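/- Let $p>1$ be an integer and let $\mathfrak g$ be the complex Lie algebra with basis $L_m$ ($m\in\mathbb Z$) and $C_i$ ($i\in\mathbb Z/p$, with $C_i$ and $C_{-i}$ identified), where the $C_i$ are central and, for $m,n\in p\mathbb Z$ and $r,s\notin p\mathbb Z$, $$[L_m,L_n]=(n-m)L_{m+n}+\delta_{m+n,0}\tfrac1{12}\Big(\big(\tfrac mp\big)^3-\tfrac mp\Big)C_0,\qquad [L_m,L_r]=rL_{m+r},\qquad [L_r,L_s]=\delta_{r+s,0}\,r\,C_{\overline r},$$ $\overline r$ denoting the residue of $r$ modulo $p$. Put $\mathfrak g_0=\mathrm{span}\{L_0,C_i\}$ and $\mathfrak g(0)=\mathrm{span}\{L_m,C_0\mid m\in p\mathbb Z\}$ (a Virasoro algebra). A $\mathfrak g$-module is *of intermediate series* if $\mathfrak g_0$ acts diagonalizably and all its weight spaces (for weights $\lambda\in\mathfrak g_0^*$) have dimension at most $1$. Let $\alpha,\beta\in\mathbb C$ and let $F=(F_{i,j})$, with $i\in\mathbb Z/p\setminus\{0\}$ and $j\in\mathbb Z/p$, be a $(p-1)\times p$ complex matrix such that (I) $F=0$,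 or $F_{i,0}\ne0$ for some $i$; (II) if $F_{i,j}\neq 0$, then $F_{s,i+j}\ne 0$ for some $s$; (III) $F_{r,i+s}F_{s,i}=F_{s,i+r}F_{r,i}$ for all $i,r,s$. Let $o(F)=\{0\}\cup\{j\mid F_{i,j}\ne0\text{ for some }i\}$. Then $V(\alpha,\beta,F)$ denotes the $\mathfrak g$-module with basis $v_n$ ($n\in\mathbb Z$, $\overline n\in o(F)$) and action $$L_mv_n=(\alpha+n+m\beta)v_{n+m}\ (m\in p\mathbb Z),\qquad L_sv_n=F_{\overline s,\overline n}\,v_{n+s}\ (s\notin p\mathbb Z),\qquad C_iv_n=0 .$$ For $a\in\mathbb C$ let $A(a)$ and $B(a)$ be the $\mathfrak g(0)$-modules with basis $v_n$ ($n\in p\mathbb Z$), on which $C_0$ acts by $0$ and $L_m$ ($m\in p\mathbb Z$) acts as follows. On $A(a)$: $L_mv_n=(m+n)v_{m+n}$ for $n\neq0$ and $L_mv_0=m(m+a)v_m$. On $B(a)$: $L_mv_n=nv_{m+n}$ for $m+n\ne0$ and $L_mv_{-m}=-m(m+a)v_0$. **Theorem.** Let $V$ be an irreducible $\mathfrak g$-module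 of intermediate series. (1) There are $\alpha,\beta\in\mathbb C$ and a matrix $F$ satisfying (I)–(III) such that $V$ is isomorphic to a subquotient of $V(\alpha,\beta,F)$ and, unless $V$ is the trivial module, every irreducible subquotient of $V(\alpha,\beta,F)$ on which $\mathfrak g$ acts nontrivially is isomorphic to $V$. (2) For $z\in\mathbb C$ let the component $V[z]$ be the sum of the eigenspaces of $L_0$ on $V$ with eigenvalues in $z+p\mathbb Z$; it is a $\mathfrak g(0)$-module. If $V$ has at least two nonzero components $V[z]\neq V[w]$ (that is, $w\notin z+p\mathbb Z$), then $V[z]$ is not isomorphic to a subquotient of $A(a)$ or of $B(a)$, for any $a\in\mathbb C$. -/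

import Mathlib

noncomputable section

/-- Indices of the central elements: residues modulo `p`, with `i` and `-i` identified. -/
def gapSetoid (p : ℕ) : Setoid (ZMod p) where
  r i j := j = i ∨ j = -i
  iseqv :=
    { refl := fun _ => Or.inl rfl
      symm := by
        rintro i j (h | h)
        · exact Or.inl h.symm
        · right; rw [h, neg_neg]
      trans := by
        rintro i j k (h | h) (h' | h') <;> subst h <;> subst h' <;> simp }

/-- The index set of the central elements `C_i`, where `C_i = C_{-i}`. -/
def GapIdx (p : ℕ) : Type := Quotient (gapSetoid p)

/-- The vector space with basis `L_m` (`m ∈ ℤ`) and `C_i` (`i ∈ ℤ/p` up to sign). -/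
def GapVir (p : ℕ) : Type := (ℤ →₀ ℂ) × (GapIdx p →₀ ℂ)

namespace GapVir

variable (p : ℕ)

instance : AddCommGroup (GapVir p) := inferInstanceAs (AddCommGroup ((ℤ →₀ ℂ) × (GapIdx p →₀ ℂ)))

instance : Module ℂ (GapVir p) := inferInstanceAs (Module ℂ ((ℤ →₀ ℂ) × (GapIdx p →₀ ℂ)))

/-- The basis vector `L_m`. -/
def L (m : ℤ) : GapVir p := ((Finsupp.single m 1, 0) : (ℤ →₀ ℂ) × (GapIdx p →₀ ℂ))

/-- The central basis vector `C_i`; by construction `C_{-i} = C_i`. -/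
def C (i : ZMod p) : GapVir p :=
  ((0, Finsupp.single (Quotient.mk (gapSetoid p) i) 1) : (ℤ →₀ ℂ) × (GapIdx p →₀ ℂ))

/-- The coordinates along the `L_m`. -/
def fstL : GapVir p →ₗ[ℂ] (ℤ →₀ ℂ) := LinearMap.fst ℂ (ℤ →₀ ℂ) (GapIdx p →₀ ℂ)

theorem C_neg (i : ZMod p) : C p (-i) = C p i := by
  have h : Quotient.mk (gapSetoid p) (-i) = Quotient.mk (gapSetoid p) i :=
    Quotient.sound (Or.inr (neg_neg i).symm)
  unfold C
  rw [h]

@[simp] theorem fstL_L (m : ℤ) : fstL p (L p m) = Finsupp.single m 1 := rfl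

@[simp] theorem fstL_C (i : ZMod p) : fstL p (C p i) = 0 := rfl

/-- The bracket of `L_m` and `L_n`; here `(m : ZMod p) = 0` says `m ∈ pℤ`. -/
def bracketLL (m n : ℤ) : GapVir p :=
  if (m : ZMod p) = 0 then
    if (n : ZMod p) = 0 then
      ((n : ℂ) - m) • L p (m + n) +
        (if m + n = 0 then (1 / 12 * (((m : ℂ) / p) ^ 3 - (m : ℂ) / p)) • C p 0 else 0)
    else (n : ℂ) • L p (m + n)
  else
    if (n : ZMod p) = 0 then -((m : ℂ) • L p (m + n))
    else if m + n = 0 then (m : ℂ) • C p (m : ZMod p) else 0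

/-- The bilinear extension of `bracketLL`. -/
def bracketMap : (ℤ →₀ ℂ) →ₗ[ℂ] (ℤ →₀ ℂ) →ₗ[ℂ] GapVir p :=
  Finsupp.linearCombination ℂ
    (fun m : ℤ => Finsupp.linearCombination ℂ (fun n : ℤ => bracketLL p m n))

@[simp] theorem bracketMap_single (m n : ℤ) :
    bracketMap p (Finsupp.single m 1) (Finsupp.single n 1) = bracketLL p m n := by
  simp [bracketMap]

theorem bracketLL_skew (m n : ℤ) : bracketLL p m n = -bracketLL p n m := by
  unfold bracketLL
  by_cases hm : (m : ZMod p) = 0 <;> by_cases hn : (n : ZMod p) = 0 <;>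
    by_cases h : m + n = 0
  · obtain rfl : n = -m := by omega
    simp only [hm, hn, if_true, add_neg_cancel, neg_add_cancel, Int.cast_neg]
    module
  · simp only [hm, hn, h, if_true, if_false, add_comm n m]
    module
  all_goals try simp only [hm, hn, if_true, if_false, add_comm n m, neg_neg]
  · obtain rfl : n = -m := by omega
    simp only [add_neg_cancel, if_true, Int.cast_neg, C_neg]
    module
  · simp [h]

@[ext] theorem hom_ext {M : Type*} [AddCommGroup M] [Module ℂ M] {f g : GapVir p →ₗ[ℂ] M}
    (hL : ∀ m, f (L p m) = g (L p m)) (hC : ∀ i, f (C p i) = g (C p i)) : f = g := by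
  have : (show ((ℤ →₀ ℂ) × (GapIdx p →₀ ℂ)) →ₗ[ℂ] M from f) = g := by
    apply LinearMap.prod_ext
    · ext m; exact hL m
    · ext i
      obtain ⟨i, rfl⟩ := Quotient.exists_rep i
      exact hC i
  exact this

instance : Bracket (GapVir p) (GapVir p) where
  bracket x y := bracketMap p (fstL p x) (fstL p y)

theorem bracket_def (x y : GapVir p) : ⁅x, y⁆ = bracketMap p (fstL p x) (fstL p y) := rfl

theorem bracket_L_L (m n : ℤ) : ⁅L p m, L p n⁆ = bracketLL p m n := by simp [bracket_def]

theorem bracketMap_skew (x y : ℤ →₀ ℂ) : bracketMap p x y = -bracketMap p y x := by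
  have : bracketMap p = -(bracketMap p).flip := by
    ext m n : 4
    simpa using bracketLL_skew p m n
  conv_lhs => rw [this]
  rfl

/-- The coefficient of `L_{m+n}` in the bracket of `L_m` and `L_n`. -/
def coef (m n : ℤ) : ℂ :=
  if (m : ZMod p) = 0 then if (n : ZMod p) = 0 then (n : ℂ) - m else n
  else if (n : ZMod p) = 0 then -(m : ℂ) else 0

theorem fstL_bracketLL (m n : ℤ) :
    fstL p (bracketLL p m n) = coef p m n • Finsupp.single (m + n) 1 := by
  unfold bracketLL coef
  by_cases hm : (m : ZMod p) = 0 <;> by_cases hn : (n : ZMod p) = 0 <;>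
    by_cases h : m + n = 0 <;> simp [hm, hn, h]

theorem jacobi_L (a b c : ℤ) :
    bracketMap p (Finsupp.single a 1) (fstL p (bracketLL p b c)) =
      bracketMap p (fstL p (bracketLL p a b)) (Finsupp.single c 1) +
        bracketMap p (Finsupp.single b 1) (fstL p (bracketLL p a c)) := by
  simp only [fstL_bracketLL, map_smul, LinearMap.smul_apply, bracketMap_single]
  have e1 : a + (b + c) = a + b + c := by ring
  have e2 : b + (a + c) = a + b + c := by ring
  by_cases h : a + b + c = 0
  · obtain rfl : c = -(a + b) := by omega
    unfold coef bracketLL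
    by_cases ha : (a : ZMod p) = 0 <;> by_cases hb : (b : ZMod p) = 0
    · simp only [e1, e2, h, ha, hb, Int.cast_add, Int.cast_neg, add_zero, neg_zero, if_true]
      module
    · simp only [e1, e2, h, ha, hb, Int.cast_add, Int.cast_neg, add_zero, zero_add, neg_zero,
        if_true, if_false, neg_eq_zero]
      module
    · simp only [e1, e2, h, ha, hb, Int.cast_add, Int.cast_neg, add_zero, zero_add, neg_zero,
        if_true, if_false, neg_eq_zero]
      module
    · by_cases hc : (a : ZMod p) + b = 0
      · obtain hb' : (b : ZMod p) = -a := by linear_combination hc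
        simp only [e1, e2, h, ha, hb', Int.cast_add, Int.cast_neg, add_zero, zero_add, neg_zero,
          if_true, if_false, neg_eq_zero, add_neg_cancel, C_neg]
        module
      · simp only [ha, hb, hc, Int.cast_add, Int.cast_neg, if_false, neg_eq_zero]
        module
  · unfold coef bracketLL
    by_cases ha : (a : ZMod p) = 0 <;> by_cases hb : (b : ZMod p) = 0 <;>
      by_cases hc : (c : ZMod p) = 0 <;>
      simp only [e1, e2, h, ha, hb, hc, Int.cast_add, add_zero, zero_add, if_true, if_false]
    all_goals module

theorem jacobi (x y z : ℤ →₀ ℂ) :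
    bracketMap p x (fstL p (bracketMap p y z)) =
      bracketMap p (fstL p (bracketMap p x y)) z +
        bracketMap p y (fstL p (bracketMap p x z)) := by
  induction x using Finsupp.induction_linear with
  | zero => simp
  | add x x' h h' => simp only [map_add, LinearMap.add_apply, h, h']; abel
  | single a r =>
  induction y using Finsupp.induction_linear with
  | zero => simp
  | add x x' h h' => simp only [map_add, LinearMap.add_apply, h, h']; abel
  | single b s =>
  induction z using Finsupp.induction_linear with
  | zero => simp
  | add x x' h h' => simp only [map_add, h, h']; abel
  | single c t =>
  rw [← mul_one r, ← mul_one s, ← mul_one t]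
  simp only [← smul_eq_mul, ← Finsupp.smul_single, map_smul, LinearMap.smul_apply,
    bracketMap_single, jacobi_L p a b c]
  module

instance : LieRing (GapVir p) where
  add_lie x y z := by simp [bracket_def]
  lie_add x y z := by simp [bracket_def]
  lie_self x := by
    have h := bracketMap_skew p (fstL p x) (fstL p x)
    have h2 : (2 : ℂ) • bracketMap p (fstL p x) (fstL p x) = 0 := by
      rw [two_smul]
      exact eq_neg_iff_add_eq_zero.mp h
    exact (smul_eq_zero.mp h2).resolve_left two_ne_zero
  leibniz_lie x y z := jacobi p _ _ _

instance : LieAlgebra ℂ (GapVir p) where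
  lie_smul t x y := by simp [bracket_def]

theorem lie_C (x : GapVir p) (i : ZMod p) : ⁅x, C p i⁆ = 0 := by simp [bracket_def]

/-- The Cartan subalgebra `𝔤₀ = span {L_0, C_i}`, as a subspace. -/
def cartan : Submodule ℂ (GapVir p) := Submodule.span ℂ ({L p 0} ∪ Set.range (C p))

/-- The Virasoro subalgebra `𝔤(0) = span {L_m, C_0 | m ∈ pℤ}`. -/
def vir : LieSubalgebra ℂ (GapVir p) where
  __ := Submodule.span ℂ ({x | ∃ m : ℤ, (m : ZMod p) = 0 ∧ x = L p m} ∪ {C p 0})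
  lie_mem' := by
    intro x y hx hy
    simp only [AddSubsemigroup.mem_carrier, AddSubmonoid.mem_toSubsemigroup,
      Submodule.mem_toAddSubmonoid] at hx hy ⊢
    induction hx, hy using Submodule.span_induction₂ with
    | mem_mem x y hx hy =>
      rcases hx with ⟨m, hm, rfl⟩ | rfl
      · rcases hy with ⟨n, hn, rfl⟩ | rfl
        · rw [bracket_L_L, bracketLL, if_pos hm, if_pos hn]
          refine add_mem (Submodule.smul_mem _ _ (Submodule.subset_span (Or.inl ⟨m + n, ?_, rfl⟩)))
            ?_
          · simp [hm, hn]
          · split_ifs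
            · exact Submodule.smul_mem _ _ (Submodule.subset_span (Or.inr rfl))
            · exact zero_mem _
        · simp [bracket_def]
      · simp [bracket_def]
    | zero_left y hy => simp
    | zero_right x hx => simp
    | add_left x y z _ _ _ h h' => rw [add_lie]; exact add_mem h h'
    | add_right x y z _ _ _ h h' => rw [lie_add]; exact add_mem h h'
    | smul_left r x y _ _ h => rw [smul_lie]; exact Submodule.smul_mem _ _ h
    | smul_right r x y _ _ h => rw [lie_smul]; exact Submodule.smul_mem _ _ h

section Weights

variable (V : Type*) [AddCommGroup V] [Module ℂ V] [LieRingModule (GapVir p) V]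
  [LieModule ℂ (GapVir p) V]

/-- The weight space `V_λ` for a linear functional `λ` on `𝔤₀`. -/
def weightSpace (lam : Module.Dual ℂ (cartan p)) : Submodule ℂ V where
  carrier := {v | ∀ a : cartan p, ⁅(a : GapVir p), v⁆ = lam a • v}
  add_mem' := by
    intro v w hv hw a
    rw [lie_add, hv a, hw a, smul_add]
  zero_mem' := by
    intro a
    simp
  smul_mem' := by
    intro c v hv a
    rw [lie_smul, hv a, smul_comm]

/-- A weight module: `𝔤₀` acts diagonalizably. -/
def IsWeightModule : Prop := ⨆ lam : Module.Dual ℂ (cartan p), weightSpace p V lam = ⊤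

/-- A module of intermediate series: a weight module whose weight spaces are at most
one-dimensional. -/
def IsIntermediateSeries : Prop :=
  IsWeightModule p V ∧ ∀ lam : Module.Dual ℂ (cartan p), Module.rank ℂ (weightSpace p V lam) ≤ 1

/-- The eigenspace of `L_0` with eigenvalue `z`. -/
def eigenL0 (z : ℂ) : Submodule ℂ V where
  carrier := {v | ⁅L p 0, v⁆ = z • v}
  add_mem' := by
    intro v w (hv : _ = _) (hw : _ = _)
    change _ = _
    rw [lie_add, hv, hw, smul_add]
  zero_mem' := by
    change _ = _
    simp
  smul_mem' := by
    intro c v (hv : _ = _)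
    change _ = _
    rw [lie_smul, hv, smul_comm]

/-- The component of `V` at `z`: the sum of the `L_0`-eigenspaces with eigenvalues in `z + pℤ`,
which is a module over the Virasoro subalgebra. -/
def component (z : ℂ) : LieSubmodule ℂ (vir p) V where
  __ := ⨆ k : ℤ, eigenL0 p V (z + p * k)
  lie_mem := by
    rintro ⟨x, hx⟩ v hv
    simp only [AddSubsemigroup.mem_carrier, AddSubmonoid.mem_toSubsemigroup,
      Submodule.mem_toAddSubmonoid] at hv ⊢
    change ⁅x, v⁆ ∈ _
    change x ∈ Submodule.span ℂ _ at hx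
    induction hx using Submodule.span_induction with
    | zero => simp
    | add x y _ _ h h' => rw [add_lie]; exact add_mem h h'
    | smul r x _ h => rw [smul_lie]; exact Submodule.smul_mem _ _ h
    | mem x hx =>
    induction hv using Submodule.iSup_induction' with
    | zero => simp
    | add x y _ _ h h' => rw [lie_add]; exact add_mem h h'
    | mem k v hv =>
    change _ = _ at hv
    rcases hx with ⟨m, hm, rfl⟩ | rfl
    · obtain ⟨l, rfl⟩ := (ZMod.intCast_zmod_eq_zero_iff_dvd m p).mp hm
      refine Submodule.mem_iSup_of_mem (k + l) ?_
      change _ = _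
      rw [leibniz_lie, hv, lie_smul, bracket_L_L, bracketLL, if_pos (by simp), if_pos hm]
      by_cases h : 0 + (p : ℤ) * l = 0
      · simp [h]
        rw [zero_add] at h
        have h' : (p : ℂ) * l = 0 := by exact_mod_cast h
        simp [h, mul_add, h']
      · simp [mul_add, ← add_smul]
        ring_nf
    · refine Submodule.mem_iSup_of_mem k ?_
      change _ = _
      rw [leibniz_lie, hv, lie_smul, lie_C, zero_lie, zero_add]

end Weights

/-! ### Modules with a basis `v_n`, `n ∈ S ⊆ ℤ`, on which `L_m v_n = c m n • v_{n+m}` and the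
centre acts by zero. -/

/-- The condition on the coefficients that makes `L_m v_n = c m n • v_{n+m}` a module structure. -/
def Compat (c : ℤ → ℤ → ℂ) : Prop :=
  ∀ m n k : ℤ, coef p m n * c (m + n) k = c n k * c m (k + n) - c m k * c n (k + m)

/-- The space with basis `v_n`, `n ∈ ℤ`. -/
def ShiftMod (c : ℤ → ℤ → ℂ) (_ : Compat p c) : Type := ℤ →₀ ℂ

namespace ShiftMod

variable (c : ℤ → ℤ → ℂ) (hc : Compat p c)

instance : AddCommGroup (ShiftMod p c hc) := inferInstanceAs (AddCommGroup (ℤ →₀ ℂ))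

instance : Module ℂ (ShiftMod p c hc) := inferInstanceAs (Module ℂ (ℤ →₀ ℂ))

/-- The basis vector `v_n`. -/
def v (n : ℤ) : ShiftMod p c hc := Finsupp.single n (1 : ℂ)

/-- The bilinear extension of `(L_m, v_n) ↦ c m n • v_{n+m}`. -/
def act : (ℤ →₀ ℂ) →ₗ[ℂ] ShiftMod p c hc →ₗ[ℂ] ShiftMod p c hc :=
  Finsupp.linearCombination ℂ
    (fun m : ℤ => Finsupp.linearCombination ℂ (fun n : ℤ => c m n • v p c hc (n + m)))

theorem act_single (m n : ℤ) :
    act p c hc (Finsupp.single m 1) (v p c hc n) = c m n • v p c hc (n + m) := by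
  have h1 : act p c hc (Finsupp.single m 1) =
      Finsupp.linearCombination ℂ (fun n : ℤ => c m n • v p c hc (n + m)) :=
    (Finsupp.linearCombination_single ℂ 1 m).trans (one_smul ℂ _)
  have h2 : Finsupp.linearCombination ℂ (fun n : ℤ => c m n • v p c hc (n + m))
      (Finsupp.single n (1 : ℂ)) = c m n • v p c hc (n + m) :=
    (Finsupp.linearCombination_single ℂ 1 n).trans (one_smul ℂ _)
  rw [h1]
  exact h2

theorem hom_ext {M : Type*} [AddCommGroup M] [Module ℂ M] {f g : ShiftMod p c hc →ₗ[ℂ] M}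
    (h : ∀ n, f (v p c hc n) = g (v p c hc n)) : f = g := by
  have : (show (ℤ →₀ ℂ) →ₗ[ℂ] M from f) = g := by
    ext n
    exact h n
  exact this

theorem act_bracketLL (m n : ℤ) (w : ShiftMod p c hc) :
    act p c hc (fstL p (bracketLL p m n)) w =
      act p c hc (Finsupp.single m 1) (act p c hc (Finsupp.single n 1) w) -
        act p c hc (Finsupp.single n 1) (act p c hc (Finsupp.single m 1) w) := by
  suffices act p c hc (fstL p (bracketLL p m n)) =
      act p c hc (Finsupp.single m 1) ∘ₗ act p c hc (Finsupp.single n 1) -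
        act p c hc (Finsupp.single n 1) ∘ₗ act p c hc (Finsupp.single m 1) by
    rw [this]
    rfl
  apply hom_ext
  intro k
  simp only [fstL_bracketLL, map_smul, LinearMap.smul_apply, LinearMap.sub_apply,
    LinearMap.comp_apply, act_single, smul_smul]
  rw [hc m n k, add_assoc k n m, add_assoc k m n, add_comm n m]
  module

theorem act_bracketMap (x y : ℤ →₀ ℂ) (w : ShiftMod p c hc) :
    act p c hc (fstL p (bracketMap p x y)) w =
      act p c hc x (act p c hc y w) - act p c hc y (act p c hc x w) := by
  induction x using Finsupp.induction_linear with
  | zero => simp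
  | add x x' h h' => simp only [map_add, LinearMap.add_apply, h, h']; abel
  | single a r =>
  induction y using Finsupp.induction_linear with
  | zero => simp
  | add x x' h h' => simp only [map_add, LinearMap.add_apply, h, h']; abel
  | single b s =>
  rw [← mul_one r, ← mul_one s]
  simp only [← smul_eq_mul, ← Finsupp.smul_single, map_smul, LinearMap.smul_apply,
    bracketMap_single, act_bracketLL]
  module

instance : LieRingModule (GapVir p) (ShiftMod p c hc) where
  bracket x w := act p c hc (fstL p x) w
  add_lie x y w := by
    change act p c hc (fstL p (x + y)) w = act p c hc (fstL p x) w + act p c hc (fstL p y) w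
    simp
  lie_add x w w' := map_add (act p c hc (fstL p x)) w w'
  leibniz_lie x y w := by
    change act p c hc (fstL p x) (act p c hc (fstL p y) w) =
      act p c hc (fstL p (bracketMap p (fstL p x) (fstL p y))) w +
        act p c hc (fstL p y) (act p c hc (fstL p x) w)
    rw [act_bracketMap, sub_add_cancel]

theorem lie_def (x : GapVir p) (w : ShiftMod p c hc) : ⁅x, w⁆ = act p c hc (fstL p x) w := rfl

instance : LieModule ℂ (GapVir p) (ShiftMod p c hc) where
  smul_lie t x w := by simp [lie_def]
  lie_smul t x w := by simp [lie_def]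

theorem L_lie_v (m n : ℤ) : ⁅L p m, v p c hc n⁆ = c m n • v p c hc (n + m) := by
  rw [lie_def, fstL_L, act_single]

theorem C_lie (i : ZMod p) (w : ShiftMod p c hc) : ⁅C p i, w⁆ = 0 := by
  simp [lie_def]

/-- The submodule spanned by the `v_n` with `n ∈ S`. -/
def sub (S : Set ℤ) (hS : ∀ m n : ℤ, n ∈ S → c m n ≠ 0 → n + m ∈ S) :
    LieSubmodule ℂ (GapVir p) (ShiftMod p c hc) where
  __ := Submodule.span ℂ (v p c hc '' S)
  lie_mem := by
    intro x w hw
    simp only [AddSubsemigroup.mem_carrier, AddSubmonoid.mem_toSubsemigroup,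
      Submodule.mem_toAddSubmonoid] at hw ⊢
    rw [lie_def]
    induction fstL p x using Finsupp.induction_linear with
    | zero => simp
    | add x y h h' => rw [map_add]; exact add_mem h h'
    | single m r =>
    rw [← mul_one r, ← smul_eq_mul, ← Finsupp.smul_single, map_smul]
    refine Submodule.smul_mem _ _ ?_
    induction hw using Submodule.span_induction with
    | zero => simp
    | add x y _ _ h h' => rw [map_add]; exact add_mem h h'
    | smul t x _ h => rw [map_smul]; exact Submodule.smul_mem _ _ h
    | mem w hw =>
    obtain ⟨n, hn, rfl⟩ := hw
    rw [act_single]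
    by_cases h0 : c m n = 0
    · simp [h0]
    · exact Submodule.smul_mem _ _ (Submodule.subset_span ⟨_, hS m n hn h0, rfl⟩)

end ShiftMod

/-! ### The modules `V(α,β,F)` -/

variable {p}

/-- The index set `o(F)` of the components of `V(α,β,F)`: the residues `j` whose column of `F` is
nonzero, together with `0`. -/
def supp (F : Matrix {i : ZMod p // i ≠ 0} (ZMod p) ℂ) : Set (ZMod p) :=
  {j | j = 0 ∨ ∃ i, F i j ≠ 0}

/-- The three conditions on a `(p-1) × p` matrix with rows indexed by the nonzero residues
modulo `p` and columns by all residues. The matrix `F = 0` is allowed: it stands for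
`o(F) = {0}`. -/
structure Admissible (F : Matrix {i : ZMod p // i ≠ 0} (ZMod p) ℂ) : Prop where
  condI : F = 0 ∨ ∃ i, F i 0 ≠ 0
  condII : ∀ i j, F i j ≠ 0 → ∃ s, F s (i + j) ≠ 0
  condIII : ∀ (r s : {i : ZMod p // i ≠ 0}) (i : ZMod p),
    F r (i + s) * F s i = F s (i + r) * F r i

/-- `L_m v_n = (α + n + mβ) v_{n+m}` for `m ∈ pℤ`, and `L_s v_n = F_{s,n} v_{n+s}` for `s ∉ pℤ`. -/
def seriesCoeff (α β : ℂ) (F : Matrix {i : ZMod p // i ≠ 0} (ZMod p) ℂ) (m n : ℤ) : ℂ :=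
  if h : (m : ZMod p) = 0 then α + n + m * β else F ⟨m, h⟩ n

theorem seriesCoeff_compat (α β : ℂ) {F : Matrix {i : ZMod p // i ≠ 0} (ZMod p) ℂ}
    (hF : Admissible F) : Compat p (seriesCoeff α β F) := by
  intro m n k
  unfold seriesCoeff coef
  by_cases hm : (m : ZMod p) = 0 <;> by_cases hn : (n : ZMod p) = 0
  · simp [hm, hn]
    ring
  · simp [hm, hn]
    ring
  · simp [hm, hn]
    ring
  · simp only [hm, hn, if_false, dif_neg, not_false_iff, zero_mul, Int.cast_add]
    have := hF.condIII ⟨m, hm⟩ ⟨n, hn⟩ k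
    simp only at this
    rw [mul_comm, this]
    ring

variable (p)

/-- The module `V(α,β,F) = ⨁_{j ∈ o(F)} V_(j)`, where `V_(j)` has basis `v_n`, `n ∈ j + pℤ`. -/
def series (α β : ℂ) (F : Matrix {i : ZMod p // i ≠ 0} (ZMod p) ℂ) (hF : Admissible F) :
    LieSubmodule ℂ (GapVir p) (ShiftMod p (seriesCoeff α β F) (seriesCoeff_compat α β hF)) :=
  ShiftMod.sub p (seriesCoeff α β F) (seriesCoeff_compat α β hF) {n | (n : ZMod p) ∈ supp F} (by
    intro m n hn h
    simp only [Set.mem_ofPred_eq, Int.cast_add]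
    unfold seriesCoeff at h
    by_cases hm : (m : ZMod p) = 0
    · simpa [hm] using hn
    · rw [dif_neg hm] at h
      obtain ⟨s, hs⟩ := hF.condII _ _ h
      exact Or.inr ⟨s, by rwa [add_comm]⟩)

/-! ### The Virasoro modules of type `A` and `B`, extended to `𝔤` by letting `L_s` act by zero
for `s ∉ pℤ`. They have a basis `v_n`, `n ∈ pℤ`. -/

/-- `L_m v_n = (m + n) v_{n+m}` for `n ≠ 0`, and `L_m v_0 = m (m + a) v_m`. -/
def coeffA (a : ℂ) (m n : ℤ) : ℂ :=
  if (m : ZMod p) = 0 then if n ≠ 0 then (m : ℂ) + n else m * (m + a) else 0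

/-- `L_m v_n = n v_{n+m}` for `m + n ≠ 0`, and `L_m v_{-m} = -m (m + a) v_0`. -/
def coeffB (a : ℂ) (m n : ℤ) : ℂ :=
  if (m : ZMod p) = 0 then if m + n ≠ 0 then (n : ℂ) else -(m * (m + a)) else 0

theorem coeffA_compat (a : ℂ) : Compat p (coeffA p a) := by
  intro m n k
  unfold coeffA coef
  by_cases hm : (m : ZMod p) = 0 <;> by_cases hn : (n : ZMod p) = 0
  · simp only [hm, hn, if_true, Int.cast_add, add_zero]
    by_cases hk : k = 0
    · subst hk
      by_cases h1 : n = 0 <;> by_cases h2 : m = 0 <;> simp [h1, h2] <;> ring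
    · by_cases h1 : k + n = 0 <;> by_cases h2 : k + m = 0
      · obtain rfl : n = -k := by omega
        obtain rfl : m = -k := by omega
        simp [hk]
      · obtain rfl : n = -k := by omega
        simp [hk, h2] <;> ring
      · obtain rfl : m = -k := by omega
        simp [hk, h1] <;> ring
      · simp [hk, h1, h2] <;> ring
  all_goals simp [hm, hn]

theorem coeffB_compat (a : ℂ) : Compat p (coeffB p a) := by
  intro m n k
  unfold coeffB coef
  by_cases hm : (m : ZMod p) = 0 <;> by_cases hn : (n : ZMod p) = 0
  · simp only [hm, hn, if_true, Int.cast_add, add_zero]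
    by_cases hk : m + n + k = 0
    · obtain rfl : k = -(m + n) := by omega
      have e1 : m + (-(m + n) + n) = 0 := by ring
      have e2 : n + (-(m + n) + m) = 0 := by ring
      by_cases h1 : n = 0
      · subst h1
        by_cases h2 : m = 0 <;> simp [h2]
      · by_cases h2 : m = 0
        · subst h2
          simp [h1]
        · simp [h1, h2, e1, e2]
          ring
    · have e1 : m + (k + n) ≠ 0 := by omega
      have e2 : n + (k + m) ≠ 0 := by omega
      by_cases h1 : n + k = 0 <;> by_cases h2 : m + k = 0
      · obtain rfl : n = -k := by omega
        obtain rfl : m = -k := by omega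
        simp
      · obtain rfl : n = -k := by omega
        have h0 : m ≠ 0 := by omega
        simp [h0, h2]
        ring
      · obtain rfl : m = -k := by omega
        have h0 : n ≠ 0 := by omega
        simp [h0, h1]
        ring
      · simp [hk, h1, h2, e1, e2]
        ring
  all_goals simp [hm, hn]

/-- The module `A(a)`. -/
def typeA (a : ℂ) : LieSubmodule ℂ (GapVir p) (ShiftMod p (coeffA p a) (coeffA_compat p a)) :=
  ShiftMod.sub p (coeffA p a) (coeffA_compat p a) {n | (n : ZMod p) = 0} (by
    intro m n hn h
    have hm : (m : ZMod p) = 0 := by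
      by_contra hm
      exact h (if_neg hm)
    simp only [Set.mem_ofPred_eq] at hn ⊢
    simp [hm, hn])

/-- The module `B(a)`. -/
def typeB (a : ℂ) : LieSubmodule ℂ (GapVir p) (ShiftMod p (coeffB p a) (coeffB_compat p a)) :=
  ShiftMod.sub p (coeffB p a) (coeffB_compat p a) {n | (n : ZMod p) = 0} (by
    intro m n hn h
    have hm : (m : ZMod p) = 0 := by
      by_contra hm
      exact h (if_neg hm)
    simp only [Set.mem_ofPred_eq] at hn ⊢
    simp [hm, hn])

end GapVir

/-- `V` is isomorphic to a subquotient (a quotient of a submodule) of `W`. -/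
def IsLieSubquotient (𝔤 : Type*) [LieRing 𝔤] [LieAlgebra ℂ 𝔤]
    (V : Type*) [AddCommGroup V] [Module ℂ V] [LieRingModule 𝔤 V] [LieModule ℂ 𝔤 V]
    (W : Type*) [AddCommGroup W] [Module ℂ W] [LieRingModule 𝔤 W] [LieModule ℂ 𝔤 W] : Prop :=
  ∃ (N : LieSubmodule ℂ 𝔤 W) (K : LieSubmodule ℂ 𝔤 N), Nonempty (V ≃ₗ⁅ℂ, 𝔤⁆ (N ⧸ K))

end

/-! For an index $s\notin p\mathbb Z$, call $s$ active if some $L_t$ with $t\equiv s$ modulo $p$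
acts nontrivially. Everything turns on whether an active index exists.

If none exists, $V$ is in effect an irreducible Virasoro module with weight spaces of dimension at
most one. If its weights are bounded on both sides, it is trivial. Otherwise, after a reflection if
necessary, $E_1$ is injective on all sufficiently high weights and produces a ladder of weight
vectors. The structure constants of $E_{\pm1},E_{\pm2}$ along it have closed polynomial forms, and
one polynomial identity forces the central charge to vanish and the constants to be those of a
tensor density module (`density_structure_constants`). The diagonal ladder in $M\times V$, with
$M=V(\alpha,\beta,0)$, then generates a subrepresentation that is the graph of a surjection from a
submodule of $M$ onto $V$ (`exists_cover_of_ladder`). Uniqueness of the nontrivial subquotient holds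
because a submodule of $V(\alpha,\beta,0)$ either contains the image of $L_0$ or is killed by $L_0$
(`density_submodule_dichotomy`).

If an active index exists, the first point is that $C_i$ acts by zero for $i\ne0$
(`central_eq_zero`). Otherwise each pair $L_{\pm t}$ in the class is a Heisenberg pair, one member
of which has no power killing a chosen weight vector. Among three pairs two agree in direction;
suitable powers of these two operators reach the same weight line, where $L_{-t}L_t$ would have two
different eigenvalues. Hence all $L_s$ with $s\notin p\mathbb Z$ commute, and irreducibility makes
active ones bijective (`eq_zero_of_op_eq_zero`, `op_surjective`). The operator $L_{s+p}L_s^{-1}$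
commutes with every $L_r$, $r\notin p\mathbb Z$, and shifts weights by $p$. In a basis adapted to it
the coefficients of active $L_s$ depend only on residues, while $L_m$, $m\in p\mathbb Z$, has
coefficient $n+h(m)$ with $h$ affine (`exists_series_coefficients`). So $V\cong V(\alpha,\beta,F)$,
which is then its own only irreducible subquotient.

For the second claim, two distinct components force an active index, so each nonzero component is a
full tensor density module; comparing a few coefficients excludes $A(a)$ and $B(a)$. -/

/-! ### Virasoro representations: generalities -/

/-- The operators `E m` define a representation of the Virasoro algebra with central charge `c`. -/
def IsVirRep {V : Type*} [AddCommGroup V] [Module ℂ V] (E : ℤ → Module.End ℂ V) (c : ℂ) : Prop :=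
  ∀ (m n : ℤ) (x : V), E m (E n x) = E n (E m x) + ((n : ℂ) - m) • E (m + n) x +
    (if m + n = 0 then ((m : ℂ) ^ 3 - m) / 12 * c else 0) • x

namespace IsVirRep

section General

variable {V : Type*} [AddCommGroup V] [Module ℂ V] {E : ℤ → Module.End ℂ V} {c : ℂ}

theorem weight_shift (hE : IsVirRep E c) {a : ℂ} {x : V} (hx : E 0 x = a • x) (m : ℤ) :
    E 0 (E m x) = (a + m) • E m x := by
  rw [hE 0 m x, hx]
  simp [add_smul]

/-- The reflection `E m ↦ -E (-m)` of a Virasoro representation. -/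
theorem reflect (hE : IsVirRep E c) : IsVirRep (fun m => -E (-m)) (-c) := by
  intro m n x
  have := hE (-m) (-n) x
  simp only [LinearMap.neg_apply, map_neg, neg_neg, this, neg_add]
  by_cases h : m + n = 0
  · have h' : -m + -n = 0 := by omega
    simp only [h, h', if_true, Int.cast_neg]
    module
  · have h' : -m + -n ≠ 0 := by omega
    simp only [h, h', if_false, Int.cast_neg]
    module

theorem prod {W : Type*} [AddCommGroup W] [Module ℂ W] {D : ℤ → Module.End ℂ W}
    (hE : IsVirRep E c) (hD : IsVirRep D c) : IsVirRep (fun m => (D m).prodMap (E m)) c :=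
  fun m n x => Prod.ext (hD m n x.1) (hE m n x.2)

/-- A subspace stable under the raising operators generates, by means of the lowering operators,
a subrepresentation. -/
theorem exists_stable_between (hE : IsVirRep E c) {R₀ R' : Submodule ℂ V} (h₀ : R₀ ≤ R')
    (hraise : ∀ m : ℤ, 0 ≤ m → ∀ x ∈ R₀, E m x ∈ R₀)
    (hlower : ∀ m : ℤ, m < 0 → ∀ x ∈ R', E m x ∈ R') :
    ∃ R : Submodule ℂ V, R₀ ≤ R ∧ R ≤ R' ∧ ∀ m, ∀ x ∈ R, E m x ∈ R := by
  let R : Submodule ℂ V := sInf {S | R₀ ≤ S ∧ ∀ m : ℤ, m < 0 → ∀ x ∈ S, E m x ∈ S}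
  have hR₀ : R₀ ≤ R := le_sInf fun S hS => hS.1
  have hRlow : ∀ m : ℤ, m < 0 → ∀ x ∈ R, E m x ∈ R := by
    intro m hm x hx
    rw [Submodule.mem_sInf] at hx ⊢
    exact fun S hS => hS.2 m hm x (hx S hS)
  -- `S` is again stable under lowering: a raising operator commuted past a lowering one leaves a
  -- single operator of known sign and a scalar. Minimality of `R` then gives `R ≤ S`.
  let S : Submodule ℂ V :=
    { carrier := {x | x ∈ R ∧ ∀ m : ℤ, 0 ≤ m → E m x ∈ R}
      add_mem' := fun {x y} hx hy => ⟨add_mem hx.1 hy.1, fun m hm => by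
        rw [map_add]; exact add_mem (hx.2 m hm) (hy.2 m hm)⟩
      zero_mem' := ⟨zero_mem _, fun m _ => by simp⟩
      smul_mem' := fun t x hx => ⟨R.smul_mem t hx.1, fun m hm => by
        rw [map_smul]; exact R.smul_mem t (hx.2 m hm)⟩ }
  have hS : R ≤ S := by
    refine sInf_le ⟨fun x hx => ⟨hR₀ hx, fun m hm => hR₀ (hraise m hm x hx)⟩, ?_⟩
    rintro a ha x ⟨hx, hx'⟩
    refine ⟨hRlow a ha x hx, fun m hm => ?_⟩
    rw [hE m a x]
    refine add_mem (add_mem (hRlow a ha _ (hx' m hm)) (R.smul_mem _ ?_)) (R.smul_mem _ hx)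
    rcases lt_or_ge (m + a) 0 with h | h
    · exact hRlow _ h x hx
    · exact hx' _ h
  refine ⟨R, hR₀, sInf_le ⟨h₀, hlower⟩, fun m x hx => ?_⟩
  rcases lt_or_ge m 0 with h | h
  · exact hRlow m h x hx
  · exact (hS hx).2 m h

end General

end IsVirRep

/-- An eigenvector can be separated from all eigenvectors with other eigenvalues by a linear
functional. -/
theorem Module.End.exists_dual_of_eigenvector {V : Type*} [AddCommGroup V] [Module ℂ V]
    (H : Module.End ℂ V) {a : ℂ} {u : V} (hu : H u = a • u) (h0 : u ≠ 0) :
    ∃ l : V →ₗ[ℂ] ℂ, l u = 1 ∧ ∀ (b : ℂ) (x : V), b ≠ a → H x = b • x → l x = 0 := by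
  have hind := Module.End.eigenspaces_iSupIndep H
  have hdis := hind a
  set U := ⨆ b, ⨆ (_ : b ≠ a), H.eigenspace b
  have hnot : u ∉ U := fun h => h0 <| by
    have := Submodule.disjoint_def.mp hdis u (Module.End.mem_eigenspace_iff.mpr hu) h
    exact this
  obtain ⟨f, hf, hU⟩ := Submodule.exists_le_ker_of_notMem hnot
  refine ⟨(f u)⁻¹ • f, by simp [hf], fun b x hb hx => ?_⟩
  have : x ∈ U := Submodule.mem_iSup_of_mem b
    (Submodule.mem_iSup_of_mem hb (Module.End.mem_eigenspace_iff.mpr hx))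
  have := hU this
  simp only [LinearMap.mem_ker] at this
  simp [this]

/-! ### Structure constants along a ladder -/

/-- A polynomial of degree at most five vanishing on an arithmetic progression is zero. -/
theorem quintic_coeffs_eq_zero {a₀ a₁ a₂ a₃ a₄ a₅ u : ℂ}
    (h : ∀ i : ℕ, a₅ * (u + 2 * i) ^ 5 + a₄ * (u + 2 * i) ^ 4 + a₃ * (u + 2 * i) ^ 3 +
      a₂ * (u + 2 * i) ^ 2 + a₁ * (u + 2 * i) + a₀ = 0) :
    a₀ = 0 ∧ a₁ = 0 ∧ a₂ = 0 ∧ a₃ = 0 ∧ a₄ = 0 ∧ a₅ = 0 := by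
  open Polynomial in
  let P : ℂ[X] := C a₅ * X ^ 5 + C a₄ * X ^ 4 + C a₃ * X ^ 3 + C a₂ * X ^ 2 + C a₁ * X + C a₀
  have hP : P = 0 := by
    apply Polynomial.eq_zero_of_infinite_isRoot
    have hinj : Function.Injective fun i : ℕ => u + 2 * (i : ℂ) := by
      intro i j hij
      simpa using hij
    refine (Set.infinite_range_of_injective hinj).mono ?_
    rintro _ ⟨i, rfl⟩
    simpa [P] using h i
  have hc (k : ℕ) : P.coeff k = 0 := by rw [hP, Polynomial.coeff_zero]
  have h0 := hc 0
  have h1 := hc 1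
  have h2 := hc 2
  have h3 := hc 3
  have h4 := hc 4
  have h5 := hc 5
  simp [P, Polynomial.coeff_X, Polynomial.coeff_C] at h0 h1 h2 h3 h4 h5
  exact ⟨h0, h1, h2, h3, h4, h5⟩

/-- The structure constants of a sequence on which `E 1` acts as a shift are those of a
tensor density module. -/
theorem density_structure_constants {t c : ℂ} {q y z : ℕ → ℂ}
    (hq : ∀ j : ℕ, q (j + 1) = q j + 2 * (t + j + 1))
    (hy : ∀ j : ℕ, q (j + 2) * y (j + 1) = q j * y j + 3)
    (hz : ∀ j : ℕ, z (j + 1) = z j + 3 * q (j + 1))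
    (hyz : ∀ j : ℕ, y (j + 2) * z (j + 2) = y j * z j + 4 * (t + j + 2) - c / 2) :
    c = 0 ∧ ∃ β : ℂ, ∀ j : ℕ,
      q j = (t + j + β) * (t + j + 1 - β) ∧
      y j * (q j * q (j + 1)) = (t + j + 2 * β) * (t + j + 1 - β) * (t + j + 2 - β) ∧
      z j = (t + j + 2 - 2 * β) * (t + j + 1 + β) * (t + j + β) := by
  -- `w`, `C`, `C'` and `γ` are the constants of integration of the four recursions. The one for `y
  -- * z` advances by two, so its closed form is used at even indices only.
  obtain ⟨w, hw⟩ : ∃ w, w = q 0 - t ^ 2 - t := ⟨_, rfl⟩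
  have hq' (j : ℕ) : q j = (t + j) ^ 2 + (t + j) + w := by
    induction j with
    | zero => simp [hw]
    | succ j ih => rw [hq, ih]; push_cast; ring
  obtain ⟨C, hC⟩ : ∃ C, C = y 0 * (q 0 * q 1) - (t + 1) ^ 3 - (3 * w - 1) * (t + 1) := ⟨_, rfl⟩
  have hY (j : ℕ) : y j * (q j * q (j + 1)) =
      (t + j + 1) ^ 3 + (3 * w - 1) * (t + j + 1) + C := by
    induction j with
    | zero => simp [hC]
    | succ j ih =>
      have e : y (j + 1) * (q (j + 1) * q (j + 1 + 1)) = q (j + 1) * (q (j + 2) * y (j + 1)) := by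
        ring
      rw [e, hy, mul_add, ← mul_assoc, show q (j + 1) * q j * y j = y j * (q j * q (j + 1)) by ring,
        ih, hq']
      push_cast
      ring
  obtain ⟨C', hC'⟩ : ∃ C', C' = z 0 - (t + 1) ^ 3 - (3 * w - 1) * (t + 1) := ⟨_, rfl⟩
  have hZ (j : ℕ) : z j = (t + j + 1) ^ 3 + (3 * w - 1) * (t + j + 1) + C' := by
    induction j with
    | zero => simp [hC']
    | succ j ih => rw [hz, ih, hq']; push_cast; ring
  obtain ⟨γ, hγ⟩ : ∃ γ, γ = y 0 * z 0 - (t + 1) ^ 2 + c / 4 * (t + 1) := ⟨_, rfl⟩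
  have hG (i : ℕ) : y (2 * i) * z (2 * i) =
      (t + 1 + 2 * i) ^ 2 - c / 4 * (t + 1 + 2 * i) + γ := by
    induction i with
    | zero => simp [hγ]
    | succ i ih =>
      rw [show 2 * (i + 1) = 2 * i + 2 by ring, hyz, ih]
      push_cast
      ring
  -- Two computations of $y\,z\,q\,q'$ give monic sextics in $t+1+2i$ that agree for every `i`, so
  -- their difference is a quintic with all coefficients zero.
  obtain ⟨e0, e1, -, e3, e4, e5⟩ := quintic_coeffs_eq_zero
    (a₀ := γ * w ^ 2 - C * C') (a₁ := -(c / 4) * w ^ 2 - (3 * w - 1) * (C + C'))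
    (a₂ := w ^ 2 + γ * (2 * w - 1) - (3 * w - 1) ^ 2)
    (a₃ := -(c / 4) * (2 * w - 1) - (C + C')) (a₄ := γ + (2 * w - 1) - 2 * (3 * w - 1))
    (a₅ := -(c / 4)) (u := t + 1) (by
      intro i
      have h1 := hG i
      have h2 := hY (2 * i)
      have h3 := hZ (2 * i)
      have h4 : (y (2 * i) * z (2 * i)) * (q (2 * i) * q (2 * i + 1)) =
        (y (2 * i) * (q (2 * i) * q (2 * i + 1))) * z (2 * i) := by ring
      rw [h1, h2, h3, hq', hq'] at h4
      push_cast at h4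
      linear_combination h4)
  have hc : c = 0 := by linear_combination -4 * e5
  subst hc
  have hCC : C' = -C := by linear_combination -e3
  subst hCC
  have hγ' : γ = 4 * w - 1 := by linear_combination e4
  have hC2 : C ^ 2 = w ^ 2 * (1 - 4 * w) := by rw [hγ'] at e0; linear_combination e0
  -- The cubic $C^2=w^2(1-4w)$ is rational, with parameter $1-2\beta=C/w$; at the singular point `w
  -- = 0` the choice `β = 0` works.
  obtain ⟨β, hβ, hβC⟩ : ∃ β, β * (1 - β) = w ∧ β * (1 - β) * (1 - 2 * β) = C := by
    by_cases h0 : w = 0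
    · refine ⟨0, by simp [h0], ?_⟩
      rw [h0] at hC2
      simp only [ne_eq, OfNat.ofNat_ne_zero, not_false_eq_true, zero_pow, zero_mul,
        pow_eq_zero_iff] at hC2
      simp [hC2]
    · have h1 : (C / w) ^ 2 = 1 - 4 * w := by
        rw [div_pow, hC2]; field_simp
      have h2 : (1 - C / w) / 2 * (1 - (1 - C / w) / 2) = w := by linear_combination -h1 / 4
      refine ⟨(1 - C / w) / 2, h2, ?_⟩
      rw [h2]
      field_simp
      ring
  refine ⟨rfl, β, fun j => ⟨?_, ?_, ?_⟩⟩
  · rw [hq', ← hβ]; ring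
  · rw [hY, ← hβC, ← hβ]; ring
  · rw [hZ, ← hβC, ← hβ]; ring

/-! ### Weight families and bounded weights -/

/-- A family of vectors `v n` such that `v n` spans the eigenspace of `H` with eigenvalue `a + n`
(and may be zero), and which spans the whole space. -/
structure IsWeightFamily {V : Type*} [AddCommGroup V] [Module ℂ V] (H : Module.End ℂ V) (a : ℂ)
    (v : ℤ → V) : Prop where
  eig : ∀ n : ℤ, H (v n) = (a + n) • v n
  mult : ∀ (n : ℤ) (x : V), H x = (a + n) • x → ∃ t : ℂ, x = t • v n
  span : Submodule.span ℂ (Set.range v) = ⊤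

namespace IsVirRep

variable {V : Type*} [AddCommGroup V] [Module ℂ V] {E : ℤ → Module.End ℂ V} {c a : ℂ} {v : ℤ → V}

theorem exists_smul (hE : IsVirRep E c) (hv : IsWeightFamily (E 0) a v) (m n : ℤ) :
    ∃ t : ℂ, E m (v n) = t • v (n + m) := by
  apply hv.mult
  rw [hE.weight_shift (hv.eig n)]
  push_cast
  rw [add_assoc]

/-- The usual $\mathfrak{sl}_2$ computation on a vector killed by `E 1`; the central term is absent
because $m^3-m=0$ at $m=1$. -/
theorem raise_lower_pow (hE : IsVirRep E c) {b : ℂ} {x : V} (hx : E 0 x = b • x)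
    (h1 : E 1 x = 0) (k : ℕ) :
    E 0 ((E (-1) ^ k) x) = (b - k) • (E (-1) ^ k) x ∧
      E 1 ((E (-1) ^ (k + 1)) x) = (-((k + 1 : ℂ) * (2 * b - k))) • (E (-1) ^ k) x := by
  have h0 (k : ℕ) : E 0 ((E (-1) ^ k) x) = (b - k) • (E (-1) ^ k) x := by
    induction k with
    | zero => simp [hx]
    | succ k ih =>
      rw [pow_succ', Module.End.mul_apply, hE.weight_shift ih]
      push_cast
      congr 1
      ring
  refine ⟨h0 k, ?_⟩
  induction k with
  | zero =>
    have := hE 1 (-1) x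
    simp only [h1, hx, map_zero, Int.reduceNeg, add_neg_cancel, if_true] at this
    simp only [zero_add, pow_one, pow_zero, Module.End.one_apply, Int.reduceNeg]
    rw [this]
    push_cast
    module
  | succ k ih =>
    have := hE 1 (-1) ((E (-1) ^ (k + 1)) x)
    rw [ih, map_smul, ← Module.End.mul_apply (E (-1)), ← pow_succ', ← Module.End.mul_apply (E (-1)),
      ← pow_succ'] at this
    rw [this]
    simp only [Int.reduceNeg, add_neg_cancel, if_true, h0]
    push_cast
    module

/-- If the weights are unbounded above, then `E 1` is eventually injective. -/
theorem exists_forall_raise_ne_zero (hE : IsVirRep E c) (hv : IsWeightFamily (E 0) a v)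
    (hub : ∀ N : ℤ, ∃ n, N ≤ n ∧ v n ≠ 0) :
    ∃ N : ℤ, ∀ n, N ≤ n → v n ≠ 0 ∧ E 1 (v n) ≠ 0 := by
  obtain ⟨N₀, hN₀⟩ : ∃ N : ℤ, -a.re ≤ N := ⟨⌈-a.re⌉, Int.le_ceil _⟩
  -- `E 1` kills at most one nonzero `v n` with `n ≥ N₀`. Descending from `v n'` by `E (-1)` down to
  -- weight index `n`, the factors $2b-j$ keep positive real part, so `E 1` does not kill the vector
  -- reached there, a multiple of `v n`.
  have key (n n' : ℤ) (h0 : N₀ ≤ n) (hlt : n < n') (hn : v n ≠ 0) (hn' : v n' ≠ 0)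
      (h1 : E 1 (v n) = 0) (h1' : E 1 (v n') = 0) : False := by
    obtain ⟨k, hk⟩ := Int.eq_ofNat_of_zero_le (show 0 ≤ n' - n by omega)
    have hne (j : ℕ) (hj : j ≤ k) : (E (-1) ^ j) (v n') ≠ 0 := by
      induction j with
      | zero => simpa using hn'
      | succ j ih =>
        intro h
        have h2 := (hE.raise_lower_pow (hv.eig n') h1' j).2
        rw [h, map_zero, eq_comm, smul_eq_zero] at h2
        rcases h2 with h2 | h2
        · rw [neg_eq_zero, mul_eq_zero] at h2
          rcases h2 with h2 | h2
          · exact absurd h2 (by exact_mod_cast Nat.succ_ne_zero j)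
          · have h3 := congrArg Complex.re h2
            simp at h3
            have h4 : ((j : ℝ) + 1) ≤ k := by exact_mod_cast hj
            have h5 : (n' : ℝ) - n = k := by exact_mod_cast hk
            have h6 : (N₀ : ℝ) ≤ n := by exact_mod_cast h0
            have h7 : (n : ℝ) + 1 ≤ n' := by exact_mod_cast hlt
            linarith
        · exact ih (by omega) h2
    have hk1 : k ≠ 0 := by rintro rfl; simp at hk; omega
    obtain ⟨k, rfl⟩ := Nat.exists_eq_succ_of_ne_zero hk1
    have h2 := (hE.raise_lower_pow (hv.eig n') h1' (k + 1)).1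
    obtain ⟨t, ht⟩ := hv.mult n ((E (-1) ^ (k + 1)) (v n')) (by
      rw [h2]
      congr 1
      have : (n' : ℂ) - n = (k + 1 : ℕ) := by exact_mod_cast hk
      rw [← this]; ring)
    have h3 := (hE.raise_lower_pow (hv.eig n') h1' k).2
    rw [ht, map_smul, h1, smul_zero, eq_comm, smul_eq_zero, or_iff_left (hne k (by omega)),
      neg_eq_zero, mul_eq_zero] at h3
    rcases h3 with h3 | h3
    · exact absurd h3 (by exact_mod_cast Nat.succ_ne_zero k)
    · have h3 := congrArg Complex.re h3
      simp at h3
      have h5 : (n' : ℝ) - n = k + 1 := by exact_mod_cast hk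
      have h6 : (N₀ : ℝ) ≤ n := by exact_mod_cast h0
      linarith
  obtain ⟨N₁, h01, hN₁⟩ : ∃ N₁, N₀ ≤ N₁ ∧ ∀ n, N₁ ≤ n → v n ≠ 0 → E 1 (v n) ≠ 0 := by
    by_cases hex : ∃ n, N₀ ≤ n ∧ v n ≠ 0 ∧ E 1 (v n) = 0
    · obtain ⟨n, h0, hn, h1⟩ := hex
      exact ⟨n + 1, by omega, fun n' hle hn' h1' => key n n' h0 (by omega) hn hn' h1 h1'⟩
    · push Not at hex
      exact ⟨N₀, le_rfl, fun n hn h => hex n hn h⟩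
  obtain ⟨N, hN, hvN⟩ := hub N₁
  refine ⟨N, fun n hn => ?_⟩
  suffices v n ≠ 0 from ⟨this, hN₁ n (by omega) this⟩
  induction n, hn using Int.leInduction with
  | base => exact hvN
  | succ n hn ih =>
    intro h
    obtain ⟨t, ht⟩ := hE.exists_smul hv 1 n
    rw [h, smul_zero] at ht
    exact hN₁ n (by omega) ih ht

/-- A Virasoro representation with finitely many one-dimensional weight spaces is trivial. -/
theorem eq_zero_of_bounded (hE : IsVirRep E c) (hv : IsWeightFamily (E 0) a v) {N : ℤ}
    (hN : ∀ n, v n ≠ 0 → |n| ≤ N) (m : ℤ) : E m = 0 := by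
  have hN' (n : ℤ) (h : N < |n|) : v n = 0 := by
    by_contra h'
    have := hN n h'
    omega
  have hbig (m : ℤ) (hm : 2 * N < |m|) : E m = 0 := by
    refine LinearMap.ext_on_range hv.span fun n => ?_
    by_cases h : N < |n|
    · rw [hN' n h, map_zero, map_zero]
    · obtain ⟨t, ht⟩ := hE.exists_smul hv m n
      rw [LinearMap.zero_apply, ht, hN' (n + m), smul_zero]
      have := abs_sub_abs_le_abs_sub m (-n)
      simp only [abs_neg, sub_neg_eq_add] at this
      rw [add_comm]
      omega
  have hne (m : ℤ) (hm : m ≠ 0) : E m = 0 := by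
    ext x
    -- Up to a nonzero factor `E m` is the commutator of `E k` and `E (m - k)`, whose indices are
    -- both too large for the finite set of weights.
    obtain ⟨k, hk⟩ : ∃ k : ℤ, k = 2 * |N| + |m| + 1 := ⟨_, rfl⟩
    have := abs_nonneg N
    have := le_abs_self N
    have := le_abs_self m
    have := neg_abs_le m
    have h := hE k (m - k) x
    rw [hbig k (by rw [abs_of_nonneg] <;> omega),
      hbig (m - k) (by rw [abs_of_nonpos] <;> omega), if_neg (by omega)] at h
    simp only [LinearMap.zero_apply, zero_add, zero_smul, add_zero, add_sub_cancel] at h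
    refine (smul_eq_zero.mp h.symm).resolve_left ?_
    have : m - k - k ≠ 0 := by omega
    exact_mod_cast this
  by_cases hm : m = 0
  · subst hm
    ext x
    have h1 := hE 1 (-1) x
    have h2 := hE 2 (-2) x
    rw [hne 1 (by decide), hne (-1) (by decide)] at h1
    simp only [LinearMap.zero_apply, Int.reduceNeg, add_neg_cancel, if_true] at h1
    have h3 : (-2 : ℂ) • E 0 x = 0 := by
      rw [h1]
      push_cast
      module
    exact (smul_eq_zero.mp h3).resolve_left (by norm_num)
  · exact hne m hm

end IsVirRep

/-! ### Ladders and the graph construction -/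

namespace IsVirRep

section Ladder

variable {W : Type*} [AddCommGroup W] [Module ℂ W] {P : ℤ → Module.End ℂ W} {c : ℂ} {ρ : ℕ → W}

/-- If `E (±1)` and `E (±2)` move a sequence `ρ` along itself, then so do all `E m`. -/
theorem ladder (hP : IsVirRep P c) (h1 : ∀ j, ∃ t : ℂ, P 1 (ρ j) = t • ρ (j + 1))
    (h1' : ∀ j, ∃ t : ℂ, P (-1) (ρ (j + 1)) = t • ρ j)
    (h2 : ∀ j, ∃ t : ℂ, P 2 (ρ j) = t • ρ (j + 2))
    (h2' : ∀ j, ∃ t : ℂ, P (-2) (ρ (j + 2)) = t • ρ j) (k : ℕ) :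
    (∀ j, ∃ t : ℂ, P (k + 1 : ℕ) (ρ j) = t • ρ (j + (k + 1))) ∧
      ∀ j, ∃ t : ℂ, P (-(k + 1 : ℕ)) (ρ (j + (k + 1))) = t • ρ j := by
  induction k with
  | zero => exact ⟨by simpa using h1, by simpa using h1'⟩
  | succ k ih =>
  -- $[E_1,E_{k+1}]=k\,E_{k+2}$ is useless at $k=0$, which is why $E_{\pm2}$ must be given
  -- separately.
  rcases Nat.eq_zero_or_pos k with rfl | hk
  · exact ⟨h2, h2'⟩
  have hk' : (k : ℂ) ≠ 0 := by exact_mod_cast hk.ne'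
  refine ⟨fun j => ?_, fun j => ?_⟩
  · have h := hP 1 (k + 1 : ℕ) (ρ j)
    obtain ⟨t1, e1⟩ := ih.1 j
    obtain ⟨t2, e2⟩ := h1 (j + (k + 1))
    obtain ⟨t3, e3⟩ := h1 j
    obtain ⟨t4, e4⟩ := ih.1 (j + 1)
    rw [show j + 1 + (k + 1) = j + (k + 1) + 1 by ring] at e4
    rw [e1, map_smul, e2, e3, map_smul, e4, if_neg (by omega), zero_smul, add_zero,
      show (1 : ℤ) + (k + 1 : ℕ) = (k + 1 + 1 : ℕ) by push_cast; ring] at h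
    refine ⟨(k : ℂ)⁻¹ * (t1 * t2 - t3 * t4), ?_⟩
    rw [mul_smul, eq_inv_smul_iff₀ hk', sub_smul, mul_smul, mul_smul, ← add_assoc, h]
    push_cast
    module
  · have h := hP (-1) (-(k + 1 : ℕ)) (ρ (j + (k + 1 + 1)))
    obtain ⟨t1, e1⟩ := ih.2 (j + 1)
    obtain ⟨t2, e2⟩ := h1' j
    obtain ⟨t3, e3⟩ := h1' (j + (k + 1))
    obtain ⟨t4, e4⟩ := ih.2 j
    rw [show j + 1 + (k + 1) = j + (k + 1 + 1) by ring] at e1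
    rw [show j + (k + 1) + 1 = j + (k + 1 + 1) by ring] at e3
    rw [e1, map_smul, e2, e3, map_smul, e4, if_neg (by omega), zero_smul, add_zero,
      show (-1 : ℤ) + -(k + 1 : ℕ) = -(k + 1 + 1 : ℕ) by push_cast; ring] at h
    refine ⟨(k : ℂ)⁻¹ * (t3 * t4 - t1 * t2), ?_⟩
    rw [mul_smul, eq_inv_smul_iff₀ hk', sub_smul, mul_smul, mul_smul, h]
    push_cast
    module

end Ladder

/-- An irreducible representation `V` sharing a ladder with a representation `M` is a subquotient
of `M`. -/
theorem exists_cover_of_ladder {V M : Type*} [AddCommGroup V] [Module ℂ V] [AddCommGroup M]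
    [Module ℂ M] {E : ℤ → Module.End ℂ V} {D : ℤ → Module.End ℂ M} {c b : ℂ}
    (hE : IsVirRep E c) (hD : IsVirRep D c)
    (hirr : ∀ W : Submodule ℂ V, (∀ m, ∀ x ∈ W, E m x ∈ W) → W = ⊥ ∨ W = ⊤)
    {u : ℕ → V} {w : ℕ → M} (hu : ∀ j : ℕ, E 0 (u j) = (b + j) • u j)
    (hw : ∀ j : ℕ, D 0 (w j) = (b + j) • w j) (hu0 : u 0 ≠ 0) (hw0 : w 0 ≠ 0)
    (hup : ∀ k j : ℕ, ∃ t : ℂ, D (k + 1 : ℕ) (w j) = t • w (j + (k + 1)) ∧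
      E (k + 1 : ℕ) (u j) = t • u (j + (k + 1)))
    (hdown : ∀ k j : ℕ, ∃ t : ℂ, D (-(k + 1 : ℕ)) (w (j + (k + 1))) = t • w j ∧
      E (-(k + 1 : ℕ)) (u (j + (k + 1))) = t • u j) :
    ∃ (N : Submodule ℂ M) (π : N →ₗ[ℂ] V), Function.Surjective π ∧
      ∀ (m : ℤ) (x : N), ∃ h : D m x ∈ N, π ⟨D m x, h⟩ = E m (π x) := by
  have hP := hE.prod hD
  set P : ℤ → Module.End ℂ (M × V) := fun m => (D m).prodMap (E m) with hPdef
  have hPa (m : ℤ) (x : M) (y : V) : P m (x, y) = (D m x, E m y) := rfl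
  let ρ : ℕ → M × V := fun j => (w j, u j)
  let R₀ : Submodule ℂ (M × V) := Submodule.span ℂ (Set.range ρ)
  have hρ (j : ℕ) : ρ j ∈ R₀ := Submodule.subset_span ⟨j, rfl⟩
  have hρ0 (j : ℕ) : P 0 (ρ j) = (b + j) • ρ j := Prod.ext (hw j) (hu j)
  -- `G` collects everything of weight below the foot of the ladder; lowering operators that leave
  -- the ladder land there.
  let G : Submodule ℂ (M × V) :=
    Submodule.span ℂ {x | ∃ k : ℕ, P 0 x = (b - (k + 1)) • x}
  have hG {x : M × V} (k : ℕ) (h : P 0 x = (b - (k + 1)) • x) : x ∈ G :=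
    Submodule.subset_span ⟨k, h⟩
  obtain ⟨R, h0, h1, hR⟩ := hP.exists_stable_between (R₀ := R₀) (R' := R₀ ⊔ G) le_sup_left
    (by
      intro m hm x hx
      induction hx using Submodule.span_induction with
      | zero => simp
      | add x y _ _ h h' => rw [map_add]; exact add_mem h h'
      | smul t x _ h => rw [map_smul]; exact R₀.smul_mem _ h
      | mem x hx =>
      obtain ⟨j, rfl⟩ := hx
      obtain ⟨k, rfl⟩ := Int.eq_ofNat_of_zero_le hm
      rcases k with _ | k
      · exact (hρ0 j).symm ▸ R₀.smul_mem _ (hρ j)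
      · obtain ⟨t, e1, e2⟩ := hup k j
        have : P (k + 1 : ℕ) (ρ j) = t • ρ (j + (k + 1)) := Prod.ext e1 e2
        rw [this]
        exact R₀.smul_mem _ (hρ _))
    (by
      intro m hm x hx
      obtain ⟨k, hk⟩ := Int.eq_ofNat_of_zero_le (show 0 ≤ -m - 1 by omega)
      obtain rfl : m = -(k + 1 : ℕ) := by push_cast; omega
      suffices R₀ ⊔ G ≤ (R₀ ⊔ G).comap (P (-(k + 1 : ℕ))) from this hx
      refine sup_le (Submodule.span_le.mpr ?_) (Submodule.span_le.mpr ?_)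
      · rintro _ ⟨j, rfl⟩
        change P (-(k + 1 : ℕ)) (ρ j) ∈ R₀ ⊔ G
        by_cases hj : k + 1 ≤ j
        · obtain ⟨i, rfl⟩ := Nat.exists_eq_add_of_le' hj
          obtain ⟨t, e1, e2⟩ := hdown k i
          have : P (-(k + 1 : ℕ)) (ρ (i + (k + 1))) = t • ρ i := Prod.ext e1 e2
          rw [this]
          exact Submodule.smul_mem _ _ (Submodule.mem_sup_left (hρ i))
        · obtain ⟨i, hi⟩ := Nat.exists_eq_add_of_lt (not_le.mp hj)
          refine Submodule.mem_sup_right (hG i ?_)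
          rw [hP.weight_shift (hρ0 j)]
          congr 1
          have : ((k + 1 : ℕ) : ℂ) = j + i + 1 := by exact_mod_cast hi
          rw [Int.cast_neg, Int.cast_natCast, this]
          ring
      · rintro x ⟨j, hj⟩
        refine Submodule.mem_sup_right (hG (j + k + 1) ?_)
        rw [hP.weight_shift hj]
        congr 1
        push_cast
        ring)
  obtain ⟨l, hl1, hl⟩ := Module.End.exists_dual_of_eigenvector (E 0) (hu 0) hu0
  obtain ⟨l', hl1', hl'⟩ := Module.End.exists_dual_of_eigenvector (D 0) (hw 0) hw0
  -- In weight `b` the space `R₀ ⊔ G` contains only multiples of `(w 0, u 0)`, so the two normalised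
  -- coordinates agree there. In particular it does not contain `(0, u 0)`.
  have hvanish : R₀ ⊔ G ≤ LinearMap.ker (l ∘ₗ LinearMap.snd ℂ M V - l' ∘ₗ LinearMap.fst ℂ M V) := by
    refine sup_le (Submodule.span_le.mpr ?_) (Submodule.span_le.mpr ?_)
    · rintro _ ⟨j, rfl⟩
      change l (u j) - l' (w j) = 0
      rcases j with _ | j
      · rw [hl1, hl1', sub_self]
      · have hne : b + (j + 1 : ℕ) ≠ b + (0 : ℕ) := by
          simpa using Nat.cast_add_one_ne_zero j
        rw [hl _ _ hne (hu _), hl' _ _ hne (hw _), sub_self]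
    · rintro ⟨x, y⟩ ⟨j, hj⟩
      have hx : D 0 x = (b - (j + 1)) • x := congrArg Prod.fst hj
      have hy : E 0 y = (b - (j + 1)) • y := congrArg Prod.snd hj
      have hne : b - (j + 1) ≠ b + (0 : ℕ) := by
        simpa [sub_eq_iff_eq_add] using Nat.cast_add_one_ne_zero j
      change l y - l' x = 0
      rw [hl _ _ hne hy, hl' _ _ hne hx, sub_self]
  -- `R` is a graph over its projection to `M`: the vectors `y` with `(0, y) ∈ R` form a
  -- subrepresentation of `V` missing `u 0`, hence zero.
  have hker : ∀ x ∈ R, x.1 = 0 → x.2 = 0 := by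
    rintro ⟨x, y⟩ hx (rfl : x = 0)
    let K : Submodule ℂ V := R.comap (LinearMap.inr ℂ M V)
    have hK : K = ⊥ := by
      refine (hirr K ?_).resolve_right ?_
      · intro m y hy
        have := hR m _ hy
        change (0, E m y) ∈ R
        rwa [LinearMap.inr_apply, hPa, map_zero] at this
      · intro htop
        have h : u 0 ∈ K := htop ▸ Submodule.mem_top
        have h2 : l (u 0) - l' 0 = 0 := hvanish (h1 h)
        rw [hl1, map_zero] at h2
        simp at h2
    have : y ∈ K := hx
    rw [hK] at this
    exact this
  have hstable (m : ℤ) (x : R.map (LinearMap.fst ℂ M V)) :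
      (D m x, E m (R.toLinearPMap x)) ∈ R := hR m _ (R.mem_graph_toLinearPMap hker x)
  refine ⟨R.toLinearPMap.domain, R.toLinearPMap.toFun, ?_, fun m x => ?_⟩
  · rw [← LinearMap.range_eq_top, Submodule.toLinearPMap_range R hker]
    refine (hirr _ ?_).resolve_left ?_
    · rintro m _ ⟨x, hx, rfl⟩
      exact ⟨_, hR m x hx, rfl⟩
    · intro hbot
      have : u 0 ∈ R.map (LinearMap.snd ℂ M V) := ⟨ρ 0, h0 (hρ 0), rfl⟩
      rw [hbot] at this
      exact hu0 this
  · have h : D m x ∈ R.map (LinearMap.fst ℂ M V) := ⟨_, hstable m x, rfl⟩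
    refine ⟨h, ?_⟩
    have h2 := R.mem_graph_toLinearPMap hker ⟨D m x, h⟩
    have h3 := hker _ (R.sub_mem h2 (hstable m x)) (sub_self _)
    exact sub_eq_zero.mp h3

end IsVirRep

/-! ### Comparison with tensor density modules -/

namespace IsVirRep

variable {V M : Type*} [AddCommGroup V] [Module ℂ V] [AddCommGroup M] [Module ℂ M]
  {E : ℤ → Module.End ℂ V} {D : ℤ → Module.End ℂ M} {c a β : ℂ} {v : ℤ → V} {μ : ℤ → M}

theorem of_density (hD : ∀ m n : ℤ, D m (μ n) = (a + n + m * β) • μ (n + m))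
    (hspan : Submodule.span ℂ (Set.range μ) = ⊤) : IsVirRep D 0 := by
  intro m n x
  have hx : x ∈ Submodule.span ℂ (Set.range μ) := hspan ▸ Submodule.mem_top
  induction hx using Submodule.span_induction with
  | zero => simp
  | add x y _ _ h h' => simp only [map_add, h, h', smul_add]; abel
  | smul t x _ h => simp only [map_smul, h, smul_add, smul_comm t]
  | mem x hx =>
  obtain ⟨k, rfl⟩ := hx
  simp only [hD, map_smul, smul_smul, mul_zero, ite_self, zero_smul, add_zero]
  rw [show k + n + m = k + (m + n) by ring, show k + m + n = k + (m + n) by ring, ← add_smul]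
  congr 1
  push_cast
  ring

/-- The iterated images of `μ n` under `D 1` in a tensor density module. -/
theorem density_ladder (hD : ∀ m n : ℤ, D m (μ n) = (a + n + m * β) • μ (n + m)) {n : ℤ} {t : ℂ}
    (ht : t = a + n) (hμ : ∀ n, μ n ≠ 0)
    {q y z : ℕ → ℂ} (hq : ∀ j : ℕ, q j = (t + j + β) * (t + j + 1 - β))
    (hy : ∀ j : ℕ, y j * (q j * q (j + 1)) =
      (t + j + 2 * β) * (t + j + 1 - β) * (t + j + 2 - β))
    (hz : ∀ j : ℕ, z j = (t + j + 2 - 2 * β) * (t + j + 1 + β) * (t + j + β))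
    (hne : ∀ j : ℕ, q j ≠ 0) :
    ∃ w : ℕ → M, w 0 ≠ 0 ∧ (∀ j : ℕ, D 0 (w j) = (t + j) • w j) ∧
      (∀ j, D 1 (w j) = w (j + 1)) ∧ (∀ j, D (-1) (w (j + 1)) = q j • w j) ∧
      (∀ j, D 2 (w j) = y j • w (j + 2)) ∧ (∀ j, D (-2) (w (j + 2)) = z j • w j) := by
  -- Rescaling the basis by the accumulated coefficients of `D 1` makes `D 1` an exact shift.
  let r : ℕ → ℂ := fun j => ∏ i ∈ Finset.range j, (t + i + β)
  have hr (j : ℕ) : r (j + 1) = r j * (t + j + β) := Finset.prod_range_succ _ _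
  have hy' (j : ℕ) : y j * ((t + j + β) * (t + (j + 1 : ℕ) + β)) = t + j + 2 * β := by
    have h0 := hne j
    have h1 := hne (j + 1)
    rw [hq] at h0 h1
    have h2 : (t + j + 1 - β) * (t + (j + 1 : ℕ) + 1 - β) ≠ 0 :=
      mul_ne_zero (right_ne_zero_of_mul h0) (right_ne_zero_of_mul h1)
    refine mul_right_cancel₀ h2 ?_
    have := hy j
    rw [hq, hq] at this
    push_cast at this ⊢
    linear_combination this
  subst ht
  refine ⟨fun j => r j • μ (n + j), ?_, fun j => ?_, fun j => ?_, fun j => ?_, fun j => ?_,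
    fun j => ?_⟩
  · simpa [r] using hμ n
  · simp only [map_smul, hD, smul_smul, add_zero]
    congr 1
    push_cast
    ring
  · simp only [map_smul, hD, smul_smul, hr, Nat.cast_add, Nat.cast_one, add_assoc n]
    congr 1
    push_cast
    ring
  · simp only [map_smul, hD, smul_smul, hr, hq]
    rw [show n + ((j + 1 : ℕ) : ℤ) + -1 = n + j by push_cast; ring]
    congr 1
    push_cast
    ring
  · simp only [map_smul, hD, smul_smul]
    rw [show n + (j : ℤ) + 2 = n + (j + 2 : ℕ) by push_cast; ring]
    congr 1
    have := hy' j
    rw [show r (j + 2) = r (j + 1) * _ from hr (j + 1), hr]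
    push_cast at this ⊢
    linear_combination -r j * this
  · simp only [map_smul, hD, smul_smul]
    rw [show n + ((j + 2 : ℕ) : ℤ) + -2 = n + j by push_cast; ring]
    congr 1
    rw [show r (j + 2) = r (j + 1) * _ from hr (j + 1), hr, hz]
    push_cast
    ring

/-- High up, iterating `E 1` gives a ladder whose constants are those of a density module. The
ladder with equal constants in `M` moves in parallel with it under all `E m`, so the graph
construction applies. -/
theorem exists_density_cover_of_unbounded (hE : IsVirRep E c)
    (hirr : ∀ W : Submodule ℂ V, (∀ m, ∀ x ∈ W, E m x ∈ W) → W = ⊥ ∨ W = ⊤)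
    (hv : IsWeightFamily (E 0) a v) (hub : ∀ N : ℤ, ∃ n, N ≤ n ∧ v n ≠ 0) :
    ∃ β : ℂ, ∀ (M : Type) [AddCommGroup M] [Module ℂ M] (D : ℤ → Module.End ℂ M) (μ : ℤ → M),
      (∀ n, μ n ≠ 0) → (∀ m n : ℤ, D m (μ n) = (a + n + m * β) • μ (n + m)) →
      Submodule.span ℂ (Set.range μ) = ⊤ →
      ∃ (N : Submodule ℂ M) (π : N →ₗ[ℂ] V), Function.Surjective π ∧
        ∀ (m : ℤ) (x : N), ∃ h : D m x ∈ N, π ⟨D m x, h⟩ = E m (π x) := by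
  obtain ⟨N, hN⟩ := hE.exists_forall_raise_ne_zero hv hub
  let u : ℕ → V := fun j => (E 1 ^ j) (v N)
  have hu1 (j : ℕ) : E 1 (u j) = u (j + 1) := by
    change _ = (E 1 ^ (j + 1)) (v N)
    rw [pow_succ', Module.End.mul_apply]
  have huv (j : ℕ) : ∃ s : ℂ, s ≠ 0 ∧ u j = s • v (N + j) := by
    induction j with
    | zero => exact ⟨1, one_ne_zero, by simp [u]⟩
    | succ j ih =>
      obtain ⟨s, hs, e⟩ := ih
      obtain ⟨t, ht⟩ := hE.exists_smul hv 1 (N + j)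
      have ht0 : t ≠ 0 := by
        rintro rfl
        rw [zero_smul] at ht
        exact (hN (N + j) (by omega)).2 ht
      refine ⟨s * t, mul_ne_zero hs ht0, ?_⟩
      rw [← hu1, e, map_smul, ht, smul_smul, Nat.cast_add, Nat.cast_one, add_assoc]
  have hu0 (j : ℕ) : u j ≠ 0 := by
    obtain ⟨s, hs, e⟩ := huv j
    rw [e]
    exact smul_ne_zero hs (hN _ (by omega)).1
  have huE (j : ℕ) : E 0 (u j) = (a + N + j) • u j := by
    obtain ⟨s, hs, e⟩ := huv j
    rw [e, map_smul, hv.eig, smul_comm]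
    push_cast
    rw [add_assoc]
  have hum {m : ℤ} {i j : ℕ} (h : (j : ℤ) + m = i) : ∃ t : ℂ, E m (u j) = t • u i := by
    obtain ⟨s, hs, e⟩ := huv j
    obtain ⟨s', hs', e'⟩ := huv i
    obtain ⟨t, ht⟩ := hE.exists_smul hv m (N + j)
    refine ⟨s * t * s'⁻¹, ?_⟩
    rw [e, map_smul, ht, e', add_assoc, h, smul_smul, smul_smul, inv_mul_cancel_right₀ hs']
  choose q hq using fun j : ℕ => hum (m := -1) (i := j) (j := j + 1) (by push_cast; ring)
  choose y hy using fun j : ℕ => hum (m := 2) (i := j + 2) (j := j) (by push_cast; ring)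
  choose z hz using fun j : ℕ => hum (m := -2) (i := j) (j := j + 2) (by push_cast; ring)
  have cancel {j : ℕ} {s t : ℂ} (h : s • u j = t • u j) : s = t := smul_left_injective ℂ (hu0 j) h
  obtain ⟨rfl, β, hβ⟩ := density_structure_constants (t := a + N) (c := c) (q := q) (y := y) (z := z)
    (fun j => cancel (j := j + 1) (by
      have := hE (-1) 1 (u (j + 1))
      rw [hu1, hq, hq, map_smul, hu1] at this
      rw [this]
      simp only [Int.reduceNeg, neg_add_cancel, if_true, huE]
      push_cast
      module))
    (fun j => cancel (j := j + 2) (by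
      have := hE (-1) 2 (u (j + 1))
      rw [hy, map_smul, show j + 1 + 2 = j + 2 + 1 by ring, hq, hq, map_smul, hy,
        if_neg (by decide), zero_smul, add_zero, show (-1 : ℤ) + 2 = 1 by rfl, hu1] at this
      rw [mul_comm, mul_smul, this]
      push_cast
      module))
    (fun j => cancel (j := j + 1) (by
      have := hE 1 (-2) (u (j + 2))
      rw [hz, map_smul, hu1 j, hu1 (j + 2), show j + 2 + 1 = j + 1 + 2 by ring, hz (j + 1),
        if_neg (by decide), zero_smul, add_zero, show (1 : ℤ) + -2 = -1 by rfl,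
        show j + 2 = j + 1 + 1 by ring, hq] at this
      rw [add_smul, this]
      push_cast
      module))
    (fun j => cancel (j := j + 2) (by
      have := hE (-2) 2 (u (j + 2))
      rw [hy, map_smul, hz, hz, map_smul, hy] at this
      rw [mul_smul, this]
      simp only [Int.reduceNeg, neg_add_cancel, if_true, huE]
      push_cast
      module))
  refine ⟨β, fun M _ _ D μ hμ hD hspan => ?_⟩
  have hDrep := of_density hD hspan
  -- Past this height both factors of `q` have positive real part, so the constants of the density
  -- ladder can be recovered by division.
  obtain ⟨J, hJ⟩ : ∃ J : ℕ, |(a + N).re| + |β.re| + 1 ≤ J := exists_nat_ge _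
  have hqne (j : ℕ) : q (J + j) ≠ 0 := by
    rw [(hβ _).1]
    have h1 := neg_abs_le (a + N).re
    have h2 := neg_abs_le β.re
    have h3 := le_abs_self β.re
    have h4 : (0 : ℝ) ≤ j := j.cast_nonneg
    refine mul_ne_zero (fun h => ?_) fun h => ?_
    · have := congrArg Complex.re h
      simp only [Complex.add_re, Complex.zero_re, Complex.natCast_re, Nat.cast_add] at this h1 hJ
      linarith
    · have := congrArg Complex.re h
      simp only [Complex.add_re, Complex.sub_re, Complex.zero_re, Complex.one_re,
        Complex.natCast_re, Nat.cast_add] at this h1 hJ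
      linarith
  obtain ⟨w, w0, wE, w1, w1', w2, w2'⟩ := density_ladder hD (n := N + J) (t := a + N + J)
    (by push_cast; ring) hμ (q := fun j => q (J + j)) (y := fun j => y (J + j))
    (z := fun j => z (J + j))
    (fun j => by rw [(hβ _).1]; push_cast; ring)
    (fun j => by
      have := (hβ (J + j)).2.1
      rw [add_assoc] at this
      rw [this]; push_cast; ring)
    (fun j => by rw [(hβ _).2.2]; push_cast; ring) hqne
  have hlad := (hE.prod hDrep).ladder (ρ := fun j => (w j, u (J + j)))
    (fun j => ⟨1, Prod.ext (by simp [w1]) (by simp [hu1, add_assoc])⟩)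
    (fun j => ⟨q (J + j), Prod.ext (w1' j) (hq (J + j))⟩)
    (fun j => ⟨y (J + j), Prod.ext (w2 j) (hy (J + j))⟩)
    (fun j => ⟨z (J + j), Prod.ext (w2' j) (hz (J + j))⟩)
  refine exists_cover_of_ladder hE hDrep hirr (b := a + N + J) (u := fun j => u (J + j)) (w := w)
    (fun j => by rw [huE]; push_cast; rw [add_assoc _ (J : ℂ)]) wE (hu0 _) w0 (fun k j => ?_)
    (fun k j => ?_)
  · obtain ⟨t, ht⟩ := (hlad k).1 j
    exact ⟨t, congrArg Prod.fst ht, congrArg Prod.snd ht⟩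
  · obtain ⟨t, ht⟩ := (hlad k).2 j
    exact ⟨t, congrArg Prod.fst ht, congrArg Prod.snd ht⟩

/-- An irreducible Virasoro representation with weight multiplicities at most one is trivial or a
subquotient of a tensor density module. -/
theorem exists_density_cover (hE : IsVirRep E c)
    (hirr : ∀ W : Submodule ℂ V, (∀ m, ∀ x ∈ W, E m x ∈ W) → W = ⊥ ∨ W = ⊤)
    (hv : IsWeightFamily (E 0) a v) (hE0 : ∃ m, E m ≠ 0) :
    ∃ β : ℂ, ∀ (M : Type) [AddCommGroup M] [Module ℂ M] (D : ℤ → Module.End ℂ M) (μ : ℤ → M),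
      (∀ n, μ n ≠ 0) → (∀ m n : ℤ, D m (μ n) = (a + n + m * β) • μ (n + m)) →
      Submodule.span ℂ (Set.range μ) = ⊤ →
      ∃ (N : Submodule ℂ M) (π : N →ₗ[ℂ] V), Function.Surjective π ∧
        ∀ (m : ℤ) (x : N), ∃ h : D m x ∈ N, π ⟨D m x, h⟩ = E m (π x) := by
  by_cases hub : ∀ N : ℤ, ∃ n, N ≤ n ∧ v n ≠ 0
  · exact hE.exists_density_cover_of_unbounded hirr hv hub
  by_cases hlb : ∀ N : ℤ, ∃ n, N ≤ n ∧ v (-n) ≠ 0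
  · have hrange : Set.range (fun n => v (-n)) = Set.range v :=
      (Equiv.neg ℤ).surjective.range_comp v
    -- Reflecting a density module changes the sign of `a` and of the basis index but keeps the
    -- parameter `β`.
    obtain ⟨β, hβ⟩ := hE.reflect.exists_density_cover_of_unbounded (a := -a)
      (v := fun n => v (-n)) (fun W hW => hirr W fun m x hx => by
        have := hW (-m) x hx
        simp only [neg_neg, LinearMap.neg_apply] at this
        exact neg_mem_iff.mp this)
      { eig := fun n => by
          simp only [neg_zero, LinearMap.neg_apply, hv.eig]
          push_cast
          module
        mult := fun n x hx => hv.mult (-n) x (by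
          simp only [neg_zero, LinearMap.neg_apply] at hx
          rw [← neg_neg (E 0 x), hx]
          push_cast
          module)
        span := by rw [hrange]; exact hv.span } hlb
    refine ⟨β, fun M _ _ D μ hμ hD hspan => ?_⟩
    obtain ⟨N, π, hπ, h⟩ := hβ M (fun m => -D (-m)) (fun n => μ (-n)) (fun n => hμ _)
      (fun m n => by
        simp only [LinearMap.neg_apply, hD]
        rw [neg_add]
        push_cast
        module)
      (by
        rw [← hspan]
        congr 1
        exact (Equiv.neg ℤ).surjective.range_comp μ)
    refine ⟨N, π, hπ, fun m x => ?_⟩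
    obtain ⟨h1, h2⟩ := h (-m) x
    simp only [neg_neg, LinearMap.neg_apply] at h1 h2
    have h3 : D m x ∈ N := neg_mem_iff.mp h1
    refine ⟨h3, ?_⟩
    rw [← neg_inj, ← h2, ← map_neg]
    rfl
  · exfalso
    push Not at hub hlb
    obtain ⟨N, hN⟩ := hub
    obtain ⟨N', hN'⟩ := hlb
    obtain ⟨m, hm⟩ := hE0
    refine hm (hE.eq_zero_of_bounded hv (N := max N N') (fun n hn => ?_) m)
    have h1 : n < N := by by_contra h; exact hn (hN n (by omega))
    have h2 : -n < N' := by
      by_contra h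
      refine hn ?_
      have := hN' (-n) (by omega)
      rwa [neg_neg] at this
    rw [abs_le]
    constructor <;> omega

end IsVirRep

/-! ### Irreducible modules of intermediate series: centre and weights -/

namespace GapVir

variable {p : ℕ}

/-- The elements `L m` generate the Lie algebra. -/
theorem generator_induction (hp : 1 < p) {P : GapVir p → Prop} (hL : ∀ m, P (L p m))
    (hadd : ∀ x y, P x → P y → P (x + y)) (hsmul : ∀ (t : ℂ) x, P x → P (t • x))
    (hlie : ∀ x y, P x → P y → P ⁅x, y⁆) (x : GapVir p) : P x := by
  have hp0 : (p : ℂ) ≠ 0 := by exact_mod_cast (show p ≠ 0 by omega)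
  have : NeZero p := ⟨by omega⟩
  let S : Submodule ℂ (GapVir p) :=
    { carrier := {x | P x}
      add_mem' := fun {x y} hx hy => hadd x y hx hy
      zero_mem' := by simpa using hsmul 0 _ (hL 0)
      smul_mem' := fun t x hx => hsmul t x hx }
  have hLS (m : ℤ) : L p m ∈ S := hL m
  have hlieS {x y : GapVir p} (hx : x ∈ S) (hy : y ∈ S) : ⁅x, y⁆ ∈ S := hlie x y hx hy
  have hC (i : ZMod p) : C p i ∈ S := by
    by_cases hi : i = 0
    · subst hi
      -- The pair `±p` would not do: the coefficient of $C_0$ vanishes there, while at `±2p` it is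
      -- $1/2$.
      have h := hlieS (hLS (2 * p)) (hLS (-(2 * p)))
      rw [bracket_L_L, bracketLL, if_pos (by simp), if_pos (by simp), if_pos (by ring)] at h
      have h2 := (S.add_mem_iff_right (S.smul_mem _ (hLS _))).mp h
      refine (S.smul_mem_iff ?_).mp h2
      push_cast
      rw [mul_div_cancel_right₀ _ hp0]
      norm_num
    · have h := hlieS (hLS (i.val : ℤ)) (hLS (-(i.val : ℤ)))
      have e : ((i.val : ℤ) : ZMod p) = i := by simp
      rw [bracket_L_L, bracketLL, if_neg (by simpa [e] using hi), if_neg (by simpa using hi),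
        if_pos (by ring), e] at h
      refine (S.smul_mem_iff ?_).mp h
      have : i.val ≠ 0 := by simpa using hi
      exact_mod_cast this
  have hmk : S.mkQ = 0 := by
    refine hom_ext p (fun m => ?_) fun i => ?_
    · simpa using hLS m
    · simpa using hC i
  have hx : S.mkQ x = 0 := by rw [hmk]; rfl
  exact (Submodule.Quotient.mk_eq_zero S).mp hx

section Module

variable {V : Type*} [AddCommGroup V] [Module ℂ V] [LieRingModule (GapVir p) V]
  [LieModule ℂ (GapVir p) V]

/-- A subspace stable under all `L m` is a submodule. -/
def lieSubmoduleOfStable (hp : 1 < p) (W : Submodule ℂ V)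
    (h : ∀ m, ∀ x ∈ W, ⁅L p m, x⁆ ∈ W) : LieSubmodule ℂ (GapVir p) V where
  __ := W
  lie_mem := by
    intro a x hx
    refine generator_induction hp (P := fun a => ∀ x ∈ W, ⁅a, x⁆ ∈ W) h ?_ ?_ ?_ a x hx
    · intro a b ha hb x hx
      rw [add_lie]
      exact add_mem (ha x hx) (hb x hx)
    · intro t a ha x hx
      rw [smul_lie]
      exact W.smul_mem t (ha x hx)
    · intro a b ha hb x hx
      rw [lie_lie]
      exact sub_mem (ha _ (hb x hx)) (hb _ (ha x hx))

/-- A linear map commuting with all `L m` is a homomorphism of modules. -/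
def lieHomOfEquivariant (hp : 1 < p) {W : Type*} [AddCommGroup W] [Module ℂ W]
    [LieRingModule (GapVir p) W] [LieModule ℂ (GapVir p) W] (f : V →ₗ[ℂ] W)
    (h : ∀ m x, f ⁅L p m, x⁆ = ⁅L p m, f x⁆) : V →ₗ⁅ℂ, GapVir p⁆ W where
  __ := f
  map_lie' := by
    intro a x
    refine generator_induction hp (P := fun a => ∀ x, f ⁅a, x⁆ = ⁅a, f x⁆) h ?_ ?_ ?_ a x
    · intro a b ha hb x
      rw [add_lie, add_lie, map_add, ha, hb]
    · intro t a ha x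
      rw [smul_lie, smul_lie, map_smul, ha]
    · intro a b ha hb x
      rw [lie_lie, lie_lie, map_sub, ha, hb, hb, ha]

theorem isTrivial_of_L (hp : 1 < p) (h : ∀ m (x : V), ⁅L p m, x⁆ = 0) :
    LieModule.IsTrivial (GapVir p) V where
  trivial a x := by
    refine generator_induction hp (P := fun a => ∀ x : V, ⁅a, x⁆ = 0) h ?_ ?_ ?_ a x
    · intro a b ha hb x
      rw [add_lie, ha, hb, add_zero]
    · intro t a ha x
      rw [smul_lie, ha, smul_zero]
    · intro a b ha hb x
      rw [lie_lie, ha, hb, sub_zero]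

theorem stable_eq_bot_or_top (hp : 1 < p) [LieModule.IsIrreducible ℂ (GapVir p) V]
    (W : Submodule ℂ V) (h : ∀ m, ∀ x ∈ W, ⁅L p m, x⁆ ∈ W) : W = ⊥ ∨ W = ⊤ := by
  rcases eq_bot_or_eq_top (lieSubmoduleOfStable hp W h) with h | h
  · exact Or.inl (congrArg LieSubmodule.toSubmodule h)
  · exact Or.inr (congrArg LieSubmodule.toSubmodule h)

theorem lie_L_zero_L (m : ℤ) (x : V) :
    ⁅L p 0, ⁅L p m, x⁆⁆ = ⁅L p m, ⁅L p 0, x⁆⁆ + (m : ℂ) • ⁅L p m, x⁆ := by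
  rw [leibniz_lie, bracket_L_L, bracketLL, if_pos (by simp), add_comm]
  by_cases hm : (m : ZMod p) = 0
  · by_cases h : m = 0
    · subst h
      simp
    · simp [hm, h]
  · simp [hm]

theorem eigenL0_shift {z : ℂ} {x : V} (hx : x ∈ eigenL0 p V z) (m : ℤ) :
    ⁅L p m, x⁆ ∈ eigenL0 p V (z + m) := by
  change ⁅L p 0, x⁆ = z • x at hx
  change _ = _
  rw [lie_L_zero_L, hx, lie_smul, add_smul]

theorem weightSpace_ne_bot_of_isWeightModule [Nontrivial V] (h : IsWeightModule p V) :
    ∃ lam, weightSpace p V lam ≠ ⊥ := by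
  by_contra! h'
  have h2 : (⊥ : Submodule ℂ V) = ⊤ := by
    rw [← h, eq_comm, iSup_eq_bot]
    exact h'
  exact bot_ne_top h2

/-- The central elements act on an irreducible weight module by scalars. -/
theorem exists_central_character (hp : 1 < p) [LieModule.IsIrreducible ℂ (GapVir p) V]
    (h : IsWeightModule p V) : ∃ κ : Module.Dual ℂ (cartan p), weightSpace p V κ ≠ ⊥ ∧
      ∀ (i : ZMod p) (hi : C p i ∈ cartan p) (x : V), ⁅C p i, x⁆ = κ ⟨C p i, hi⟩ • x := by
  have : Nontrivial V := LieModule.nontrivial_of_isIrreducible ℂ (GapVir p) V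
  obtain ⟨κ, hκ⟩ := weightSpace_ne_bot_of_isWeightModule h
  refine ⟨κ, hκ, fun i hi x => ?_⟩
  let W : Submodule ℂ V := LinearMap.ker (LieModule.toEnd ℂ (GapVir p) V (C p i) -
    κ ⟨C p i, hi⟩ • LinearMap.id)
  have hW (y : V) : y ∈ W ↔ ⁅C p i, y⁆ = κ ⟨C p i, hi⟩ • y := by
    simp [W, sub_eq_zero]
  have htop : W = ⊤ := by
    refine (stable_eq_bot_or_top hp W fun m y hy => ?_).resolve_left fun hbot => hκ ?_
    · rw [hW] at hy ⊢
      rw [leibniz_lie, hy, lie_smul, ← lie_skew, lie_C, neg_zero, zero_lie, zero_add]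
    · refine (Submodule.eq_bot_iff _).mpr fun y hy => ?_
      have : y ∈ W := (hW y).mpr (hy ⟨C p i, hi⟩)
      rwa [hbot] at this
  exact (hW x).mp (htop ▸ Submodule.mem_top)

theorem C_mem_cartan (i : ZMod p) : C p i ∈ cartan p := Submodule.subset_span (Or.inr ⟨i, rfl⟩)

theorem L_zero_mem_cartan : L p 0 ∈ cartan p := Submodule.subset_span (Or.inl rfl)

/-- In an irreducible module of intermediate series, the eigenspaces of `L 0` are at most
one-dimensional. -/
theorem exists_span_eigenL0 (hp : 1 < p) [LieModule.IsIrreducible ℂ (GapVir p) V]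
    (hV : IsIntermediateSeries p V) (z : ℂ) : ∃ v ∈ eigenL0 p V z, eigenL0 p V z ≤ ℂ ∙ v := by
  obtain ⟨κ, -, hκ⟩ := exists_central_character hp hV.1
  obtain ⟨K, hK⟩ := LinearMap.exists_extend κ
  let e : GapVir p →ₗ[ℂ] ℂ := Finsupp.lapply 0 ∘ₗ fstL p
  -- The functional with value `z` at $L_0$ and the central character on the $C_i$; its weight space
  -- contains the whole eigenspace.
  let lam : Module.Dual ℂ (cartan p) := (K + (z - K (L p 0)) • e) ∘ₗ (cartan p).subtype
  have hle : eigenL0 p V z ≤ weightSpace p V lam := by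
    rintro x hx ⟨a, ha⟩
    change ⁅L p 0, x⁆ = z • x at hx
    change ⁅a, x⁆ = (K + (z - K (L p 0)) • e) a • x
    change a ∈ Submodule.span ℂ _ at ha
    induction ha using Submodule.span_induction with
    | zero => simp
    | add a b _ _ h h' => rw [add_lie, map_add, add_smul, h, h']
    | smul t a _ h => rw [smul_lie, map_smul, h, smul_smul, smul_eq_mul]
    | mem a ha =>
    rcases ha with rfl | ⟨i, rfl⟩
    · rw [hx]
      simp [e]
    · rw [hκ i (C_mem_cartan i)]
      have : κ ⟨C p i, C_mem_cartan i⟩ = K (C p i) := by rw [← hK]; rfl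
      simp [e, this]
  exact (rank_submodule_le_one_iff _).mp ((Submodule.rank_mono hle).trans (hV.2 lam))

/-- All weights lie in one coset $a+\mathbb Z$: starting from any weight vector, the span of the
eigenspaces over this coset is stable, hence everything. -/
theorem exists_weightFamily (hp : 1 < p) [LieModule.IsIrreducible ℂ (GapVir p) V]
    (hV : IsIntermediateSeries p V) : ∃ (a : ℂ) (v : ℤ → V), v 0 ≠ 0 ∧
      IsWeightFamily (LieModule.toEnd ℂ (GapVir p) V (L p 0)) a v := by
  obtain ⟨κ, hκ, -⟩ := exists_central_character hp hV.1
  obtain ⟨x, hx, hx0⟩ := Submodule.exists_mem_ne_zero_of_ne_bot hκ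
  obtain ⟨a, ha⟩ : ∃ a, a = κ ⟨L p 0, L_zero_mem_cartan⟩ := ⟨_, rfl⟩
  have hxa : x ∈ eigenL0 p V a := by
    change _ = _
    rw [ha]
    exact hx ⟨L p 0, L_zero_mem_cartan⟩
  choose v hv hspan using fun n : ℤ => exists_span_eigenL0 hp hV (a + n)
  have hmult (n : ℤ) (y : V) (hy : y ∈ eigenL0 p V (a + n)) : ∃ t : ℂ, y = t • v n := by
    obtain ⟨t, ht⟩ := Submodule.mem_span_singleton.mp (hspan n hy)
    exact ⟨t, ht.symm⟩
  obtain ⟨t, ht⟩ := hmult 0 x (by simpa using hxa)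
  have hv0 : v 0 ≠ 0 := by
    rintro h
    rw [h, smul_zero] at ht
    exact hx0 ht
  refine ⟨a, v, hv0, fun n => hv n, hmult, ?_⟩
  refine (stable_eq_bot_or_top hp _ fun m y hy => ?_).resolve_left fun hbot => ?_
  · induction hy using Submodule.span_induction with
    | zero => simp
    | add y z _ _ h h' => rw [lie_add]; exact add_mem h h'
    | smul t y _ h => rw [lie_smul]; exact Submodule.smul_mem _ _ h
    | mem y hy =>
    obtain ⟨n, rfl⟩ := hy
    obtain ⟨t, ht⟩ := hmult (n + m) _ (by
      have := eigenL0_shift (hv n) m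
      rw [add_assoc] at this
      exact_mod_cast this)
    rw [ht]
    exact Submodule.smul_mem _ _ (Submodule.subset_span ⟨_, rfl⟩)
  · rw [Submodule.span_eq_bot] at hbot
    exact hv0 (hbot _ ⟨0, rfl⟩)

end Module

end GapVir

/-! ### Irreducible quotients of Lie modules -/

/-- The kernel of a map to an irreducible module behaves like a maximal submodule: if `K` had
nonzero image, the image would be everything and `K` together with the kernel would fill `U`. -/
theorem LieModuleHom.ker_le_ker_of_sup_ne_top {𝔤 : Type*} [LieRing 𝔤] [LieAlgebra ℂ 𝔤]
    {V : Type*} [AddCommGroup V] [Module ℂ V] [LieRingModule 𝔤 V]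
    {U : Type*} [AddCommGroup U] [Module ℂ U]
    [LieRingModule 𝔤 U] [LieModule ℂ 𝔤 U] [LieModule.IsIrreducible ℂ 𝔤 V] (f : U →ₗ⁅ℂ, 𝔤⁆ V)
    (K : LieSubmodule ℂ 𝔤 U) (h : f.ker ⊔ K ≠ ⊤) : K ≤ f.ker := by
  rcases eq_bot_or_eq_top (K.map f) with h' | h'
  · intro x hx
    have : f x ∈ K.map f := LieSubmodule.mem_map_of_mem hx
    rw [h', LieSubmodule.mem_bot] at this
    exact f.mem_ker.mpr this
  · refine absurd (eq_top_iff.mpr fun x _ => ?_) h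
    have : f x ∈ K.map f := h' ▸ LieSubmodule.mem_top _
    obtain ⟨y, hy, hxy⟩ := LieSubmodule.mem_map _ |>.mp this
    rw [← sub_add_cancel x y]
    refine add_mem ((le_sup_left : f.ker ≤ _) (f.mem_ker.mpr ?_)) ((le_sup_right : K ≤ _) hy)
    rw [map_sub, hxy, sub_self]

theorem LieModuleHom.surjective_of_ne_zero {𝔤 : Type*} [LieRing 𝔤]
    {V : Type*} [AddCommGroup V] [Module ℂ V] [LieRingModule 𝔤 V]
    {W : Type*} [AddCommGroup W] [Module ℂ W] [LieRingModule 𝔤 W]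
    [LieModule.IsIrreducible ℂ 𝔤 V] (f : W →ₗ⁅ℂ, 𝔤⁆ V)
    {x : W} (hx : f x ≠ 0) : Function.Surjective f := by
  rw [← LieModuleHom.range_eq_top]
  refine (eq_bot_or_eq_top f.range).resolve_left fun h => hx ?_
  have : f x ∈ f.range := ⟨x, rfl⟩
  rwa [h, LieSubmodule.mem_bot] at this

section Quotients

variable {𝔤 : Type*} [LieRing 𝔤] [LieAlgebra ℂ 𝔤]
  {V : Type*} [AddCommGroup V] [Module ℂ V] [LieRingModule 𝔤 V] [LieModule ℂ 𝔤 V]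
  {W : Type*} [AddCommGroup W] [Module ℂ W] [LieRingModule 𝔤 W] [LieModule ℂ 𝔤 W]

/-- The first isomorphism theorem for a surjective homomorphism of Lie modules. -/
noncomputable def LieModuleHom.quotKerEquivOfSurjective (f : W →ₗ⁅ℂ, 𝔤⁆ V)
    (hf : Function.Surjective f) : (W ⧸ f.ker) ≃ₗ⁅ℂ, 𝔤⁆ V where
  __ := (Submodule.quotEquivOfEq _ _ f.ker_toSubmodule).trans
    ((f : W →ₗ[ℂ] V).quotKerEquivOfSurjective hf)
  map_lie' := by
    intro a x
    induction x using Submodule.Quotient.induction_on with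
    | _ x => exact f.map_lie a x

theorem isLieSubquotient_of_surjective {N : LieSubmodule ℂ 𝔤 W} (f : N →ₗ⁅ℂ, 𝔤⁆ V)
    (hf : Function.Surjective f) : IsLieSubquotient 𝔤 V W :=
  ⟨N, f.ker, ⟨(f.quotKerEquivOfSurjective hf).symm⟩⟩

/-- Two irreducible quotients are isomorphic if the two kernels do not span the whole module. -/
theorem nonempty_equiv_of_ker_sup_ne_top {U : Type*} [AddCommGroup U] [Module ℂ U]
    [LieRingModule 𝔤 U] [LieModule ℂ 𝔤 U] [LieModule.IsIrreducible ℂ 𝔤 V]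
    [LieModule.IsIrreducible ℂ 𝔤 W] (f : U →ₗ⁅ℂ, 𝔤⁆ V) (g : U →ₗ⁅ℂ, 𝔤⁆ W)
    (hf : Function.Surjective f) (hg : Function.Surjective g) (h : f.ker ⊔ g.ker ≠ ⊤) :
    Nonempty (V ≃ₗ⁅ℂ, 𝔤⁆ W) := by
  have e : f.ker = g.ker := le_antisymm
    (g.ker_le_ker_of_sup_ne_top f.ker (by rwa [sup_comm])) (f.ker_le_ker_of_sup_ne_top g.ker h)
  have e2 := g.quotKerEquivOfSurjective hg
  rw [← e] at e2
  exact ⟨(f.quotKerEquivOfSurjective hf).symm.trans e2⟩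

end Quotients

/-- A stable subspace contains the eigencomponents of its elements. -/
theorem Module.End.mem_of_sum_eigenvectors_mem {V ι : Type*} [AddCommGroup V] [Module ℂ V]
    (H : Module.End ℂ V) {W : Submodule ℂ V} (hW : ∀ x ∈ W, H x ∈ W) {d : ι → ℂ}
    (hd : Function.Injective d) (s : Finset ι) (y : ι → V) (hy : ∀ i ∈ s, H (y i) = d i • y i)
    (hsum : ∑ i ∈ s, y i ∈ W) : ∀ i ∈ s, y i ∈ W := by
  classical
  induction s using Finset.induction_on generalizing y with
  | empty => simp
  | insert j s hj ih =>
    have h1 : ∀ i ∈ s, y i ∈ W := by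
      -- Applying `H - d j` to the sum removes the `j`-th term and rescales each other one by a
      -- nonzero factor.
      have h2 := ih (fun i => (d i - d j) • y i) (fun i hi => by
        rw [map_smul, hy i (Finset.mem_insert_of_mem hi), smul_comm]) (by
        have h3 := W.sub_mem (hW _ hsum) (W.smul_mem (d j) hsum)
        rw [map_sum, Finset.smul_sum, ← Finset.sum_sub_distrib, Finset.sum_insert hj,
          hy j (Finset.mem_insert_self j s), sub_self, zero_add] at h3
        convert h3 using 1
        refine Finset.sum_congr rfl fun i hi => ?_
        rw [hy i (Finset.mem_insert_of_mem hi), sub_smul])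
      intro i hi
      have hne : d i - d j ≠ 0 := sub_ne_zero.mpr fun h => hj (hd h ▸ hi)
      exact (W.smul_mem_iff hne).mp (h2 i hi)
    rw [Finset.sum_insert hj] at hsum
    have h2 : y j ∈ W := (W.add_mem_iff_left (W.sum_mem h1)).mp hsum
    simpa using ⟨h2, h1⟩

/-! ### Submodules and subquotients of $V(\alpha,\beta,0)$ -/

namespace GapVir

variable {p : ℕ}

theorem ShiftMod.v_ne_zero (c : ℤ → ℤ → ℂ) (hc : Compat p c) (n : ℤ) : ShiftMod.v p c hc n ≠ 0 :=
  Finsupp.single_ne_zero.mpr one_ne_zero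

theorem isTrivial_of_L_zero (hp : 1 < p) {V : Type*} [AddCommGroup V] [Module ℂ V]
    [LieRingModule (GapVir p) V] [LieModule ℂ (GapVir p) V] (h : ∀ x : V, ⁅L p 0, x⁆ = 0) :
    LieModule.IsTrivial (GapVir p) V := by
  refine isTrivial_of_L hp fun m x => ?_
  by_cases hm : m = 0
  · rw [hm, h]
  · have h1 := lie_L_zero_L (p := p) m x
    rw [h, h, lie_zero, zero_add, eq_comm] at h1
    exact (smul_eq_zero.mp h1).resolve_left (by exact_mod_cast hm)

theorem admissible_zero : Admissible (p := p) 0 where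
  condI := Or.inl rfl
  condII := by simp
  condIII := by simp

section Density

variable {α β : ℂ} {hF : Admissible (p := p) 0}

/-- The basis of `V(α,β,0)`. -/
noncomputable def densityVec (hF : Admissible (p := p) 0) (α β : ℂ) (k : ℤ) : series p α β 0 hF :=
  ⟨ShiftMod.v p _ _ (p * k), Submodule.subset_span ⟨p * k, by simp [supp], rfl⟩⟩

theorem densityVec_ne_zero (k : ℤ) : densityVec hF α β k ≠ 0 := fun h =>
  ShiftMod.v_ne_zero _ _ _ (congrArg Subtype.val h)

theorem L_lie_densityVec (m k : ℤ) :
    ⁅L p (p * m), densityVec hF α β k⁆ =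
      (α + p * k + p * m * β) • densityVec hF α β (k + m) := by
  apply Subtype.ext
  change ⁅L p (p * m), ShiftMod.v p _ _ (p * k)⁆ = _ • ShiftMod.v p _ _ (p * (k + m))
  rw [ShiftMod.L_lie_v, seriesCoeff, dif_pos (by simp), mul_add]
  push_cast
  rfl

theorem span_densityVec : Submodule.span ℂ (Set.range (densityVec hF α β)) = ⊤ := by
  rw [Submodule.eq_top_iff']
  rintro ⟨y, hy⟩
  change y ∈ Submodule.span ℂ _ at hy
  induction hy using Submodule.span_induction with
  | zero => exact zero_mem _
  | add x y _ _ h h' => exact add_mem h h'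
  | smul t x _ h => exact Submodule.smul_mem _ t h
  | mem x hx =>
  obtain ⟨n, hn, rfl⟩ := hx
  have hn0 : (n : ZMod p) = 0 := by simpa [supp] using hn
  obtain ⟨k, rfl⟩ := (ZMod.intCast_zmod_eq_zero_iff_dvd n p).mp hn0
  exact Submodule.subset_span ⟨k, rfl⟩

theorem L_lie_density_eq_zero {s : ℤ} (hs : (s : ZMod p) ≠ 0) (x : series p α β 0 hF) :
    ⁅L p s, x⁆ = 0 := by
  have hx : x ∈ Submodule.span ℂ (Set.range (densityVec hF α β)) :=
    span_densityVec ▸ Submodule.mem_top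
  induction hx using Submodule.span_induction with
  | zero => simp
  | add x y _ _ h h' => rw [lie_add, h, h', add_zero]
  | smul t x _ h => rw [lie_smul, h, smul_zero]
  | mem x hx =>
  obtain ⟨k, rfl⟩ := hx
  apply Subtype.ext
  change ⁅L p s, ShiftMod.v p _ _ (p * k)⁆ = 0
  rw [ShiftMod.L_lie_v, seriesCoeff, dif_neg hs]
  simp

theorem L_zero_lie_densityVec (k : ℤ) :
    ⁅L p 0, densityVec hF α β k⁆ = (α + p * k) • densityVec hF α β k := by
  have := L_lie_densityVec (hF := hF) (α := α) (β := β) 0 k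
  simpa using this

/-- A submodule of `V(α,β,0)` containing one basis vector of nonzero weight contains all of
them. -/
theorem densityVec_mem_of_mem (hp : 1 < p) (X : LieSubmodule ℂ (GapVir p) (series p α β 0 hF))
    {k l : ℤ} (hk : α + p * k ≠ 0) (hl : α + p * l ≠ 0) (h : densityVec hF α β k ∈ X) :
    densityVec hF α β l ∈ X := by
  have hp0 : (p : ℂ) ≠ 0 := by exact_mod_cast (show p ≠ 0 by omega)
  have step (i j : ℤ) (hi : densityVec hF α β i ∈ X)
      (hij : α + p * i + p * (j - i : ℤ) * β ≠ 0) : densityVec hF α β j ∈ X := by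
    have h1 := X.lie_mem (x := L p (p * (j - i))) hi
    rw [L_lie_densityVec, add_sub_cancel] at h1
    exact (X.toSubmodule.smul_mem_iff hij).mp h1
  by_cases h0 : β = 0
  · exact step k l h (by simpa [h0] using hk)
  by_cases h1 : β = 1
  · refine step k l h ?_
    rw [h1]
    push_cast
    convert hl using 1
    ring
  -- One step from `k` to `l` may have zero coefficient. For $\beta\ne0,1$ each of the two
  -- coefficients of a detour through `j` vanishes for at most one `j`.
  obtain ⟨j, hj1, hj2⟩ : ∃ j : ℤ, α + p * k + p * (j - k : ℤ) * β ≠ 0 ∧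
      α + p * j + p * (l - j : ℤ) * β ≠ 0 := by
    have h1' : 1 - β ≠ 0 := sub_ne_zero.mpr (Ne.symm h1)
    have hfin : ({z : ℂ | z = (p * k * β - α - p * k) / (p * β)} ∪
        {z : ℂ | z = (-α - p * l * β) / (p * (1 - β))}).Finite := by
      simp
    have hinf : (Set.range fun j : ℤ => (j : ℂ)).Infinite :=
      Set.infinite_range_of_injective Int.cast_injective
    obtain ⟨_, ⟨j, rfl⟩, hj⟩ := hinf.exists_notMem_finite hfin
    simp only [Set.mem_union, Set.mem_ofPred_eq, not_or] at hj
    refine ⟨j, fun h => hj.1 ?_, fun h => hj.2 ?_⟩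
    · rw [eq_div_iff (mul_ne_zero hp0 h0)]
      push_cast at h
      linear_combination h
    · rw [eq_div_iff (mul_ne_zero hp0 h1')]
      push_cast at h
      linear_combination h
  exact step j l (step k j h hj1) hj2

/-- Every submodule of `V(α,β,0)` either contains `L 0 • V(α,β,0)` or is killed by `L 0`. -/
theorem density_submodule_dichotomy (hp : 1 < p)
    (X : LieSubmodule ℂ (GapVir p) (series p α β 0 hF)) :
    (∀ k : ℤ, α + p * k ≠ 0 → densityVec hF α β k ∈ X) ∨ (∀ x ∈ X, ⁅L p 0, x⁆ = 0) := by
  have hp0 : (p : ℂ) ≠ 0 := by exact_mod_cast (show p ≠ 0 by omega)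
  by_cases h : ∃ k : ℤ, α + p * k ≠ 0 ∧ densityVec hF α β k ∈ X
  · obtain ⟨k, hk, hkX⟩ := h
    exact Or.inl fun l hl => densityVec_mem_of_mem hp X hk hl hkX
  · push Not at h
    refine Or.inr fun x hx => ?_
    have hx' : x ∈ Submodule.span ℂ (Set.range (densityVec hF α β)) :=
      span_densityVec ▸ Submodule.mem_top
    obtain ⟨f, rfl⟩ := Finsupp.mem_span_range_iff_exists_finsupp.mp hx'
    have hmem := Module.End.mem_of_sum_eigenvectors_mem
      (LieModule.toEnd ℂ (GapVir p) (series p α β 0 hF) (L p 0)) (W := X.toSubmodule)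
      (fun x hx => X.lie_mem hx) (d := fun k : ℤ => α + p * k)
      (fun i j hij => by simpa [hp0] using hij)
      f.support (fun k => f k • densityVec hF α β k)
      (fun k _ => by
        rw [map_smul, LieModule.toEnd_apply_apply, L_zero_lie_densityVec, smul_comm]) hx
    rw [Finsupp.sum, lie_sum]
    refine Finset.sum_eq_zero fun k hk => ?_
    rw [lie_smul, L_zero_lie_densityVec]
    by_cases h0 : α + p * k = 0
    · rw [h0, zero_smul, smul_zero]
    · exact absurd ((X.toSubmodule.smul_mem_iff (Finsupp.mem_support_iff.mp hk)).mp (hmem k hk))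
        (h k h0)

theorem L_zero_lie_mem_of_densityVec_mem
    (X : LieSubmodule ℂ (GapVir p) (series p α β 0 hF))
    (hX : ∀ k : ℤ, α + p * k ≠ 0 → densityVec hF α β k ∈ X) (x : series p α β 0 hF) :
    ⁅L p 0, x⁆ ∈ X := by
  have hx : x ∈ Submodule.span ℂ (Set.range (densityVec hF α β)) :=
    span_densityVec ▸ Submodule.mem_top
  induction hx using Submodule.span_induction with
  | zero => simp
  | add x y _ _ h h' => rw [lie_add]; exact add_mem h h'
  | smul t x _ h => rw [lie_smul]; exact X.smul_mem t h
  | mem x hx =>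
  obtain ⟨k, rfl⟩ := hx
  rw [L_zero_lie_densityVec]
  by_cases h0 : α + p * k = 0
  · rw [h0, zero_smul]
    exact zero_mem _
  · exact X.smul_mem _ (hX k h0)

/-- The dichotomy is applied twice. If `N` were killed by $L_0$, or the kernel of `f` contained the
image of $L_0$, then $L_0$ would kill `A`, making `A` trivial. -/
theorem densityVec_mem_of_surjective (hp : 1 < p) {A : Type*} [AddCommGroup A] [Module ℂ A]
    [LieRingModule (GapVir p) A] [LieModule ℂ (GapVir p) A]
    {N : LieSubmodule ℂ (GapVir p) (series p α β 0 hF)} (f : N →ₗ⁅ℂ, GapVir p⁆ A)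
    (hf : Function.Surjective f) (hA : ¬ LieModule.IsTrivial (GapVir p) A) :
    (∀ k : ℤ, α + p * k ≠ 0 → densityVec hF α β k ∈ N) ∧
      ∀ x : N, f x = 0 → ⁅L p 0, x⁆ = 0 := by
  constructor
  · refine (density_submodule_dichotomy hp N).resolve_right fun h => hA ?_
    refine isTrivial_of_L_zero hp fun y => ?_
    obtain ⟨x, rfl⟩ := hf y
    rw [← LieModuleHom.map_lie, show ⁅L p 0, x⁆ = 0 from Subtype.ext (h x x.2), map_zero]
  · rcases density_submodule_dichotomy hp (f.ker.map N.incl) with h | h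
    · refine absurd (isTrivial_of_L_zero hp fun y => ?_) hA
      obtain ⟨x, rfl⟩ := hf y
      have h1 := L_zero_lie_mem_of_densityVec_mem _ h (x : series p α β 0 hF)
      obtain ⟨y, hy, hxy⟩ := LieSubmodule.mem_map _ |>.mp h1
      have h2 : y = ⁅L p 0, x⁆ := Subtype.ext hxy
      rw [← LieModuleHom.map_lie, ← h2]
      exact f.mem_ker.mp hy
    · exact fun x hx => Subtype.ext
        (h x (LieSubmodule.mem_map _ |>.mpr ⟨x, f.mem_ker.mpr hx, rfl⟩))

/-- `V(α,β,0)` has at most one nontrivial irreducible subquotient. -/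
theorem density_subquotient_unique (hp : 1 < p) {A B : Type*} [AddCommGroup A] [Module ℂ A]
    [LieRingModule (GapVir p) A] [LieModule ℂ (GapVir p) A] [AddCommGroup B] [Module ℂ B]
    [LieRingModule (GapVir p) B] [LieModule ℂ (GapVir p) B]
    [LieModule.IsIrreducible ℂ (GapVir p) A] [LieModule.IsIrreducible ℂ (GapVir p) B]
    {N N' : LieSubmodule ℂ (GapVir p) (series p α β 0 hF)}
    (f : N →ₗ⁅ℂ, GapVir p⁆ A) (g : N' →ₗ⁅ℂ, GapVir p⁆ B)
    (hf : Function.Surjective f) (hg : Function.Surjective g)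
    (hA : ¬ LieModule.IsTrivial (GapVir p) A) (hB : ¬ LieModule.IsTrivial (GapVir p) B) :
    Nonempty (A ≃ₗ⁅ℂ, GapVir p⁆ B) := by
  have hp0 : (p : ℂ) ≠ 0 := by exact_mod_cast (show p ≠ 0 by omega)
  obtain ⟨hN, hf0⟩ := densityVec_mem_of_surjective hp f hf hA
  obtain ⟨hN', hg0⟩ := densityVec_mem_of_surjective hp g hg hB
  obtain ⟨k, hk⟩ : ∃ k : ℤ, α + p * k ≠ 0 := by
    by_contra! h
    have h0 := h 0
    have h1 := h 1
    refine hp0 ?_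
    push_cast at h0 h1
    linear_combination h1 - h0
  let x : (N ⊓ N' : LieSubmodule ℂ (GapVir p) (series p α β 0 hF)) :=
    ⟨densityVec hF α β k, hN k hk, hN' k hk⟩
  have hx : ⁅L p 0, x⁆ ≠ 0 := by
    intro h
    have h2 : ⁅L p 0, densityVec hF α β k⁆ = 0 := congrArg Subtype.val h
    rw [L_zero_lie_densityVec] at h2
    exact smul_ne_zero hk (densityVec_ne_zero k) h2
  let f' := f.comp (LieSubmodule.inclusion (inf_le_left : N ⊓ N' ≤ N))
  let g' := g.comp (LieSubmodule.inclusion (inf_le_right : N ⊓ N' ≤ N'))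
  have hf' (y) (h : f' y = 0) : ⁅L p 0, y⁆ = 0 := by
    have h1 := congrArg Subtype.val (hf0 _ h)
    exact Subtype.ext h1
  have hg' (y) (h : g' y = 0) : ⁅L p 0, y⁆ = 0 := by
    have h1 := congrArg Subtype.val (hg0 _ h)
    exact Subtype.ext h1
  -- Both maps are compared on `N ⊓ N'`. Their kernels lie in the kernel of $L_0$, so does the sum
  -- of the kernels, and `x` is not in it.
  refine nonempty_equiv_of_ker_sup_ne_top f' g'
    (f'.surjective_of_ne_zero fun h => hx (hf' x h))
    (g'.surjective_of_ne_zero fun h => hx (hg' x h)) fun htop => hx ?_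
  have hxt : x ∈ f'.ker ⊔ g'.ker := htop ▸ LieSubmodule.mem_top x
  obtain ⟨y, hy, z, hz, hyz⟩ := LieSubmodule.mem_sup _ _ _ |>.mp hxt
  rw [← hyz, lie_add, hf' y (f'.mem_ker.mp hy), hg' z (g'.mem_ker.mp hz), add_zero]

end Density

end GapVir

/-! ### Modules on which every $L_s$, $s\notin p\mathbb Z$, acts by zero -/

namespace GapVir

variable {p : ℕ} {V : Type*} [AddCommGroup V] [Module ℂ V] [LieRingModule (GapVir p) V]
  [LieModule ℂ (GapVir p) V]

/-- The Virasoro operators `p⁻¹ L_{pm}`. -/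
noncomputable def virOp (p : ℕ) (V : Type*) [AddCommGroup V] [Module ℂ V]
    [LieRingModule (GapVir p) V] [LieModule ℂ (GapVir p) V] (m : ℤ) : Module.End ℂ V :=
  (p : ℂ)⁻¹ • LieModule.toEnd ℂ (GapVir p) V (L p (p * m))

theorem virOp_apply (m : ℤ) (x : V) : virOp p V m x = (p : ℂ)⁻¹ • ⁅L p (p * m), x⁆ := rfl

theorem L_lie_eq_virOp (hp : 1 < p) (m : ℤ) (x : V) :
    ⁅L p (p * m), x⁆ = (p : ℂ) • virOp p V m x := by
  have hp0 : (p : ℂ) ≠ 0 := by exact_mod_cast (show p ≠ 0 by omega)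
  rw [virOp_apply, smul_inv_smul₀ hp0]

/-- The cocycle is already a function of $m/p$, so rescaling both generators by $p^{-1}$ gives the
standard form and contributes $p^{-2}$ to the charge. -/
theorem isVirRep_virOp (hp : 1 < p) {κ : ℂ} (hκ : ∀ x : V, ⁅C p 0, x⁆ = κ • x) :
    IsVirRep (virOp p V) (κ / p ^ 2) := by
  have hp0 : (p : ℂ) ≠ 0 := by exact_mod_cast (show p ≠ 0 by omega)
  intro m n x
  simp only [virOp_apply, lie_smul]
  rw [leibniz_lie, bracket_L_L, bracketLL, if_pos (by simp), if_pos (by simp), ← mul_add]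
  by_cases h : m + n = 0
  · simp only [h, mul_zero, if_true, add_lie, smul_lie, hκ, smul_add, smul_smul]
    push_cast
    match_scalars <;> field_simp
  · have h' : (p : ℤ) * (m + n) ≠ 0 := mul_ne_zero (by omega) h
    simp only [h, h', if_false, add_zero, smul_lie, smul_add, smul_smul, zero_smul]
    push_cast
    match_scalars <;> field_simp

theorem stable_of_virOp (hp : 1 < p) (hT : ∀ s : ℤ, (s : ZMod p) ≠ 0 → ∀ x : V, ⁅L p s, x⁆ = 0)
    {W : Submodule ℂ V} (hW : ∀ m, ∀ x ∈ W, virOp p V m x ∈ W) (m : ℤ) (x : V) (hx : x ∈ W) :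
    ⁅L p m, x⁆ ∈ W := by
  by_cases hm : (m : ZMod p) = 0
  · obtain ⟨k, rfl⟩ := (ZMod.intCast_zmod_eq_zero_iff_dvd m p).mp hm
    rw [L_lie_eq_virOp hp]
    exact W.smul_mem _ (hW k x hx)
  · rw [hT m hm]
    exact W.zero_mem

/-- With nothing acting outside $p\mathbb Z$, the vectors of index in $p\mathbb Z$ span a submodule;
it contains `v 0`, so it is all of `V`. -/
theorem isWeightFamily_virOp (hp : 1 < p) [LieModule.IsIrreducible ℂ (GapVir p) V]
    (hT : ∀ s : ℤ, (s : ZMod p) ≠ 0 → ∀ x : V, ⁅L p s, x⁆ = 0) {a : ℂ} {v : ℤ → V}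
    (hv : IsWeightFamily (LieModule.toEnd ℂ (GapVir p) V (L p 0)) a v) (hv0 : v 0 ≠ 0)
    (hrep : ∃ c, IsVirRep (virOp p V) c) :
    IsWeightFamily (virOp p V 0) (a / p) fun k => v (p * k) := by
  have hp0 : (p : ℂ) ≠ 0 := by exact_mod_cast (show p ≠ 0 by omega)
  obtain ⟨c, hrep⟩ := hrep
  have heig (k : ℤ) : virOp p V 0 (v (p * k)) = (a / p + k) • v (p * k) := by
    have h := hv.eig (p * k)
    rw [LieModule.toEnd_apply_apply] at h
    rw [virOp_apply, mul_zero, h, smul_smul]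
    congr 1
    push_cast
    field_simp
  have hmult (k : ℤ) (x : V) (hx : virOp p V 0 x = (a / p + k) • x) : ∃ t : ℂ, x = t • v (p * k) := by
    refine hv.mult (p * k) x ?_
    have := L_lie_eq_virOp hp 0 x
    rw [mul_zero, hx, smul_smul] at this
    rw [LieModule.toEnd_apply_apply, this]
    congr 1
    push_cast
    field_simp
  refine ⟨heig, hmult, ?_⟩
  refine (stable_eq_bot_or_top hp _ (stable_of_virOp hp hT fun m y hy => ?_)).resolve_left
    fun hbot => ?_
  · induction hy using Submodule.span_induction with
    | zero => simp
    | add y z _ _ h h' => rw [map_add]; exact add_mem h h'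
    | smul t y _ h => rw [map_smul]; exact Submodule.smul_mem _ _ h
    | mem y hy =>
    obtain ⟨k, rfl⟩ := hy
    obtain ⟨t, ht⟩ := hmult (k + m) _ (by
      rw [hrep.weight_shift (heig k)]
      push_cast
      rw [add_assoc])
    rw [ht]
    exact Submodule.smul_mem _ _ (Submodule.subset_span ⟨_, rfl⟩)
  · rw [Submodule.span_eq_bot] at hbot
    exact hv0 (hbot _ ⟨0, by simp⟩)

/-- A nontrivial irreducible module of intermediate series on which `L s` acts by zero for
`s ∉ pℤ` is a subquotient of some `V(α,β,0)`. -/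
theorem exists_density_cover_of_L_eq_zero (hp : 1 < p) [LieModule.IsIrreducible ℂ (GapVir p) V]
    (hV : IsIntermediateSeries p V)
    (hT : ∀ s : ℤ, (s : ZMod p) ≠ 0 → ∀ x : V, ⁅L p s, x⁆ = 0)
    (hnt : ¬ LieModule.IsTrivial (GapVir p) V) :
    ∃ (α β : ℂ) (N : LieSubmodule ℂ (GapVir p) (series p α β 0 admissible_zero))
      (f : N →ₗ⁅ℂ, GapVir p⁆ V), Function.Surjective f := by
  have hp0 : (p : ℂ) ≠ 0 := by exact_mod_cast (show p ≠ 0 by omega)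
  obtain ⟨a, v, hv0, hv⟩ := exists_weightFamily hp hV
  obtain ⟨κ, -, hκ⟩ := exists_central_character hp hV.1
  have hrep := isVirRep_virOp hp (hκ 0 (C_mem_cartan 0))
  obtain ⟨β, hβ⟩ := hrep.exists_density_cover
    (fun W hW => stable_eq_bot_or_top hp W (stable_of_virOp hp hT hW))
    (isWeightFamily_virOp hp hT hv hv0 ⟨_, hrep⟩) (by
      by_contra! h
      refine hnt (isTrivial_of_L hp fun m x => ?_)
      by_cases hm : (m : ZMod p) = 0
      · obtain ⟨k, rfl⟩ := (ZMod.intCast_zmod_eq_zero_iff_dvd m p).mp hm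
        rw [L_lie_eq_virOp hp, h, LinearMap.zero_apply, smul_zero]
      · exact hT m hm x)
  obtain ⟨N, f, hf, hfE⟩ := hβ (series p a β 0 admissible_zero)
    (virOp p (series p a β 0 admissible_zero)) (densityVec admissible_zero a β)
    densityVec_ne_zero (fun m k => by
      rw [virOp_apply, L_lie_densityVec, smul_smul]
      congr 1
      field_simp) span_densityVec
  let N' := lieSubmoduleOfStable hp N (stable_of_virOp hp (fun s hs x => L_lie_density_eq_zero hs x)
    fun m x hx => (hfE m ⟨x, hx⟩).1)
  refine ⟨a, β, N', lieHomOfEquivariant hp (V := N') f fun m x => ?_, hf⟩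
  by_cases hm : (m : ZMod p) = 0
  · obtain ⟨k, rfl⟩ := (ZMod.intCast_zmod_eq_zero_iff_dvd m p).mp hm
    obtain ⟨h1, h2⟩ := hfE k x
    have e : ⁅L p (p * k), x⁆ = ((p : ℂ) • (⟨virOp p _ k x, h1⟩ : N) : N) :=
      Subtype.ext (L_lie_eq_virOp hp k x.1)
    refine (congrArg f e).trans ((f.map_smul _ _).trans ?_)
    rw [h2, ← L_lie_eq_virOp hp]
    rfl
  · have e : ⁅L p m, x⁆ = 0 := Subtype.ext (L_lie_density_eq_zero hm x.1)
    rw [e, hT m hm]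
    exact map_zero f

/-- The coefficient of `v n`. -/
noncomputable def ShiftMod.coeffAt {c : ℤ → ℤ → ℂ} {hc : Compat p c} (n : ℤ) :
    ShiftMod p c hc →ₗ[ℂ] ℂ :=
  (Finsupp.lapply n : (ℤ →₀ ℂ) →ₗ[ℂ] ℂ)

theorem ShiftMod.coeffAt_v {c : ℤ → ℤ → ℂ} {hc : Compat p c} (n m : ℤ) :
    ShiftMod.coeffAt n (ShiftMod.v p c hc m) = if m = n then 1 else 0 :=
  Finsupp.single_apply

/-- The trivial module is a quotient of `V(0,1,0)`. -/
theorem isLieSubquotient_of_isTrivial (hp : 1 < p) [LieModule.IsIrreducible ℂ (GapVir p) V]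
    [LieModule.IsTrivial (GapVir p) V] :
    IsLieSubquotient (GapVir p) V (series p 0 1 0 admissible_zero) := by
  have := LieModule.nontrivial_of_isIrreducible ℂ (GapVir p) V
  obtain ⟨u, hu⟩ := exists_ne (0 : V)
  -- The coordinate along $v_0$ is invariant: the coefficient of $L_{pm}v_{pk}$ is $p(k+m)$, which
  -- vanishes exactly when the target is $v_0$.
  let f : series p 0 1 0 admissible_zero →ₗ[ℂ] V :=
    LinearMap.toSpanSingleton ℂ V u ∘ₗ ShiftMod.coeffAt 0 ∘ₗ (series p 0 1 0 _).toSubmodule.subtype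
  have hf (k : ℤ) : f (densityVec _ 0 1 k) = if (p : ℤ) * k = 0 then u else 0 := by
    change ShiftMod.coeffAt 0 (ShiftMod.v p (seriesCoeff 0 1 0)
      (seriesCoeff_compat 0 1 admissible_zero) (p * k)) • u = _
    rw [ShiftMod.coeffAt_v, ite_smul, one_smul, zero_smul]
  let g : series p 0 1 0 admissible_zero →ₗ⁅ℂ, GapVir p⁆ V := lieHomOfEquivariant hp f (by
    intro m x
    rw [LieModule.IsTrivial.trivial (L p m) (f x)]
    by_cases hm : (m : ZMod p) = 0
    · obtain ⟨l, rfl⟩ := (ZMod.intCast_zmod_eq_zero_iff_dvd m p).mp hm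
      have hx : x ∈ Submodule.span ℂ (Set.range (densityVec admissible_zero 0 1)) :=
        span_densityVec ▸ Submodule.mem_top
      induction hx using Submodule.span_induction with
      | zero => simp
      | add x y _ _ h h' => rw [lie_add, map_add, h, h', add_zero]
      | smul t x _ h => rw [lie_smul, map_smul, h, smul_zero]
      | mem x hx =>
      obtain ⟨k, rfl⟩ := hx
      rw [L_lie_densityVec, map_smul, hf]
      split_ifs with h
      · have h' : (p : ℂ) * k + p * l = 0 := by
          rw [mul_add] at h
          exact_mod_cast h
        rw [zero_add, mul_one, h', zero_smul]
      · rw [smul_zero]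
    · rw [L_lie_density_eq_zero hm, map_zero])
  let h := g.comp (⊤ : LieSubmodule ℂ (GapVir p) (series p 0 1 0 admissible_zero)).incl
  refine isLieSubquotient_of_surjective h (h.surjective_of_ne_zero
    (x := ⟨densityVec _ 0 1 0, LieSubmodule.mem_top _⟩) ?_)
  change f (densityVec _ 0 1 0) ≠ 0
  rw [hf]
  simpa using hu

end GapVir

/-! ### Heisenberg pairs and the vanishing of $C_i$, $i\ne0$ -/

theorem IsWeightFamily.pow_apply {V : Type*} [AddCommGroup V] [Module ℂ V] {X : Module.End ℂ V}
    {v : ℤ → V} {s : ℤ} (hX : ∀ n, ∃ t : ℂ, X (v n) = t • v (n + s)) (k : ℕ) (n : ℤ) :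
    ∃ t : ℂ, (X ^ k) (v n) = t • v (n + k * s) := by
  induction k with
  | zero => exact ⟨1, by simp⟩
  | succ k ih =>
    obtain ⟨t, ht⟩ := ih
    obtain ⟨t', ht'⟩ := hX (n + k * s)
    refine ⟨t * t', ?_⟩
    rw [pow_succ', Module.End.mul_apply, ht, map_smul, ht', smul_smul]
    congr 2
    push_cast
    ring

section Heisenberg

variable {V : Type*} [AddCommGroup V] [Module ℂ V] {A B : Module.End ℂ V} {c : ℂ}

theorem heisenberg_lower_pow (h : ∀ x, A (B x) = B (A x) + c • x) {y : V} (hy : A y = 0) (j : ℕ) :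
    A ((B ^ (j + 1)) y) = ((j + 1 : ℂ) * c) • (B ^ j) y := by
  induction j with
  | zero => simp [h, hy]
  | succ j ih =>
    rw [pow_succ', Module.End.mul_apply, h, ih, map_smul, ← Module.End.mul_apply B, ← pow_succ']
    push_cast
    module

/-- For a Heisenberg pair acting on one-dimensional weight spaces, one of the two operators never
kills a given weight vector. -/
theorem heisenberg_pow_ne_zero (h : ∀ x, A (B x) = B (A x) + c • x) (hc : c ≠ 0) {v : ℤ → V}
    {s : ℤ} (hA : ∀ n, ∃ t : ℂ, A (v n) = t • v (n + s))
    (hB : ∀ n, ∃ t : ℂ, B (v n) = t • v (n + -s)) {n : ℤ} (hn : v n ≠ 0) :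
    (∀ k, (A ^ k) (v n) ≠ 0) ∨ ∀ k, (B ^ k) (v n) ≠ 0 := by
  by_contra! hcon
  obtain ⟨hex, j, hj⟩ := hcon
  classical
  have hk := Nat.find_spec hex
  obtain ⟨k, hkeq⟩ : ∃ k, Nat.find hex = k + 1 := by
    refine Nat.exists_eq_succ_of_ne_zero fun h0 => hn ?_
    rw [h0] at hk
    simpa using hk
  have hy0 : (A ^ k) (v n) ≠ 0 := Nat.find_min hex (by omega)
  rw [hkeq, pow_succ', Module.End.mul_apply] at hk
  -- The last surviving vector $A^kv_n$ is killed by `A`, so no power of `B` kills it. But $B^k$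
  -- brings it back to a multiple of `v n`, which $B^j$ kills.
  have hne (i : ℕ) : (B ^ i) ((A ^ k) (v n)) ≠ 0 := by
    induction i with
    | zero => simpa using hy0
    | succ i ih =>
      intro h0
      have h1 := heisenberg_lower_pow h hk i
      rw [h0, map_zero, eq_comm, smul_eq_zero, or_iff_left ih, mul_eq_zero, or_iff_left hc] at h1
      exact Nat.cast_add_one_ne_zero i h1
  obtain ⟨t, ht⟩ := IsWeightFamily.pow_apply hA k n
  obtain ⟨t', ht'⟩ := IsWeightFamily.pow_apply hB k (n + k * s)
  refine hne (j + k) ?_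
  rw [pow_add, Module.End.mul_apply, ht, map_smul, ht', show n + k * s + k * -s = n by ring,
    map_smul, map_smul, hj, smul_zero, smul_zero]

/-- Two operators of the same weight, one commuting with a Heisenberg pair and the other a power
of a member of the pair, cannot both be nonzero. -/
theorem heisenberg_central_eq_zero (h : ∀ x, A (B x) = B (A x) + c • x) {X : Module.End ℂ V}
    (hXA : ∀ x, X (A x) = A (X x)) (hXB : ∀ x, X (B x) = B (X x)) {v : ℤ → V} {s t : ℤ}
    (hA : ∀ n, ∃ e : ℂ, A (v n) = e • v (n + t)) (hB : ∀ n, ∃ e : ℂ, B (v n) = e • v (n + -t))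
    (hX : ∀ n, ∃ e : ℂ, X (v n) = e • v (n + s)) {a b : ℕ} (hab : (b : ℤ) * s = a * t)
    (ha : a ≠ 0) {n : ℤ} (h1 : (X ^ b) (v n) ≠ 0) (h2 : (A ^ a) (v n) ≠ 0) : c = 0 := by
  obtain ⟨e, he⟩ : ∃ e : ℂ, B (A (v n)) = e • v n := by
    obtain ⟨e1, h1⟩ := hA n
    obtain ⟨e2, h2⟩ := hB (n + t)
    exact ⟨e1 * e2, by rw [h1, map_smul, h2, smul_smul, add_neg_cancel_right]⟩
  -- `B A` has eigenvalue `e` along the orbit of `X` but $e-kc$ along that of `A`. Since $bs=at$,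
  -- the vectors $X^bv_n$ and $A^av_n$ are nonzero multiples of one vector, so $ac=0$.
  have hx (k : ℕ) : B (A ((X ^ k) (v n))) = e • (X ^ k) (v n) := by
    induction k with
    | zero => simpa using he
    | succ k ih => rw [pow_succ', Module.End.mul_apply, ← hXA, ← hXB, ih, map_smul]
  have hy (k : ℕ) : B (A ((A ^ k) (v n))) = (e - k * c) • (A ^ k) (v n) := by
    induction k with
    | zero => simpa using he
    | succ k ih =>
      have h3 := h (A ((A ^ k) (v n)))
      rw [ih, map_smul] at h3
      rw [pow_succ', Module.End.mul_apply, ← sub_eq_of_eq_add h3]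
      push_cast
      module
  obtain ⟨t1, e1⟩ := IsWeightFamily.pow_apply hX b n
  obtain ⟨t2, e2⟩ := IsWeightFamily.pow_apply hA a n
  rw [← hab] at e2
  have h3 := hx b
  have h4 := hy a
  rw [e1] at h1 h3
  rw [e2] at h2 h4
  rw [smul_ne_zero_iff] at h1 h2
  rw [map_smul, map_smul, smul_comm e, smul_right_inj h1.1] at h3
  rw [map_smul, map_smul, smul_comm _ t2, smul_right_inj h2.1, h3] at h4
  have h5 := smul_left_injective ℂ h1.2 h4
  simp only [eq_comm (a := e), sub_eq_self, mul_eq_zero, Nat.cast_eq_zero, ha, false_or] at h5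
  exact h5

end Heisenberg

namespace GapVir

variable {p : ℕ} {V : Type*} [AddCommGroup V] [Module ℂ V] [LieRingModule (GapVir p) V]
  [LieModule ℂ (GapVir p) V]

/-- The operator `L m`. -/
noncomputable abbrev op (p : ℕ) (V : Type*) [AddCommGroup V] [Module ℂ V]
    [LieRingModule (GapVir p) V] [LieModule ℂ (GapVir p) V] (m : ℤ) : Module.End ℂ V :=
  LieModule.toEnd ℂ (GapVir p) V (L p m)

theorem exists_op_smul {a : ℂ} {v : ℤ → V} (hv : IsWeightFamily (op p V 0) a v) (m n : ℤ) :
    ∃ t : ℂ, op p V m (v n) = t • v (n + m) := by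
  apply hv.mult
  have h := hv.eig n
  simp only [LieModule.toEnd_apply_apply] at h ⊢
  rw [lie_L_zero_L, h, lie_smul, ← add_smul]
  push_cast
  rw [add_assoc]

theorem op_vir_comm {m s : ℤ} (hm : (m : ZMod p) = 0) (hs : (s : ZMod p) ≠ 0) (x : V) :
    op p V m (op p V s x) = op p V s (op p V m x) + (s : ℂ) • op p V (m + s) x := by
  simp only [LieModule.toEnd_apply_apply]
  rw [leibniz_lie, bracket_L_L, bracketLL, if_pos hm, if_neg hs, smul_lie, add_comm]

theorem op_comm {r s : ℤ} (hr : (r : ZMod p) ≠ 0) (hs : (s : ZMod p) ≠ 0) (hrs : r + s ≠ 0)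
    (x : V) : op p V r (op p V s x) = op p V s (op p V r x) := by
  simp only [LieModule.toEnd_apply_apply]
  rw [leibniz_lie, bracket_L_L, bracketLL, if_neg hr, if_neg hs, if_neg hrs, zero_lie, zero_add]

theorem op_neg_comm {r : ℤ} (hr : (r : ZMod p) ≠ 0) {κ : ℂ}
    (hκ : ∀ x : V, ⁅C p r, x⁆ = κ • x) (x : V) :
    op p V r (op p V (-r) x) = op p V (-r) (op p V r x) + (r * κ : ℂ) • x := by
  simp only [LieModule.toEnd_apply_apply]
  rw [leibniz_lie, bracket_L_L, bracketLL, if_neg hr, if_neg (by simpa using hr),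
    if_pos (by ring), smul_lie, hκ, smul_smul, add_comm]

/-- The elements `C i`, `i ≠ 0`, act by zero on an irreducible module of intermediate series. -/
theorem central_eq_zero {i : ZMod p} (hp : 1 < p) (hi : i ≠ 0) {κ : ℂ}
    (hκ : ∀ x : V, ⁅C p i, x⁆ = κ • x) {a : ℂ} {v : ℤ → V}
    (hv : IsWeightFamily (op p V 0) a v) (hv0 : v 0 ≠ 0) : κ = 0 := by
  by_contra hκ0
  have : NeZero p := ⟨by omega⟩
  have cast_pos (k : ℕ) : ((i.val + k * p : ℕ) : ZMod p) = i := by simp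
  have hpos (k : ℕ) : i.val + k * p ≠ 0 := by
    have : i.val ≠ 0 := by simpa using hi
    omega
  have hdich (k : ℕ) : (∀ j, (op p V (i.val + k * p : ℕ) ^ j) (v 0) ≠ 0) ∨
      ∀ j, (op p V (-(i.val + k * p : ℕ)) ^ j) (v 0) ≠ 0 := by
    refine heisenberg_pow_ne_zero (c := ((i.val + k * p : ℕ) : ℤ) * κ)
      (op_neg_comm (by rw [Int.cast_natCast, cast_pos]; exact hi)
        (by rw [Int.cast_natCast, cast_pos]; exact hκ)) ?_ (exists_op_smul hv _)
      (exists_op_smul hv _) hv0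
    exact mul_ne_zero (by exact_mod_cast hpos k) hκ0
  -- With $s,t$ the two indices, $L_{\varepsilon s}^t$ and $L_{\varepsilon t}^s$ shift weights
  -- equally, and $L_{\varepsilon s}$ commutes with the pair $L_{\pm\varepsilon t}$ because $s\ne\pm
  -- t$.
  have key (j k : ℕ) (hjk : j ≠ k) (ε : ℤ) (hε : ε = 1 ∨ ε = -1)
      (hj : ∀ l, (op p V (ε * (i.val + j * p : ℕ)) ^ l) (v 0) ≠ 0)
      (hk : ∀ l, (op p V (ε * (i.val + k * p : ℕ)) ^ l) (v 0) ≠ 0) : False := by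
    have hne : i.val + j * p ≠ i.val + k * p := by
      simpa [hjk] using (show p ≠ 0 by omega)
    have hj0 := hpos j
    have hk0 := hpos k
    have cj := cast_pos j
    have ck := cast_pos k
    generalize i.val + j * p = s at *
    generalize i.val + k * p = t at *
    have cs : ((ε * s : ℤ) : ZMod p) ≠ 0 := by
      rcases hε with rfl | rfl <;> simpa [cj] using hi
    have ct : ((ε * t : ℤ) : ZMod p) ≠ 0 := by
      rcases hε with rfl | rfl <;> simpa [ck] using hi
    have ht : ∀ x : V, ⁅C p ((ε * t : ℤ) : ZMod p), x⁆ = κ • x := by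
      rcases hε with rfl | rfl
      · simpa [ck] using hκ
      · simpa [ck, C_neg] using hκ
    have hst : ε * s + ε * t ≠ 0 := by rcases hε with rfl | rfl <;> omega
    have hst' : ε * s + -(ε * t) ≠ 0 := by rcases hε with rfl | rfl <;> omega
    have h0 := heisenberg_central_eq_zero (op_neg_comm ct ht) (op_comm cs ct hst)
      (op_comm cs (by simpa using ct) hst') (exists_op_smul hv _) (exists_op_smul hv _)
      (exists_op_smul hv _) (a := s) (b := t) (by ring) hj0 (hj t) (hk s)
    rw [mul_eq_zero, or_iff_left hκ0] at h0
    have : ε * t ≠ 0 := by rcases hε with rfl | rfl <;> omega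
    exact this (by exact_mod_cast h0)
  have key1 (j k : ℕ) (hjk : j ≠ k) := key j k hjk 1 (Or.inl rfl)
  have key2 (j k : ℕ) (hjk : j ≠ k) := key j k hjk (-1) (Or.inr rfl)
  simp only [one_mul, neg_one_mul] at key1 key2
  -- Pigeonhole: three indices, two directions.
  rcases hdich 0 with h0 | h0 <;> rcases hdich 1 with h1 | h1 <;> rcases hdich 2 with h2 | h2
  · exact key1 0 1 (by decide) h0 h1
  · exact key1 0 1 (by decide) h0 h1
  · exact key1 0 2 (by decide) h0 h2
  · exact key2 1 2 (by decide) h1 h2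
  · exact key1 1 2 (by decide) h1 h2
  · exact key2 0 2 (by decide) h0 h2
  · exact key2 0 1 (by decide) h0 h1
  · exact key2 0 1 (by decide) h0 h1

end GapVir

/-! ### Active operators are bijective -/

namespace GapVir

variable {p : ℕ} {V : Type*} [AddCommGroup V] [Module ℂ V] [LieRingModule (GapVir p) V]
  [LieModule ℂ (GapVir p) V]

/-- The operators `L s`, `s ∉ pℤ`, commute with each other. -/
def OpsCommute (p : ℕ) (V : Type*) [AddCommGroup V] [Module ℂ V] [LieRingModule (GapVir p) V]
    [LieModule ℂ (GapVir p) V] : Prop :=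
  ∀ r s : ℤ, (r : ZMod p) ≠ 0 → (s : ZMod p) ≠ 0 → ∀ x : V,
    op p V r (op p V s x) = op p V s (op p V r x)

/-- `s ∉ pℤ` and some `L t` with `t ≡ s` modulo `p` acts nontrivially. -/
def IsActive (p : ℕ) (V : Type*) [AddCommGroup V] [Module ℂ V] [LieRingModule (GapVir p) V]
    [LieModule ℂ (GapVir p) V] (s : ℤ) : Prop :=
  (s : ZMod p) ≠ 0 ∧ ∃ t : ℤ, (t : ZMod p) = s ∧ ∃ x : V, op p V t x ≠ 0

theorem IsActive.congr {s t : ℤ} (hs : IsActive p V s) (h : (t : ZMod p) = s) :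
    IsActive p V t := by
  unfold IsActive
  rw [h]
  exact hs

theorem op_eq_zero_of_not_isActive {s : ℤ} (hs : (s : ZMod p) ≠ 0) (h : ¬ IsActive p V s) (x : V) :
    op p V s x = 0 := by
  by_contra hx
  exact h ⟨hs, s, rfl, x, hx⟩

theorem OpsCommute.pow (hc : OpsCommute p V) {r s : ℤ} (hr : (r : ZMod p) ≠ 0)
    (hs : (s : ZMod p) ≠ 0) (k : ℕ) (x : V) :
    op p V r ((op p V s ^ k) x) = (op p V s ^ k) (op p V r x) := by
  induction k with
  | zero => simp
  | succ k ih => rw [pow_succ', Module.End.mul_apply, hc r s hr hs, ih, Module.End.mul_apply]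

/-- $L_m$ acts like a derivation on powers of $L_s$; a single correction term suffices because
$L_{m+s}$ commutes with $L_s$. -/
theorem op_vir_pow (hc : OpsCommute p V) {m s : ℤ} (hm : (m : ZMod p) = 0) (hs : (s : ZMod p) ≠ 0)
    (k : ℕ) (x : V) :
    op p V m ((op p V s ^ (k + 1)) x) = (op p V s ^ (k + 1)) (op p V m x) +
      ((k + 1 : ℂ) * s) • (op p V s ^ k) (op p V (m + s) x) := by
  have hms : ((m + s : ℤ) : ZMod p) ≠ 0 := by simpa [hm] using hs
  induction k with
  | zero =>
    simpa using op_vir_comm hm hs x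
  | succ k ih =>
    rw [pow_succ', Module.End.mul_apply, op_vir_comm hm hs, ih, hc.pow hms hs, map_add, map_smul,
      ← Module.End.mul_apply (op p V s), ← Module.End.mul_apply (op p V s), ← pow_succ', ← pow_succ',
      ← Module.End.mul_apply]
    push_cast
    module

section Irreducible

variable [LieModule.IsIrreducible ℂ (GapVir p) V]

/-- The common kernel of all $L_{m+s}$, $m\in p\mathbb Z$, is a submodule, and it is not `V` because
`s` is active. -/
theorem eq_zero_of_forall_op_eq_zero (hp : 1 < p) (hc : OpsCommute p V) {s : ℤ}
    (hs : IsActive p V s) {x : V} (hx : ∀ m : ℤ, (m : ZMod p) = 0 → op p V (m + s) x = 0) :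
    x = 0 := by
  obtain ⟨hs0, t, hts, y, hy⟩ := hs
  let W : Submodule ℂ V := ⨅ (m : ℤ) (_ : (m : ZMod p) = 0), LinearMap.ker (op p V (m + s))
  have hW (z : V) : z ∈ W ↔ ∀ m : ℤ, (m : ZMod p) = 0 → op p V (m + s) z = 0 := by
    simp [W, Submodule.mem_iInf]
  have hms {m : ℤ} (hm : (m : ZMod p) = 0) : ((m + s : ℤ) : ZMod p) ≠ 0 := by simpa [hm] using hs0
  have hbot : W = ⊥ := by
    refine (stable_eq_bot_or_top hp W fun m z hz => ?_).resolve_right fun htop => hy ?_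
    · change op p V m z ∈ W
      rw [hW] at hz ⊢
      intro l hl
      by_cases hm : (m : ZMod p) = 0
      · have h := op_vir_comm hm (hms hl) z
        rw [hz l hl, map_zero, ← add_assoc, hz (m + l) (by simp [hm, hl]), smul_zero, add_zero] at h
        exact h.symm
      · rw [hc _ _ (hms hl) hm, hz l hl, map_zero]
    · have h := (hW y).mp (htop ▸ Submodule.mem_top) (t - s) (by simp [hts])
      rwa [sub_add_cancel] at h
  have := (hW x).mpr hx
  rwa [hbot] at this

/-- Applying $L_m$ to a vanishing product differentiates it: after raising the power of $L_s$, the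
only remaining term has one factor $L_t$ replaced by $L_{m+t}$. As `m` varies, that factor can be
stripped off. -/
theorem pow_eq_zero_of_mul_pow_eq_zero (hp : 1 < p) (hc : OpsCommute p V) {s t : ℤ}
    (hs : IsActive p V s) (ht : IsActive p V t) (b a : ℕ)
    (h : ∀ x : V, (op p V s ^ a) ((op p V t ^ b) x) = 0) :
    ∃ N, ∀ x : V, (op p V s ^ N) x = 0 := by
  induction b generalizing a with
  | zero => exact ⟨a, by simpa using h⟩
  | succ b ih =>
  have hpow (k : ℕ) (hk : a ≤ k) (x : V) : (op p V s ^ k) ((op p V t ^ (b + 1)) x) = 0 := by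
    rw [← Nat.sub_add_cancel hk, pow_add, Module.End.mul_apply, h, map_zero]
  refine ih (a + 2) fun x => ?_
  refine eq_zero_of_forall_op_eq_zero hp hc ht fun m hm => ?_
  have hmt : ((m + t : ℤ) : ZMod p) ≠ 0 := by simpa [hm] using ht.1
  have hms : ((m + s : ℤ) : ZMod p) ≠ 0 := by simpa [hm] using hs.1
  rw [hc.pow hmt hs.1, hc.pow hmt ht.1]
  have h1 := op_vir_pow hc hm hs.1 (a + 1) ((op p V t ^ (b + 1)) x)
  rw [hpow _ (by omega), map_zero, op_vir_pow hc hm ht.1, map_add, map_smul, hpow _ (by omega),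
    zero_add, hc.pow hms ht.1, hpow _ (by omega), smul_zero, add_zero, eq_comm, smul_eq_zero,
    mul_eq_zero] at h1
  refine h1.resolve_left fun h2 => ?_
  rcases h2 with h2 | h2
  · exact Nat.cast_add_one_ne_zero b h2
  · refine ht.1 ?_
    have : t = 0 := by exact_mod_cast h2
    simp [this]

/-- Differentiating $L_s^{N+1}=0$ by all $L_m$ gives $L_{m+s}L_s^N=0$ and hence $L_s^N=0$, down to
the identity. -/
theorem not_nilpotent (hp : 1 < p) (hc : OpsCommute p V) {s : ℤ} (hs : IsActive p V s) (N : ℕ) :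
    ¬ ∀ x : V, (op p V s ^ N) x = 0 := by
  induction N with
  | zero =>
    intro h
    obtain ⟨x, hx⟩ := (hs.2.choose_spec.2 : ∃ x : V, _)
    exact hx (by simpa using h (op p V hs.2.choose x))
  | succ N ih =>
    intro h
    refine ih fun x => eq_zero_of_forall_op_eq_zero hp hc hs fun m hm => ?_
    have hms : ((m + s : ℤ) : ZMod p) ≠ 0 := by simpa [hm] using hs.1
    have h1 := op_vir_pow hc hm hs.1 N x
    rw [h, h, map_zero, zero_add, eq_comm, smul_eq_zero, mul_eq_zero] at h1
    rw [hc.pow hms hs.1]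
    refine h1.resolve_left fun h2 => ?_
    rcases h2 with h2 | h2
    · exact Nat.cast_add_one_ne_zero N h2
    · refine hs.1 ?_
      have : s = 0 := by exact_mod_cast h2
      simp [this]

/-- Active operators are injective. -/
theorem eq_zero_of_op_eq_zero (hp : 1 < p) (hc : OpsCommute p V) {a : ℂ} {v : ℤ → V}
    (hv : IsWeightFamily (op p V 0) a v) {s : ℤ} (hs : IsActive p V s) {x : V}
    (hx : op p V s x = 0) : x = 0 := by
  by_contra hx0
  let W : Submodule ℂ V :=
    { carrier := {x | ∃ k : ℕ, (op p V s ^ k) x = 0}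
      add_mem' := by
        rintro x y ⟨k, hk⟩ ⟨l, hl⟩
        refine ⟨k + l, ?_⟩
        rw [map_add, pow_add, Module.End.mul_apply, Module.End.mul_apply, hl, map_zero, add_zero,
          ← Module.End.mul_apply, ← pow_add, add_comm, pow_add, Module.End.mul_apply, hk, map_zero]
      zero_mem' := ⟨0, by simp⟩
      smul_mem' := by
        rintro t x ⟨k, hk⟩
        exact ⟨k, by rw [map_smul, hk, smul_zero]⟩ }
  -- The vectors killed by some power of $L_s$ form a submodule, so one kernel vector already makes
  -- $L_s$ locally nilpotent.
  have htop : W = ⊤ := by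
    refine (stable_eq_bot_or_top hp W ?_).resolve_left fun hbot => hx0 ?_
    · rintro m y ⟨k, hk⟩
      by_cases hm : (m : ZMod p) = 0
      · have hms : ((m + s : ℤ) : ZMod p) ≠ 0 := by simpa [hm] using hs.1
        have h1 := op_vir_pow hc hm hs.1 k y
        have h2 : (op p V s ^ (k + 1)) y = 0 := by
          rw [pow_succ', Module.End.mul_apply, hk, map_zero]
        rw [h2, map_zero, ← hc.pow hms hs.1, hk, map_zero, smul_zero, add_zero] at h1
        exact ⟨k + 1, h1.symm⟩
      · refine ⟨k, ?_⟩
        change (op p V s ^ k) (op p V m y) = 0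
        rw [← hc.pow hm hs.1, hk, map_zero]
    · have : x ∈ W := ⟨1, by simpa using hx⟩
      rwa [hbot] at this
  obtain ⟨q, rfl⟩ : ∃ q, p = q + 1 := Nat.exists_eq_succ_of_ne_zero (by omega)
  -- With $q=p-1$ this `t` is congruent to `s`, hence active, and $L_s^qL_t$ preserves weights.
  -- Being scalar on each `v n` and locally nilpotent, it is zero, which would make $L_s$ nilpotent.
  let t : ℤ := -(q * s)
  have ht : IsActive (q + 1) V t := hs.congr (by
    have : (q : ZMod (q + 1)) = -1 := by
      rw [eq_neg_iff_add_eq_zero]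
      exact_mod_cast ZMod.natCast_self (q + 1)
    simp [t, this])
  have hzero : ∀ x : V, (op (q + 1) V s ^ q) ((op (q + 1) V t ^ 1) x) = 0 := by
    suffices (op (q + 1) V s ^ q) ∘ₗ op (q + 1) V t = 0 by
      intro x
      rw [pow_one]
      exact LinearMap.congr_fun this x
    refine LinearMap.ext_on_range hv.span fun n => ?_
    rw [LinearMap.comp_apply, LinearMap.zero_apply]
    obtain ⟨e, he⟩ : ∃ e : ℂ, (op (q + 1) V s ^ q) (op (q + 1) V t (v n)) = e • v n := by
      obtain ⟨e1, h1⟩ := exists_op_smul hv t n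
      obtain ⟨e2, h2⟩ := IsWeightFamily.pow_apply (exists_op_smul hv s) q (n + t)
      refine ⟨e1 * e2, ?_⟩
      rw [h1, map_smul, h2, smul_smul, show n + t + q * s = n by simp [t]]
    have hex : ∃ k : ℕ, (op (q + 1) V s ^ k) (v n) = 0 := by
      have : v n ∈ W := htop ▸ Submodule.mem_top
      exact this
    classical
    have hk := Nat.find_spec hex
    rcases h0 : Nat.find hex with _ | k
    · rw [h0, pow_zero, Module.End.one_apply] at hk
      rw [hk, map_zero, map_zero]
    · have hk' : (op (q + 1) V s ^ k) (v n) ≠ 0 := Nat.find_min hex (by omega)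
      have h1 := congrArg (op (q + 1) V s ^ k) he
      rw [← Module.End.mul_apply, ← pow_add, ← hc.pow ht.1 hs.1,
        show k + q = (q - 1) + (k + 1) by omega, pow_add, Module.End.mul_apply, ← h0, hk, map_zero,
        map_zero, map_smul, eq_comm, smul_eq_zero, or_iff_left hk'] at h1
      rw [he, h1, zero_smul]
  obtain ⟨N, hN⟩ := pow_eq_zero_of_mul_pow_eq_zero hp hc hs ht 1 q hzero
  exact not_nilpotent hp hc hs N hN

theorem weight_ne_zero_add (hp : 1 < p) (hc : OpsCommute p V) {a : ℂ} {v : ℤ → V}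
    (hv : IsWeightFamily (op p V 0) a v) {s : ℤ} (hs : IsActive p V s) {n : ℤ} (hn : v n ≠ 0) :
    v (n + s) ≠ 0 := by
  intro h
  obtain ⟨t, ht⟩ := exists_op_smul hv s n
  rw [h, smul_zero] at ht
  exact hn (eq_zero_of_op_eq_zero hp hc hv hs ht)

/-- Going down by `s` is going up: $p-2$ steps by `s`, then one by $-(p-1)s$, which is congruent to
`s` and so active. -/
theorem weight_ne_zero_sub (hp : 1 < p) (hc : OpsCommute p V) {a : ℂ} {v : ℤ → V}
    (hv : IsWeightFamily (op p V 0) a v) {s : ℤ} (hs : IsActive p V s) {n : ℤ} (hn : v n ≠ 0) :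
    v (n - s) ≠ 0 := by
  obtain ⟨q, rfl⟩ : ∃ q, p = q + 2 := ⟨p - 2, by omega⟩
  have hmul (k : ℕ) : v (n + k * s) ≠ 0 := by
    induction k with
    | zero => simpa using hn
    | succ k ih =>
      have := weight_ne_zero_add hp hc hv hs ih
      rwa [show n + k * s + s = n + (k + 1 : ℕ) * s by push_cast; ring] at this
  have ht : IsActive (q + 2) V (-((q + 1) * s)) := hs.congr (by
    have : (q : ZMod (q + 2)) + 1 = -1 := by
      rw [eq_neg_iff_add_eq_zero, add_assoc, one_add_one_eq_two]
      exact_mod_cast ZMod.natCast_self (q + 2)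
    push_cast
    rw [this]
    ring)
  have := weight_ne_zero_add hp hc hv ht (hmul q)
  rwa [show n + q * s + -((q + 1) * s) = n - s by ring] at this

theorem op_surjective (hp : 1 < p) (hc : OpsCommute p V) {a : ℂ} {v : ℤ → V}
    (hv : IsWeightFamily (op p V 0) a v) {s : ℤ} (hs : IsActive p V s) :
    Function.Surjective (op p V s) := by
  rw [← LinearMap.range_eq_top, ← top_le_iff, ← hv.span, Submodule.span_le]
  rintro _ ⟨n, rfl⟩
  by_cases hn : v n = 0
  · rw [hn]
    exact zero_mem _
  · have hn' := weight_ne_zero_sub hp hc hv hs hn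
    obtain ⟨t, ht⟩ := exists_op_smul hv s (n - s)
    rw [sub_add_cancel] at ht
    have ht0 : t ≠ 0 := by
      rintro rfl
      rw [zero_smul] at ht
      exact hn' (eq_zero_of_op_eq_zero hp hc hv hs ht)
    exact (Submodule.smul_mem_iff _ ht0).mp ⟨_, ht⟩

/-- A weight family adapted to a set of indices closed under the action is supported there. -/
theorem mem_of_weight_ne_zero (hp : 1 < p) {a : ℂ} {v : ℤ → V}
    (hv : IsWeightFamily (op p V 0) a v) (hv0 : v 0 ≠ 0) {Q : Set ℤ} (h0 : 0 ∈ Q)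
    (hQ : ∀ n ∈ Q, ∀ m, n + m ∉ Q → op p V m (v n) = 0) {n : ℤ} (hn : v n ≠ 0) : n ∈ Q := by
  by_contra hnQ
  obtain ⟨l, hl1, hl⟩ := Module.End.exists_dual_of_eigenvector (op p V 0) (hv.eig n) hn
  have htop : Submodule.span ℂ (v '' Q) = ⊤ := by
    refine (stable_eq_bot_or_top hp _ fun m y hy => ?_).resolve_left fun hbot => ?_
    · induction hy using Submodule.span_induction with
      | zero => simp
      | add y z _ _ h h' => rw [lie_add]; exact add_mem h h'
      | smul t y _ h => rw [lie_smul]; exact Submodule.smul_mem _ _ h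
      | mem y hy =>
      obtain ⟨k, hk, rfl⟩ := hy
      by_cases hkm : k + m ∈ Q
      · obtain ⟨t, ht⟩ := exists_op_smul hv m k
        change op p V m (v k) ∈ _
        rw [ht]
        exact Submodule.smul_mem _ _ (Submodule.subset_span ⟨_, hkm, rfl⟩)
      · have := hQ k hk m hkm
        rw [LieModule.toEnd_apply_apply] at this
        rw [this]
        exact zero_mem _
    · rw [Submodule.span_eq_bot] at hbot
      exact hv0 (hbot _ ⟨0, h0, rfl⟩)
  have hker : Submodule.span ℂ (v '' Q) ≤ LinearMap.ker l := by
    rw [Submodule.span_le]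
    rintro _ ⟨k, hk, rfl⟩
    refine hl (a + k) _ (fun h => hnQ ?_) (hv.eig k)
    have : k = n := by simpa using h
    exact this ▸ hk
  rw [htop] at hker
  have : l (v n) = 0 := hker Submodule.mem_top
  rw [hl1] at this
  exact one_ne_zero this

end Irreducible

end GapVir

/-! ### The affine law and bases adapted to a shift -/

/-- The relation satisfied by the constants `h m` with `L_m v_n = (n + h m) v_{n+m}` forces `h` to
be affine. -/
theorem affine_of_virasoro_relation {h : ℤ → ℂ} {c : ℂ}
    (hrel : ∀ m l : ℤ, (l : ℂ) * h l - m * h m =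
      (l - m) * h (m + l) + if m + l = 0 then ((m : ℂ) ^ 3 - m) / 12 * c else 0) (k : ℤ) :
    h k = h 0 + k * (h 1 - h 0) := by
  -- Affine functions satisfy the relation without its central term, so away from $m+l=0$ the
  -- deviation `e` obeys the same law. The values at $0,\pm1,\pm2$ start the recursion with
  -- $m=\pm1$.
  obtain ⟨e, he⟩ : ∃ e : ℤ → ℂ, ∀ k, e k = h k - h 0 - k * (h 1 - h 0) := ⟨_, fun _ => rfl⟩
  have rel (m l : ℤ) (hml : m + l ≠ 0) : (l : ℂ) * e l - m * e m = (l - m) * e (m + l) := by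
    have := hrel m l
    rw [if_neg hml] at this
    rw [he, he, he]
    push_cast
    linear_combination this
  have e0 : e 0 = 0 := by simp [he]
  have e1 : e 1 = 0 := by simp [he]
  have en1 : e (-1) = 0 := by
    have := hrel 1 (-1)
    norm_num at this
    rw [he]
    push_cast
    linear_combination -this
  have e2 : e 2 = 0 := by
    have := rel (-1) 2 (by decide)
    norm_num [e1, en1] at this
    exact this
  have en2 : e (-2) = 0 := by
    have := rel 1 (-2) (by decide)
    norm_num [e1, en1] at this
    exact this
  have hpos (n : ℕ) : e (n + 2) = 0 := by
    induction n with
    | zero => simpa using e2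
    | succ n ih =>
      have := rel 1 (n + 2) (by omega)
      rw [ih, e1, show (1 : ℤ) + (n + 2) = (n + 1 : ℕ) + 2 by push_cast; ring, mul_zero, mul_zero,
        sub_zero, eq_comm, mul_eq_zero] at this
      refine this.resolve_left fun h0 => Nat.cast_add_one_ne_zero (R := ℂ) n ?_
      push_cast at h0
      linear_combination h0
  have hneg (n : ℕ) : e (-(n + 2)) = 0 := by
    induction n with
    | zero => simpa using en2
    | succ n ih =>
      have := rel (-1) (-(n + 2)) (by omega)
      rw [ih, en1, show (-1 : ℤ) + -(n + 2) = -((n + 1 : ℕ) + 2) by push_cast; ring, mul_zero,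
        mul_zero, sub_zero, eq_comm, mul_eq_zero] at this
      refine this.resolve_left fun h0 => Nat.cast_add_one_ne_zero (R := ℂ) n ?_
      push_cast at h0
      linear_combination -h0
  have hall : e k = 0 := by
    rcases lt_trichotomy k 0 with hk | rfl | hk
    · by_cases h1 : k = -1
      · rw [h1, en1]
      · have := hneg (-k - 2).toNat
        rwa [show -(((-k - 2).toNat : ℤ) + 2) = k by omega] at this
    · exact e0
    · by_cases h1 : k = 1
      · rw [h1, e1]
      · have := hpos (k - 2).toNat
        rwa [show ((k - 2).toNat : ℤ) + 2 = k by omega] at this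
  rw [he] at hall
  linear_combination hall

theorem shift_equiv_zpow {V : Type*} [AddCommGroup V] [Module ℂ V] {B : V ≃ₗ[ℂ] V}
    {H : Module.End ℂ V} {q : ℂ}
    (hB : ∀ x, H (B x) = B (H x) + q • B x) (k : ℤ) (x : V) :
    H ((B ^ k) x) = (B ^ k) (H x) + (k * q : ℂ) • (B ^ k) x := by
  induction k using Int.induction_on with
  | zero => simp
  | succ k ih =>
    rw [add_comm (k : ℤ), zpow_one_add, LinearEquiv.mul_apply, LinearEquiv.mul_apply, hB, ih,
      map_add, map_smul]
    push_cast
    module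
  | pred k ih =>
    apply B.injective
    have e (y : V) : B ((B ^ (-(k : ℤ) - 1)) y) = (B ^ (-(k : ℤ))) y := by
      rw [← LinearEquiv.mul_apply, ← zpow_one_add, add_sub_cancel]
    have h1 := hB ((B ^ (-(k : ℤ) - 1)) x)
    rw [e, ih] at h1
    rw [map_add, map_smul, e, e, ← sub_eq_of_eq_add h1]
    push_cast
    module

/-- One vector is kept for each residue and transported along its class by powers of `B`: the new
family is `(B ^ (n / p)) (v (n % p))`. -/
theorem exists_adapted_weightFamily {p : ℕ} {V : Type*} [AddCommGroup V] [Module ℂ V]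
    (hp : 1 < p) {a : ℂ} {v : ℤ → V} {H : Module.End ℂ V}
    (hv : IsWeightFamily H a v) (hv0 : v 0 ≠ 0) {B : V ≃ₗ[ℂ] V}
    (hB : ∀ x, H (B x) = B (H x) + (p : ℂ) • B x) :
    ∃ w : ℤ → V, IsWeightFamily H a w ∧ w 0 ≠ 0 ∧ ∀ n, B (w n) = w (n + p) := by
  have hp0 : (p : ℤ) ≠ 0 := by omega
  have hmult (n : ℤ) (x : V) (hx : H x = (a + n) • x) :
      ∃ t : ℂ, x = t • (B ^ (n / p)) (v (n % p)) := by
    have h1 : H ((B ^ (-(n / p))) x) = (a + (n % p : ℤ)) • (B ^ (-(n / p))) x := by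
      rw [shift_equiv_zpow hB, hx, map_smul, ← add_smul]
      congr 1
      have : (n : ℂ) = (n % p : ℤ) + p * (n / p : ℤ) := by
        exact_mod_cast (Int.emod_add_mul_ediv n p).symm
      rw [this]
      push_cast
      ring
    obtain ⟨t, ht⟩ := hv.mult _ _ h1
    refine ⟨t, ?_⟩
    rw [← map_smul, ← ht, ← LinearEquiv.mul_apply, ← zpow_add, add_neg_cancel, zpow_zero,
      LinearEquiv.coe_one, id]
  refine ⟨fun n => (B ^ (n / p)) (v (n % p)), ⟨fun n => ?_, hmult, ?_⟩, ?_, fun n => ?_⟩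
  · rw [shift_equiv_zpow hB, hv.eig, map_smul, ← add_smul]
    congr 1
    have : (n : ℂ) = (n % p : ℤ) + p * (n / p : ℤ) := by
      exact_mod_cast (Int.emod_add_mul_ediv n p).symm
    rw [this]
    ring
  · rw [← top_le_iff, ← hv.span, Submodule.span_le]
    rintro _ ⟨n, rfl⟩
    obtain ⟨t, ht⟩ := hmult n (v n) (hv.eig n)
    rw [ht]
    exact Submodule.smul_mem _ _ (Submodule.subset_span ⟨n, rfl⟩)
  · simpa using hv0
  · simp only [Int.add_ediv_of_dvd_right (dvd_refl (p : ℤ)), Int.ediv_self hp0, Int.add_emod_right]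
    rw [add_comm, zpow_one_add, LinearEquiv.mul_apply]

/-! ### The action in an adapted basis -/

namespace GapVir

variable {p : ℕ} {V : Type*} [AddCommGroup V] [Module ℂ V] [LieRingModule (GapVir p) V]
  [LieModule ℂ (GapVir p) V]

section Irreducible

variable [LieModule.IsIrreducible ℂ (GapVir p) V]

/-- The invertible operator `L_{s+p} L_s⁻¹`. -/
theorem exists_shift_equiv (hp : 1 < p) (hc : OpsCommute p V) {a : ℂ} {v : ℤ → V}
    (hv : IsWeightFamily (op p V 0) a v) {s : ℤ} (hs : IsActive p V s) :
    ∃ B : V ≃ₗ[ℂ] V, (∀ x, B (op p V s x) = op p V (s + p) x) ∧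
      (∀ r : ℤ, (r : ZMod p) ≠ 0 → ∀ x, B (op p V r x) = op p V r (B x)) ∧
      ∀ x, op p V 0 (B x) = B (op p V 0 x) + (p : ℂ) • B x := by
  have hs' : IsActive p V (s + p) := hs.congr (by simp)
  have hbij {t : ℤ} (ht : IsActive p V t) : Function.Bijective (op p V t) :=
    ⟨(injective_iff_map_eq_zero _).mpr fun x hx => eq_zero_of_op_eq_zero hp hc hv ht hx,
      op_surjective hp hc hv ht⟩
  let B := (LinearEquiv.ofBijective _ (hbij hs)).symm.trans (LinearEquiv.ofBijective _ (hbij hs'))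
  have hB (x : V) : B (op p V s x) = op p V (s + p) x := by
    change op p V (s + p) ((LinearEquiv.ofBijective _ (hbij hs)).symm
      (LinearEquiv.ofBijective _ (hbij hs) x)) = _
    rw [LinearEquiv.symm_apply_apply]
  refine ⟨B, hB, fun r hr x => ?_, fun x => ?_⟩
  · obtain ⟨y, rfl⟩ := (hbij hs).2 x
    rw [hc r s hr hs.1, hB, hB, hc r _ hr hs'.1]
  · obtain ⟨y, rfl⟩ := (hbij hs).2 x
    have h1 := op_vir_comm (V := V) (m := 0) (by simp) hs.1 y
    have h2 := op_vir_comm (V := V) (m := 0) (by simp) hs'.1 y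
    rw [zero_add] at h1 h2
    rw [h1, hB, map_add, map_smul, hB, hB, h2]
    push_cast
    module

/-- If some `L s` with `s ∉ pℤ` acts nontrivially, then the action is given by the formulas
for `V(α,β,F)`. -/
theorem exists_series_coefficients (hp : 1 < p) (hc : OpsCommute p V) {a κ : ℂ} {v : ℤ → V}
    (hκ : ∀ x : V, ⁅C p 0, x⁆ = κ • x) (hv : IsWeightFamily (op p V 0) a v) (hv0 : v 0 ≠ 0)
    {s₀ : ℤ} (hs₀ : IsActive p V s₀) :
    ∃ (β : ℂ) (F : Matrix {i : ZMod p // i ≠ 0} (ZMod p) ℂ) (w : ℤ → V), Admissible F ∧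
      IsWeightFamily (op p V 0) a w ∧ (∀ n : ℤ, w n ≠ 0 ↔ (n : ZMod p) ∈ supp F) ∧
      ∀ m n : ℤ, w n ≠ 0 → op p V m (w n) = seriesCoeff a β F m n • w (n + m) := by
  have : NeZero p := ⟨by omega⟩
  have hp0 : (p : ℂ) ≠ 0 := by exact_mod_cast (show p ≠ 0 by omega)
  obtain ⟨B, hB, hBop, hBH⟩ := exists_shift_equiv hp hc hv hs₀
  obtain ⟨w, hw, hw0, hBw⟩ := exists_adapted_weightFamily hp hv hv0 hBH
  clear hv hv0 v
  choose g hg using fun m n : ℤ => exists_op_smul hw m n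
  have hadd {s n : ℤ} (hs : IsActive p V s) (hn : w n ≠ 0) : w (n + s) ≠ 0 :=
    weight_ne_zero_add hp hc hw hs hn
  have hsub {s n : ℤ} (hs : IsActive p V s) (hn : w n ≠ 0) : w (n - s) ≠ 0 :=
    weight_ne_zero_sub hp hc hw hs hn
  have hcancel {n : ℤ} (hn : w n ≠ 0) {x y : ℂ} (h : x • w n = y • w n) : x = y :=
    smul_left_injective ℂ hn h
  have hact {s m : ℤ} (hs : IsActive p V s) (hm : (m : ZMod p) = 0) : IsActive p V (m + s) :=
    hs.congr (by simp [hm])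
  have hBne (n : ℤ) : w (n + p) ≠ 0 ↔ w n ≠ 0 := by
    rw [← hBw, Ne, LinearEquiv.map_eq_zero_iff]
  have hne_mul (n k : ℤ) : w (n + p * k) ≠ 0 ↔ w n ≠ 0 := by
    induction k using Int.induction_on with
    | zero => simp
    | succ k ih => rw [mul_add, mul_one, ← add_assoc, hBne, ih]
    | pred k ih => rw [← hBne, mul_sub, mul_one, add_assoc, sub_add_cancel, ih]
  have hne_congr {n k : ℤ} (h : (n : ZMod p) = k) : w n ≠ 0 ↔ w k ≠ 0 := by
    obtain ⟨j, hj⟩ := (ZMod.intCast_eq_intCast_iff_dvd_sub n k p).mp h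
    rw [show k = n + p * j by rw [← hj]; ring, hne_mul]
  have hgne {s n : ℤ} (hs : IsActive p V s) (hn : w n ≠ 0) : g s n ≠ 0 := by
    intro h
    have := hg s n
    rw [h, zero_smul] at this
    exact hn (eq_zero_of_op_eq_zero hp hc hw hs this)
  -- the coefficients of an active operator are periodic in the second variable
  have hper {s n : ℤ} (hs : IsActive p V s) (hn : w n ≠ 0) : g s (n + p) = g s n := by
    have h1 := hBop s hs.1 (w n)
    rw [hg, map_smul, hBw, hBw, hg, show n + s + p = n + p + s by ring] at h1
    exact (hcancel (hadd hs ((hBne n).mpr hn)) h1).symm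
  have hper_mul {s n : ℤ} (hs : IsActive p V s) (hn : w n ≠ 0) (k : ℤ) :
      g s (n + p * k) = g s n := by
    induction k using Int.induction_on with
    | zero => simp
    | succ k ih => rw [mul_add, mul_one, ← add_assoc, hper hs ((hne_mul n k).mpr hn), ih]
    | pred k ih => rw [← hper hs ((hne_mul n _).mpr hn), mul_sub, mul_one, add_assoc, sub_add_cancel,
        ih]
  have hper_of {s n m : ℤ} (hs : IsActive p V s) (hn : w n ≠ 0) (hm : (m : ZMod p) = 0) :
      g s (n + m) = g s n := by
    obtain ⟨k, rfl⟩ := (ZMod.intCast_zmod_eq_zero_iff_dvd m p).mp hm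
    exact hper_mul hs hn k
  have hne_of {n m : ℤ} (hm : (m : ZMod p) = 0) (hn : w n ≠ 0) : w (n + m) ≠ 0 :=
    (hne_congr (by simp [hm])).mpr hn
  have hcomm {r s n : ℤ} (hr : IsActive p V r) (hs : IsActive p V s) (hn : w n ≠ 0) :
      g s (n + r) * g r n = g r (n + s) * g s n := by
    have h1 := hc r s hr.1 hs.1 (w n)
    rw [hg s, map_smul, hg r, hg r, map_smul, hg s, smul_smul, smul_smul,
      show n + s + r = n + r + s by ring] at h1
    rw [mul_comm, ← hcancel (hadd hs (hadd hr hn)) h1, mul_comm]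
  -- the increments of `g m`
  let ψ : ℤ → ℤ → ℤ → ℂ := fun m s n => g (m + s) n / g s n
  have hincr {m s n : ℤ} (hm : (m : ZMod p) = 0) (hs : IsActive p V s) (hn : w n ≠ 0) :
      g m (n + s) = g m n + s * ψ m s n := by
    have h1 := op_vir_comm hm hs.1 (w n)
    rw [hg s, map_smul, hg m, hg m, map_smul, hg s, hg (m + s), smul_smul, smul_smul, smul_smul,
      show n + s + m = n + m + s by ring, show n + (m + s) = n + m + s by ring, ← add_smul] at h1
    have h2 := hcancel (hadd hs (hne_of hm hn)) h1
    rw [hper_of hs hn hm] at h2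
    have h3 := hgne hs hn
    refine mul_left_cancel₀ h3 ?_
    rw [h2]
    simp only [ψ]
    field_simp
  have hψ_add {m s r n : ℤ} (hm : (m : ZMod p) = 0) (hs : IsActive p V s) (hr : IsActive p V r)
      (hn : w n ≠ 0) : ψ m s (n + r) = ψ m s n := by
    have h1 := hcomm hr hs hn
    have h2 := hcomm hr (hact hs hm) hn
    rw [show n + (m + s) = n + s + m by ring, hper_of hr (hadd hs hn) hm] at h2
    simp only [ψ]
    rw [div_eq_div_iff (hgne hs (hadd hr hn)) (hgne hs hn)]
    refine mul_right_cancel₀ (hgne hr hn) ?_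
    linear_combination g s n * h2 - g (m + s) n * h1
  have hψ_mul {m s n : ℤ} (hm : (m : ZMod p) = 0) (hs : IsActive p V s) (hn : w n ≠ 0) (k : ℤ) :
      w (n + k * s) ≠ 0 ∧ ψ m s (n + k * s) = ψ m s n ∧
        g m (n + k * s) = g m n + k * (s * ψ m s n) := by
    induction k using Int.induction_on with
    | zero => simpa using hn
    | succ k ih =>
      obtain ⟨h1, h2, h3⟩ := ih
      rw [show n + ((k : ℤ) + 1) * s = n + k * s + s by ring]
      refine ⟨hadd hs h1, (hψ_add hm hs hs h1).trans h2, ?_⟩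
      rw [hincr hm hs h1, h2, h3]
      push_cast
      ring
    | pred k ih =>
      obtain ⟨h1, h2, h3⟩ := ih
      have h4 := hsub hs h1
      have h5 := hψ_add hm hs hs h4
      have h6 := hincr hm hs h4
      rw [sub_add_cancel] at h5 h6
      rw [show n + (-(k : ℤ) - 1) * s = n + -(k : ℤ) * s - s by ring]
      refine ⟨h4, by rw [← h5, h2], ?_⟩
      rw [eq_sub_of_add_eq h6.symm, h3, ← h5, h2]
      push_cast
      ring
  have hcast_ne {s : ℤ} (hs : IsActive p V s) : (s : ℂ) ≠ 0 := by
    intro h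
    have : s = 0 := by exact_mod_cast h
    exact hs.1 (by simp [this])
  -- The index $n+ss_0$ is reached by $s_0$ steps of `s` or by `s` steps of $s_0$; comparing `g m`
  -- there shows that the increment does not depend on the active index.
  have hψ_eq {m s n : ℤ} (hm : (m : ZMod p) = 0) (hs : IsActive p V s) (hn : w n ≠ 0) :
      ψ m s n = ψ m s₀ n := by
    have h1 := (hψ_mul hm hs hn s₀).2.2
    have h2 := (hψ_mul hm hs₀ hn s).2.2
    rw [show n + s₀ * s = n + s * s₀ by ring, h2] at h1
    have h3 := mul_ne_zero (hcast_ne hs) (hcast_ne hs₀)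
    refine mul_left_cancel₀ h3 ?_
    linear_combination -h1
  -- the coefficients of an active operator are periodic in the first variable
  have hper' {s n : ℤ} (hs : IsActive p V s) (hn : w n ≠ 0) : g (p + s) n = g s n := by
    have h1 : g (p + s₀) n = g s₀ n := by
      have h2 := hB (w n)
      rw [hg, map_smul, hBw, add_comm s₀, hg, show n + (p + s₀) = n + s₀ + p by ring] at h2
      exact (hcancel ((hBne _).mpr (hadd hs₀ hn)) h2).symm
    -- The normalisation `B (w n) = w (n + p)` says $\psi_p=1$ for $s_0$, hence for every active
    -- `s`.
    have h3 := hψ_eq (m := p) (by simp) hs hn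
    simp only [ψ] at h3
    rw [h1, div_self (hgne hs₀ hn), div_eq_one_iff_eq (hgne hs hn)] at h3
    exact h3
  have hper'_mul {s n : ℤ} (hs : IsActive p V s) (hn : w n ≠ 0) (k : ℤ) :
      g (p * k + s) n = g s n := by
    induction k using Int.induction_on with
    | zero => simp
    | succ k ih =>
      rw [mul_add, mul_one, show (p : ℤ) * k + p + s = p + (p * k + s) by ring,
        hper' (hact hs (by simp)) hn, ih]
    | pred k ih =>
      rw [← hper' (hact hs (by simp)) hn, mul_sub, mul_one,
        show (p : ℤ) + (p * -(k : ℤ) - p + s) = p * -(k : ℤ) + s by ring, ih]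
  have hg_congr {s t n k : ℤ} (hs : IsActive p V s) (hn : w n ≠ 0) (hst : (t : ZMod p) = s)
      (hnk : (k : ZMod p) = n) : g t k = g s n := by
    obtain ⟨i, hi⟩ := (ZMod.intCast_eq_intCast_iff_dvd_sub s t p).mp hst.symm
    obtain ⟨j, hj⟩ := (ZMod.intCast_eq_intCast_iff_dvd_sub n k p).mp hnk.symm
    rw [show t = p * i + s by rw [← hi]; ring, show k = n + p * j by rw [← hj]; ring,
      hper'_mul hs ((hne_mul n j).mpr hn), hper_mul hs hn]
  have hstep {m s n : ℤ} (hm : (m : ZMod p) = 0) (hs : IsActive p V s) (hn : w n ≠ 0) :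
      g m (n + s) = g m n + s := by
    have h1 : g (m + s) n = g s n := hg_congr hs hn (by simp [hm]) rfl
    rw [hincr hm hs hn]
    simp only [ψ]
    rw [h1, div_self (hgne hs hn), mul_one]
  have hstep_p {m n : ℤ} (hm : (m : ZMod p) = 0) (hn : w n ≠ 0) : g m (n + p) = g m n + p := by
    have h1 := hstep hm hs₀ ((hBne n).mpr hn)
    have h2 := hstep hm (hact hs₀ (m := p) (by simp)) hn
    rw [← add_assoc, h1] at h2
    push_cast at h2
    linear_combination h2
  have hstep_mul {m n : ℤ} (hm : (m : ZMod p) = 0) (hn : w n ≠ 0) (k : ℤ) :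
      g m (n + p * k) = g m n + p * k := by
    induction k using Int.induction_on with
    | zero => simp
    | succ k ih =>
      rw [mul_add, mul_one, ← add_assoc, hstep_p hm ((hne_mul n k).mpr hn), ih]
      push_cast
      ring
    | pred k ih =>
      have h1 := hstep_p hm ((hne_mul n (-(k : ℤ) - 1)).mpr hn)
      rw [show n + (p : ℤ) * (-(k : ℤ) - 1) + p = n + p * -(k : ℤ) by ring, ih] at h1
      push_cast at h1 ⊢
      linear_combination -h1
  -- The law holds at `0` and is preserved by every step along which the action does not vanish; by
  -- irreducibility such steps reach every weight.
  have hlin {n : ℤ} (hn : w n ≠ 0) : ∀ m : ℤ, (m : ZMod p) = 0 → g m n = n + g m 0 := by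
    let Q : Set ℤ := {n : ℤ | w n ≠ 0 ∧ ∀ m : ℤ, (m : ZMod p) = 0 → g m n = n + g m 0}
    have : n ∈ Q := by
      refine mem_of_weight_ne_zero hp hw hw0 (Q := Q) ⟨hw0, by simp⟩ ?_ hn
      rintro k ⟨hk, hk'⟩ r hr
      by_contra hne
      refine hr ?_
      by_cases hr0 : (r : ZMod p) = 0
      · refine ⟨hne_of hr0 hk, fun m hm => ?_⟩
        obtain ⟨j, rfl⟩ := (ZMod.intCast_zmod_eq_zero_iff_dvd r p).mp hr0
        rw [hstep_mul hm hk, hk' m hm]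
        push_cast
        ring
      · have hra : IsActive p V r := by
          by_contra h
          exact hne (op_eq_zero_of_not_isActive hr0 h _)
        refine ⟨hadd hra hk, fun m hm => ?_⟩
        rw [hstep hm hra hk, hk' m hm]
        push_cast
        ring
    exact this.2
  -- the Virasoro relation
  obtain ⟨β, hβ⟩ : ∃ β, ∀ k : ℤ, g (p * k) 0 = a + p * k * β := by
    have hg0 : g 0 0 = a := by
      have h1 := hg 0 0
      rw [hw.eig] at h1
      have h2 := hcancel (by simpa using hw0) (h1.symm.trans (by rw [add_zero]) : _ = _)
      simpa using h2
    have haff := affine_of_virasoro_relation (h := fun k => g (p * k) 0 / p) (c := κ / p ^ 2) (by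
      intro m l
      have h1 := isVirRep_virOp hp hκ m l (w 0)
      have hpm (m n : ℤ) : virOp p V m (w n) = ((p : ℂ)⁻¹ * g (p * m) n) • w (n + p * m) := by
        rw [virOp_apply, mul_smul]
        congr 1
        exact hg (p * m) n
      have hl (m l : ℤ) : g (p * m) (p * l) = p * l + g (p * m) 0 := by
        have := hlin (n := p * l) (by simpa using (hne_mul 0 l).mpr hw0) (p * m) (by simp)
        push_cast at this
        exact this
      have hwne : w (p * (m + l)) ≠ 0 := by simpa using (hne_mul 0 (m + l)).mpr hw0
      rw [hpm l, map_smul, hpm m, hpm m, map_smul, hpm l, hpm (m + l)] at h1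
      simp only [zero_add] at h1
      rw [hl, hl, ← mul_add, ← mul_add, add_comm l m] at h1
      have h2 : (if m + l = 0 then ((m : ℂ) ^ 3 - m) / 12 * (κ / p ^ 2) else 0) • w 0 =
          (if m + l = 0 then ((m : ℂ) ^ 3 - m) / 12 * (κ / p ^ 2) else 0) • w (p * (m + l)) := by
        split_ifs with h
        · rw [h, mul_zero]
        · simp
      rw [h2, smul_smul, smul_smul, smul_smul, ← add_smul, ← add_smul] at h1
      have h3 := hcancel hwne h1
      generalize (if m + l = 0 then ((m : ℂ) ^ 3 - m) / 12 * (κ / p ^ 2) else 0) = z at h3 ⊢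
      field_simp at h3 ⊢
      refine mul_left_cancel₀ hp0 ?_
      linear_combination h3)
    refine ⟨g (p * 1) 0 / p - g (p * 0) 0 / p, fun k => ?_⟩
    have := haff k
    rw [div_eq_iff hp0] at this
    rw [this, mul_zero, hg0]
    field_simp
  -- the matrix
  classical
  -- The default `0` on inactive rows and absent residues makes `supp F` exactly the set of residues
  -- occurring in `V`, the row of `s₀` being nonzero at each of them.
  let F : Matrix {i : ZMod p // i ≠ 0} (ZMod p) ℂ := fun i j =>
    if IsActive p V (i.1.val : ℤ) ∧ w (j.val : ℤ) ≠ 0 then g (i.1.val : ℤ) (j.val : ℤ) else 0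
  have hval (i : ZMod p) : ((i.val : ℤ) : ZMod p) = i := by simp
  have hF_active {s n : ℤ} (hs : IsActive p V s) (hn : w n ≠ 0) : F ⟨s, hs.1⟩ n = g s n := by
    have h1 : IsActive p V (((s : ZMod p).val : ℕ) : ℤ) := hs.congr (hval _)
    have h2 : w (((n : ZMod p).val : ℕ) : ℤ) ≠ 0 := (hne_congr (hval _)).mpr hn
    simp only [F]
    rw [if_pos ⟨h1, h2⟩]
    exact hg_congr hs hn (hval _) (hval _)
  have hF_cases (i : {i : ZMod p // i ≠ 0}) (j : ZMod p) :
      F i j = 0 ∨ ∃ s n : ℤ, ∃ hs : IsActive p V s, w n ≠ 0 ∧ i = ⟨s, hs.1⟩ ∧ j = n := by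
    by_cases h : IsActive p V (i.1.val : ℤ) ∧ w (j.val : ℤ) ≠ 0
    · exact Or.inr ⟨_, _, h.1, h.2, Subtype.ext (hval _).symm, (hval _).symm⟩
    · exact Or.inl (if_neg h)
  have hF_not {s n : ℤ} (hs : (s : ZMod p) ≠ 0) (h : ¬ IsActive p V s) : F ⟨s, hs⟩ n = 0 := by
    rcases hF_cases ⟨s, hs⟩ n with h0 | ⟨s', n', hs', -, h2, -⟩
    · exact h0
    · exact absurd (hs'.congr (congrArg Subtype.val h2)) h
  have hF₀ {n : ℤ} (hn : w n ≠ 0) : F ⟨s₀, hs₀.1⟩ n ≠ 0 := by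
    rw [hF_active hs₀ hn]
    exact hgne hs₀ hn
  have hF : Admissible F := by
    refine ⟨Or.inr ⟨⟨s₀, hs₀.1⟩, by simpa using hF₀ hw0⟩, fun i j hij => ?_, fun r s i => ?_⟩
    · obtain ⟨s, n, hs, hn, rfl, rfl⟩ := (hF_cases i j).resolve_left hij
      exact ⟨⟨s₀, hs₀.1⟩, by simpa [add_comm] using hF₀ (hadd hs hn)⟩
    · rcases hF_cases s i with h | ⟨s, n, hs, hn, rfl, rfl⟩
      · rcases hF_cases r i with h' | ⟨r, n, hr, hn, rfl, rfl⟩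
        · rw [h, h', mul_zero, mul_zero]
        · rcases hF_cases s ((n : ZMod p) + (r : ZMod p)) with h2 | ⟨s, -, hs, -, rfl, -⟩
          · rw [h, h2, mul_zero, zero_mul]
          · rw [hF_active hs hn] at h
            exact absurd h (hgne hs hn)
      · rcases hF_cases r n with h' | ⟨r, -, hr, -, rfl, -⟩
        · rcases hF_cases r ((n : ZMod p) + (s : ZMod p)) with h2 | ⟨r, -, hr, -, rfl, -⟩
          · rw [h', h2, mul_zero, zero_mul]
          · rw [hF_active hr hn] at h'
            exact absurd h' (hgne hr hn)
        · have h1 := hF_active hr (hadd hs hn)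
          have h2 := hF_active hs (hadd hr hn)
          rw [Int.cast_add] at h1 h2
          simp only
          rw [h1, h2, hF_active hr hn, hF_active hs hn]
          exact (hcomm hr hs hn).symm
  refine ⟨β, F, w, hF, hw, fun n => ⟨fun hn => Or.inr ⟨_, hF₀ hn⟩, ?_⟩, fun m n hn => ?_⟩
  · rintro (h | ⟨i, hi⟩)
    · exact (hne_congr (by simpa using h)).mpr hw0
    · obtain ⟨s, k, hs, hk, -, h⟩ := (hF_cases i n).resolve_left hi
      exact (hne_congr h).mpr hk
  · rw [seriesCoeff]
    split_ifs with hm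
    · obtain ⟨k, rfl⟩ := (ZMod.intCast_zmod_eq_zero_iff_dvd m p).mp hm
      rw [hg, hlin hn _ hm, hβ]
      congr 1
      push_cast
      ring
    · by_cases hma : IsActive p V m
      · rw [hg, hF_active hma hn]
      · rw [op_eq_zero_of_not_isActive hm hma, hF_not hm hma, zero_smul]

end Irreducible

end GapVir

/-! ### Isomorphism with $V(\alpha,\beta,F)$ -/

namespace GapVir

variable {p : ℕ} {V : Type*} [AddCommGroup V] [Module ℂ V] [LieRingModule (GapVir p) V]
  [LieModule ℂ (GapVir p) V]

/-- A module with the action of `V(α,β,F)` on a weight family is isomorphic to `V(α,β,F)`. -/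
theorem exists_bijective_of_series_coefficients (hp : 1 < p) {a β : ℂ}
    {F : Matrix {i : ZMod p // i ≠ 0} (ZMod p) ℂ} (hF : Admissible F) {w : ℤ → V}
    (hw : IsWeightFamily (op p V 0) a w) (hsupp : ∀ n : ℤ, w n ≠ 0 ↔ (n : ZMod p) ∈ supp F)
    (hact : ∀ m n : ℤ, w n ≠ 0 → op p V m (w n) = seriesCoeff a β F m n • w (n + m)) :
    ∃ f : series p a β F hF →ₗ⁅ℂ, GapVir p⁆ V, Function.Bijective f := by
  let S : Set ℤ := {n | (n : ZMod p) ∈ supp F}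
  let f₀ : ShiftMod p (seriesCoeff a β F) (seriesCoeff_compat a β hF) →ₗ[ℂ] V :=
    (Finsupp.linearCombination ℂ w : (ℤ →₀ ℂ) →ₗ[ℂ] V)
  have hf₀ (n : ℤ) : f₀ (ShiftMod.v p _ _ n) = w n :=
    (Finsupp.linearCombination_single ℂ 1 n).trans (one_smul ℂ _)
  have hequiv (m : ℤ) (y) (hy : y ∈ Submodule.span ℂ (ShiftMod.v p (seriesCoeff a β F)
      (seriesCoeff_compat a β hF) '' S)) : f₀ ⁅L p m, y⁆ = ⁅L p m, f₀ y⁆ := by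
    induction hy using Submodule.span_induction with
    | zero => simp
    | add x y _ _ h h' => rw [lie_add, map_add, map_add, lie_add, h, h']
    | smul t x _ h => rw [lie_smul, map_smul, map_smul, lie_smul, h]
    | mem x hx =>
    obtain ⟨n, hn, rfl⟩ := hx
    rw [ShiftMod.L_lie_v, map_smul, hf₀, hf₀]
    exact (hact m n ((hsupp n).mpr hn)).symm
  let f : series p a β F hF →ₗ⁅ℂ, GapVir p⁆ V :=
    lieHomOfEquivariant hp (f₀ ∘ₗ (series p a β F hF).toSubmodule.subtype)
      fun m x => hequiv m x.1 x.2
  refine ⟨f, (injective_iff_map_eq_zero f).mpr ?_, ?_⟩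
  · rintro ⟨y, hy⟩ hzero
    have hy' : (show ℤ →₀ ℂ from y) ∈ Finsupp.supported ℂ ℂ S := by
      rw [Finsupp.supported_eq_span_single]
      exact hy
    have hsum : ∑ n ∈ (show ℤ →₀ ℂ from y).support, (show ℤ →₀ ℂ from y) n • w n = 0 := hzero
    have hall := Module.End.mem_of_sum_eigenvectors_mem (op p V 0) (W := ⊥) (by simp)
      (d := fun n : ℤ => a + n) (fun i j hij => by simpa using hij)
      (show ℤ →₀ ℂ from y).support (fun n => (show ℤ →₀ ℂ from y) n • w n)
      (fun n _ => by rw [map_smul, hw.eig, smul_comm]) ((Submodule.mem_bot ℂ).mpr hsum)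
    have hempty : (show ℤ →₀ ℂ from y).support = ∅ := by
      refine Finset.eq_empty_of_forall_notMem fun n hn => ?_
      have h1 := (Submodule.mem_bot ℂ).mp (hall n hn)
      rcases smul_eq_zero.mp h1 with h2 | h2
      · exact Finsupp.mem_support_iff.mp hn h2
      · exact (hsupp n).mpr ((Finsupp.mem_supported ℂ _).mp hy' hn) h2
    exact Subtype.ext (Finsupp.support_eq_empty.mp hempty)
  · have hrange : LinearMap.range (f : series p a β F hF →ₗ[ℂ] V) = ⊤ := by
      rw [← top_le_iff, ← hw.span, Submodule.span_le]
      rintro _ ⟨n, rfl⟩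
      by_cases hn : w n = 0
      · rw [hn]
        exact zero_mem _
      · exact ⟨⟨ShiftMod.v p _ _ n, Submodule.subset_span ⟨n, (hsupp n).mp hn, rfl⟩⟩, hf₀ n⟩
    exact LinearMap.range_eq_top.mp hrange

/-- An irreducible module is its only irreducible subquotient. -/
theorem nonempty_equiv_subquotient_of_bijective {𝔤 : Type*} [LieRing 𝔤] [LieAlgebra ℂ 𝔤]
    {U W : Type*} [AddCommGroup U] [Module ℂ U] [LieRingModule 𝔤 U] [LieModule ℂ 𝔤 U]
    [AddCommGroup W] [Module ℂ W] [LieRingModule 𝔤 W] [LieModule ℂ 𝔤 W]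
    [LieModule.IsIrreducible ℂ 𝔤 U] {f : W →ₗ⁅ℂ, 𝔤⁆ U} (hf : Function.Bijective f)
    (N : LieSubmodule ℂ 𝔤 W) (K : LieSubmodule ℂ 𝔤 N) [LieModule.IsIrreducible ℂ 𝔤 (N ⧸ K)] :
    Nonempty (U ≃ₗ⁅ℂ, 𝔤⁆ (N ⧸ K)) := by
  have := LieModule.nontrivial_of_isIrreducible ℂ 𝔤 (N ⧸ K)
  obtain ⟨q, hq⟩ := exists_ne (0 : N ⧸ K)
  obtain ⟨x, rfl⟩ := LieSubmodule.Quotient.surjective_mk' K q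
  have hxK : x ∉ K := fun h => hq ((LieSubmodule.Quotient.mk_eq_zero K).mpr h)
  let g := f.comp N.incl
  have hg (y : N) (hy : g y = 0) : y = 0 :=
    Subtype.ext ((injective_iff_map_eq_zero f).mp hf.1 _ hy)
  refine nonempty_equiv_of_ker_sup_ne_top g (LieSubmodule.Quotient.mk' K)
    (g.surjective_of_ne_zero (x := x) fun h => ?_) (LieSubmodule.Quotient.surjective_mk' K)
    fun htop => hxK ?_
  · rw [hg x h] at hxK
    exact hxK (zero_mem _)
  · have hx : x ∈ g.ker ⊔ (LieSubmodule.Quotient.mk' K).ker := htop ▸ LieSubmodule.mem_top x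
    obtain ⟨y, hy, z, hz, rfl⟩ := LieSubmodule.mem_sup _ _ _ |>.mp hx
    rw [hg y (g.mem_ker.mp hy), zero_add]
    exact (LieSubmodule.Quotient.mk_eq_zero K).mp (LieModuleHom.mem_ker.mp hz)

/-! ### Full density modules are not subquotients of $A(a)$ or $B(a)$ -/

section Virasoro

/-- The element `L_{pm}` of the Virasoro subalgebra. -/
noncomputable def virL (p : ℕ) (m : ℤ) : vir p :=
  ⟨L p (p * m), Submodule.subset_span (Or.inl ⟨p * m, by simp, rfl⟩)⟩

variable {X U : Type*} [AddCommGroup X] [Module ℂ X] [LieRingModule (vir p) X]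
  [LieModule ℂ (vir p) X] [AddCommGroup U] [Module ℂ U] [LieRingModule (vir p) U]
  [LieModule ℂ (vir p) U]

/-- Weight vectors of a subquotient lift to weight vectors. -/
theorem exists_lift_of_weight_vector (hp : 1 < p) {ξ : ℤ → X}
    (hspan : Submodule.span ℂ (Set.range ξ) = ⊤)
    (hξ : ∀ k : ℤ, ⁅virL p 0, ξ k⁆ = (p * k : ℂ) • ξ k) (N : LieSubmodule ℂ (vir p) X)
    (K : LieSubmodule ℂ (vir p) N) {b : ℂ} {q : N ⧸ K} (hq0 : q ≠ 0)
    (hq : ⁅virL p 0, q⁆ = b • q) :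
    ∃ k : ℤ, b = p * k ∧ ∃ (h : ξ k ∈ N) (t : ℂ), t ≠ 0 ∧
      q = t • LieSubmodule.Quotient.mk' K ⟨ξ k, h⟩ := by
  have hp0 : (p : ℂ) ≠ 0 := by exact_mod_cast (show p ≠ 0 by omega)
  obtain ⟨y, rfl⟩ := LieSubmodule.Quotient.surjective_mk' K q
  have hyK : y ∉ K := fun h => hq0 ((LieSubmodule.Quotient.mk_eq_zero K).mpr h)
  have hyK' : ⁅virL p 0, y⁆ - b • y ∈ K := by
    rw [← LieSubmodule.Quotient.mk_eq_zero, map_sub, LieModuleHom.map_lie, hq, map_smul, sub_self]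
  let H := LieModule.toEnd ℂ (vir p) X (virL p 0)
  let K' : Submodule ℂ X := (K.map N.incl).toSubmodule
  have hK' {z : N} : (z : X) ∈ K' ↔ z ∈ K := by
    constructor
    · intro h
      obtain ⟨z', hz', e⟩ := LieSubmodule.mem_map _ |>.mp h
      rwa [← Subtype.ext e]
    · exact fun h => LieSubmodule.mem_map _ |>.mpr ⟨z, h, rfl⟩
  obtain ⟨f, hf⟩ := Finsupp.mem_span_range_iff_exists_finsupp.mp
    (hspan ▸ Submodule.mem_top : (y : X) ∈ Submodule.span ℂ (Set.range ξ))
  have hinj : Function.Injective fun k : ℤ => (p * k : ℂ) := fun i j hij => by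
    simpa [hp0] using hij
  have hN := Module.End.mem_of_sum_eigenvectors_mem H (W := N.toSubmodule)
    (fun x hx => N.lie_mem hx) hinj f.support (fun k => f k • ξ k)
    (fun k _ => by rw [map_smul]; exact (congrArg _ (hξ k)).trans (smul_comm _ _ _))
    (by rw [show ∑ k ∈ f.support, f k • ξ k = y from hf]; exact y.2)
  -- $(L_0-b)y$ lies in `K`, hence so do its components, and every component of `y` of weight other
  -- than `b` lies in `K`.
  have hKk := Module.End.mem_of_sum_eigenvectors_mem H (W := K')
    (fun x hx => (K.map N.incl).lie_mem hx) hinj f.support (fun k => (f k * (p * k - b)) • ξ k)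
    (fun k _ => by rw [map_smul]; exact (congrArg _ (hξ k)).trans (smul_comm _ _ _))
    (by
      have h1 := hK'.mpr hyK'
      have h2 : ((⁅virL p 0, y⁆ - b • y : N) : X) = ⁅virL p 0, (y : X)⁆ - b • (y : X) := rfl
      rw [h2, ← hf, Finsupp.sum, lie_sum, Finset.smul_sum, ← Finset.sum_sub_distrib] at h1
      convert h1 using 1
      refine Finset.sum_congr rfl fun k _ => ?_
      rw [lie_smul, hξ]
      module)
  have hgood (k : ℤ) (hk : k ∈ f.support) (hkb : (p * k : ℂ) ≠ b) : f k • ξ k ∈ K' := by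
    have := hKk k hk
    rw [mul_comm, mul_smul] at this
    exact (K'.smul_mem_iff (sub_ne_zero.mpr hkb)).mp this
  obtain ⟨k, hk, hkb⟩ : ∃ k ∈ f.support, (p * k : ℂ) = b := by
    by_contra! h
    refine hyK (hK'.mp ?_)
    rw [← hf]
    exact K'.sum_mem fun k hk => hgood k hk (h k hk)
  have hfk : f k ≠ 0 := Finsupp.mem_support_iff.mp hk
  have hξN : ξ k ∈ N := (N.toSubmodule.smul_mem_iff hfk).mp (hN k hk)
  refine ⟨k, hkb.symm, hξN, f k, hfk, ?_⟩
  rw [← map_smul, ← sub_eq_zero, ← map_sub, LieSubmodule.Quotient.mk_eq_zero, ← hK']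
  change (y : X) - f k • ξ k ∈ K'
  rw [← hf, Finsupp.sum, ← Finset.sum_erase_eq_sub hk]
  refine K'.sum_mem fun i hi => hgood i (Finset.mem_of_mem_erase hi) fun h => ?_
  exact Finset.ne_of_mem_erase hi (hinj (h.trans hkb.symm))

/-- Comparison of the structure constants of a full weight family and of a module having it as a
subquotient. -/
theorem exists_scaling_of_subquotient (hp : 1 < p) (h : IsLieSubquotient (vir p) U X)
    {ξ : ℤ → X} {c : ℤ → ℤ → ℂ}
    (hspan : Submodule.span ℂ (Set.range ξ) = ⊤)
    (hξ : ∀ m k : ℤ, ⁅virL p m, ξ k⁆ = c m k • ξ (k + m)) (hc0 : ∀ k : ℤ, c 0 k = p * k)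
    {u : ℤ → U} {b β : ℂ} (hu0 : ∀ k, u k ≠ 0)
    (hu : ∀ m k : ℤ, ⁅virL p m, u k⁆ = (b + p * k + p * m * β) • u (k + m)) :
    ∃ x : ℤ → ℂ, (∀ k, x k ≠ 0) ∧
      ∀ m k : ℤ, (p * k + p * m * β) * x (k + m) = x k * c m k := by
  have hp0 : (p : ℂ) ≠ 0 := by exact_mod_cast (show p ≠ 0 by omega)
  obtain ⟨N, K, ⟨φ⟩⟩ := h
  have hφ0 (k : ℤ) : φ (u k) ≠ 0 := fun h =>
    hu0 k (φ.injective (h.trans (map_zero φ.toLinearEquiv).symm))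
  have hφ (m k : ℤ) : ⁅virL p m, φ (u k)⁆ = (b + p * k + p * m * β) • φ (u (k + m)) := by
    have h1 : φ ⁅virL p m, u k⁆ = ⁅virL p m, φ (u k)⁆ := φ.toLieModuleHom.map_lie _ _
    rw [← h1, hu]
    exact φ.toLinearEquiv.map_smul _ _
  have hex (k : ℤ) := exists_lift_of_weight_vector hp hspan (fun k => by simp [hξ, hc0]) N K
    (hφ0 k) (b := b + p * k) (by simpa using hφ 0 k)
  -- The weights of `U` fill a whole coset of $p\mathbb Z$, so each `ξ k` must survive in the
  -- subquotient and is matched with `u (k - k₀)` up to a nonzero scalar.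
  obtain ⟨k₀, hk₀, -⟩ := hex 0
  have hb : b = p * k₀ := by simpa using hk₀
  have hex' (k : ℤ) : ∃ (h : ξ k ∈ N) (t : ℂ), t ≠ 0 ∧
      φ (u (k - k₀)) = t • LieSubmodule.Quotient.mk' K ⟨ξ k, h⟩ := by
    obtain ⟨l, hl, h⟩ := hex (k - k₀)
    obtain rfl : k = l := by
      rw [hb, ← mul_add] at hl
      have := mul_left_cancel₀ hp0 hl
      push_cast at this
      rw [add_sub_cancel] at this
      exact_mod_cast this
    exact h
  choose hN x hx0 hx using hex'
  refine ⟨x, hx0, fun m k => ?_⟩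
  have h1 := hφ m (k - k₀)
  rw [hx, show k - k₀ + m = k + m - k₀ by ring, hx, lie_smul, smul_smul,
    ← LieModuleHom.map_lie] at h1
  have h2 : ⁅virL p m, (⟨ξ k, hN k⟩ : N)⁆ = c m k • (⟨ξ (k + m), hN (k + m)⟩ : N) :=
    Subtype.ext (hξ m k)
  rw [h2, map_smul, smul_smul] at h1
  have h3 : LieSubmodule.Quotient.mk' K ⟨ξ (k + m), hN (k + m)⟩ ≠ 0 := by
    intro h
    have := hx (k + m)
    rw [h, smul_zero] at this
    exact hφ0 _ this
  have h4 := smul_left_injective ℂ h3 h1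
  rw [h4, hb]
  push_cast
  ring

theorem span_sub_basis {c : ℤ → ℤ → ℂ} (hc : Compat p c)
    (hS : ∀ m n : ℤ, n ∈ {n : ℤ | (n : ZMod p) = 0} → c m n ≠ 0 →
      n + m ∈ {n : ℤ | (n : ZMod p) = 0})
    (ξ : ℤ → ShiftMod.sub p c hc {n : ℤ | (n : ZMod p) = 0} hS)
    (hξ : ∀ k, (ξ k : ShiftMod p c hc) = ShiftMod.v p c hc (p * k)) :
    Submodule.span ℂ (Set.range ξ) = ⊤ := by
  rw [Submodule.eq_top_iff']
  rintro ⟨y, hy⟩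
  change y ∈ Submodule.span ℂ _ at hy
  induction hy using Submodule.span_induction with
  | zero => exact zero_mem _
  | add x y _ _ h h' => exact add_mem h h'
  | smul t x _ h => exact Submodule.smul_mem _ t h
  | mem x hx =>
  obtain ⟨n, hn, rfl⟩ := hx
  obtain ⟨k, rfl⟩ := (ZMod.intCast_zmod_eq_zero_iff_dvd n p).mp hn
  exact Submodule.subset_span ⟨k, Subtype.ext (hξ k)⟩

/-- Leaving $v_0$ has a quadratic coefficient in $A(a)$, which no rescaling makes linear. The entry
$(m,k)=(-1,1)$ gives $\beta=1$, then $(1,1)$ gives $x_2=x_1$, while $(1,0)$ and $(2,0)$ give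
$x_1=x_0(p+a)$ and $x_2=x_0(2p+a)$. -/
theorem not_isLieSubquotient_typeA (hp : 1 < p) (a : ℂ) {u : ℤ → U} {b β : ℂ}
    (hu0 : ∀ k, u k ≠ 0)
    (hu : ∀ m k : ℤ, ⁅virL p m, u k⁆ = (b + p * k + p * m * β) • u (k + m)) :
    ¬ IsLieSubquotient (vir p) U (typeA p a) := by
  intro h
  have hp0 : (p : ℂ) ≠ 0 := by exact_mod_cast (show p ≠ 0 by omega)
  let ξ : ℤ → typeA p a := fun k =>
    ⟨ShiftMod.v p _ _ (p * k), Submodule.subset_span ⟨p * k, by simp, rfl⟩⟩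
  obtain ⟨x, hx0, hx⟩ := exists_scaling_of_subquotient hp h (ξ := ξ)
    (c := fun m k => coeffA p a (p * m) (p * k)) (span_sub_basis _ _ ξ fun _ => rfl)
    (fun m k => Subtype.ext (by
      change ⁅L p (p * m), ShiftMod.v p _ _ (p * k)⁆ = _ • ShiftMod.v p _ _ (p * (k + m))
      rw [ShiftMod.L_lie_v, mul_add]))
    (fun k => by by_cases hk : k = 0 <;> simp [coeffA, hk]) hu0 hu
  have hp' : p ≠ 0 := by omega
  have hn (m k : ℤ) (hk : k ≠ 0) : (k + m * β) * x (k + m) = x k * (m + k) := by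
    have := hx m k
    rw [coeffA, if_pos (by simp), if_pos (by simp [hk, hp'])] at this
    push_cast at this
    refine mul_left_cancel₀ hp0 ?_
    linear_combination this
  have hz (m : ℤ) : m * β * x m = x 0 * (m * (p * m + a)) := by
    have := hx m 0
    rw [coeffA, if_pos (by simp), if_neg (by simp)] at this
    push_cast at this
    rw [zero_add] at this
    refine mul_left_cancel₀ hp0 ?_
    linear_combination this
  have hβ : β = 1 := by
    have := hn (-1) 1 (by decide)
    norm_num [hx0] at this
    linear_combination -this
  have h12 := hn 1 1 (by decide)
  have h1 := hz 1
  have h2 := hz 2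
  rw [hβ] at h12 h1 h2
  norm_num at h12 h1 h2
  have h3 : x 2 = x 1 := by linear_combination h12 / 2
  rw [h3] at h2
  have h4 : (p : ℂ) * x 0 = 0 := by linear_combination h1 - h2 / 2
  exact mul_ne_zero hp0 (hx0 0) h4

/-- Dually, the exception is in arriving at $v_0$. The entry $(1,0)$ gives $\beta=0$, then $(-1,-1)$
gives $x_{-2}=x_{-1}$, while $(1,-1)$ and $(2,-2)$ give $x_0=x_{-1}(p+a)=x_{-2}(2p+a)$. -/
theorem not_isLieSubquotient_typeB (hp : 1 < p) (a : ℂ) {u : ℤ → U} {b β : ℂ}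
    (hu0 : ∀ k, u k ≠ 0)
    (hu : ∀ m k : ℤ, ⁅virL p m, u k⁆ = (b + p * k + p * m * β) • u (k + m)) :
    ¬ IsLieSubquotient (vir p) U (typeB p a) := by
  intro h
  have hp0 : (p : ℂ) ≠ 0 := by exact_mod_cast (show p ≠ 0 by omega)
  let ξ : ℤ → typeB p a := fun k =>
    ⟨ShiftMod.v p _ _ (p * k), Submodule.subset_span ⟨p * k, by simp, rfl⟩⟩
  obtain ⟨x, hx0, hx⟩ := exists_scaling_of_subquotient hp h (ξ := ξ)
    (c := fun m k => coeffB p a (p * m) (p * k)) (span_sub_basis _ _ ξ fun _ => rfl)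
    (fun m k => Subtype.ext (by
      change ⁅L p (p * m), ShiftMod.v p _ _ (p * k)⁆ = _ • ShiftMod.v p _ _ (p * (k + m))
      rw [ShiftMod.L_lie_v, mul_add]))
    (fun k => by by_cases hk : k = 0 <;> simp [coeffB, hk]) hu0 hu
  have hp' : p ≠ 0 := by omega
  have hn (m k : ℤ) (hk : m + k ≠ 0) : (k + m * β) * x (k + m) = x k * k := by
    have := hx m k
    rw [coeffB, if_pos (by simp), if_pos (by rw [← mul_add]; simp [hk, hp'])] at this
    push_cast at this
    refine mul_left_cancel₀ hp0 ?_
    linear_combination this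
  have hz (m : ℤ) : (-m + m * β) * x 0 = -(x (-m) * (m * (p * m + a))) := by
    have := hx m (-m)
    rw [coeffB, if_pos (by simp), if_neg (by rw [← mul_add]; simp), neg_add_cancel] at this
    push_cast at this
    refine mul_left_cancel₀ hp0 ?_
    linear_combination this
  have hβ : β = 0 := by
    have := hn 1 0 (by decide)
    norm_num [hx0] at this
    exact this
  have h12 := hn (-1) (-1) (by decide)
  have h1 := hz 1
  have h2 := hz 2
  rw [hβ] at h12 h1 h2
  norm_num at h12 h1 h2
  have h3 : x (-2) = x (-1) := by linear_combination h12
  rw [h3] at h2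
  have h4 : (p : ℂ) * x (-1) = 0 := by linear_combination h1 - h2 / 2
  exact mul_ne_zero hp0 (hx0 (-1)) h4

end Virasoro

/-! ### Components of $V$ -/

section Components

theorem exists_weight_of_component_ne_bot {a : ℂ} {w : ℤ → V}
    (hw : IsWeightFamily (op p V 0) a w) {z : ℂ} (hz : component p V z ≠ ⊥) :
    ∃ n k : ℤ, w n ≠ 0 ∧ a + n = z + p * k := by
  obtain ⟨k, x, hx, hx0⟩ : ∃ k : ℤ, ∃ x : V, ⁅L p 0, x⁆ = (z + p * k) • x ∧ x ≠ 0 := by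
    by_contra! h
    refine hz ?_
    rw [← LieSubmodule.toSubmodule_eq_bot]
    change (⨆ k : ℤ, eigenL0 p V (z + p * k)) = ⊥
    rw [iSup_eq_bot]
    exact fun k => (Submodule.eq_bot_iff _).mpr fun x hx => h k x hx
  obtain ⟨n, hn⟩ : ∃ n : ℤ, a + n = z + p * k := by
    by_contra! h
    obtain ⟨l, hl1, hl⟩ := Module.End.exists_dual_of_eigenvector (op p V 0) hx hx0
    have hker : Submodule.span ℂ (Set.range w) ≤ LinearMap.ker l := by
      rw [Submodule.span_le]
      rintro _ ⟨n, rfl⟩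
      exact hl _ _ (h n) (hw.eig n)
    rw [hw.span] at hker
    have : l x = 0 := hker Submodule.mem_top
    rw [hl1] at this
    exact one_ne_zero this
  refine ⟨n, k, fun h0 => hx0 ?_, hn⟩
  rw [← hn] at hx
  obtain ⟨t, ht⟩ := hw.mult n x hx
  rw [ht, h0, smul_zero]

/-- Nonvanishing of `w n` depends only on the residue of `n`, so a nonzero component contains a
complete family of density type, without gaps. -/
theorem component_not_isLieSubquotient (hp : 1 < p) {a β : ℂ}
    {F : Matrix {i : ZMod p // i ≠ 0} (ZMod p) ℂ} {w : ℤ → V}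
    (hw : IsWeightFamily (op p V 0) a w) (hsupp : ∀ n : ℤ, w n ≠ 0 ↔ (n : ZMod p) ∈ supp F)
    (hact : ∀ m n : ℤ, w n ≠ 0 → op p V m (w n) = seriesCoeff a β F m n • w (n + m))
    {z : ℂ} (hz : component p V z ≠ ⊥) (e : ℂ) :
    ¬ IsLieSubquotient (vir p) (component p V z) (typeA p e) ∧
      ¬ IsLieSubquotient (vir p) (component p V z) (typeB p e) := by
  obtain ⟨n, l, hn, hnl⟩ := exists_weight_of_component_ne_bot hw hz
  have hne (k : ℤ) : w (n + p * k) ≠ 0 := by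
    rw [hsupp]
    simpa using (hsupp n).mp hn
  let u : ℤ → component p V z := fun k => ⟨w (n + p * k), by
    change _ ∈ ⨆ k : ℤ, eigenL0 p V (z + p * k)
    refine Submodule.mem_iSup_of_mem (l + k) ?_
    change op p V 0 _ = _
    rw [hw.eig]
    congr 1
    push_cast
    rw [← add_assoc, hnl]
    ring⟩
  have hu0 (k : ℤ) : u k ≠ 0 := fun h => hne k (congrArg Subtype.val h)
  have hu (m k : ℤ) : ⁅virL p m, u k⁆ = (a + n + p * k + p * m * β) • u (k + m) := by
    apply Subtype.ext
    change op p V (p * m) (w (n + p * k)) = _ • w (n + p * (k + m))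
    rw [hact _ _ (hne k), seriesCoeff, dif_pos (by simp),
      show n + (p : ℤ) * k + p * m = n + p * (k + m) by ring]
    congr 1
    push_cast
    ring
  exact ⟨not_isLieSubquotient_typeA hp e hu0 hu, not_isLieSubquotient_typeB hp e hu0 hu⟩

/-- An irreducible module with two different components has an active operator. -/
theorem exists_isActive_of_components (hp : 1 < p) [LieModule.IsIrreducible ℂ (GapVir p) V]
    {a : ℂ} {v : ℤ → V} (hv : IsWeightFamily (op p V 0) a v) (hv0 : v 0 ≠ 0) {z w : ℂ}
    (hz : component p V z ≠ ⊥) (hw : component p V w ≠ ⊥) (hzw : ∀ k : ℤ, w ≠ z + p * k) :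
    ∃ s, IsActive p V s := by
  by_contra! h
  have key {n : ℤ} (hn : v n ≠ 0) : ∃ i : ℤ, n = p * i := by
    have : n ∈ {n : ℤ | (n : ZMod p) = 0} := by
      refine mem_of_weight_ne_zero hp hv hv0 (by simp) (fun k hk m hkm => ?_) hn
      refine op_eq_zero_of_not_isActive (fun hm => hkm ?_) (h m) _
      have hk' : (k : ZMod p) = 0 := hk
      change ((k + m : ℤ) : ZMod p) = 0
      rw [Int.cast_add, hk', hm, add_zero]
    exact (ZMod.intCast_zmod_eq_zero_iff_dvd n p).mp this
  obtain ⟨n, k, hn, e⟩ := exists_weight_of_component_ne_bot hv hz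
  obtain ⟨n', k', hn', e'⟩ := exists_weight_of_component_ne_bot hv hw
  obtain ⟨i, rfl⟩ := key hn
  obtain ⟨j, rfl⟩ := key hn'
  refine hzw (k - i + j - k') ?_
  push_cast at e e' ⊢
  linear_combination e - e'

end Components

end GapVir

/-! ### Assembly of the two cases -/

theorem theorem4p3 (p : ℕ) (hp : 1 < p)
    (V : Type*) [AddCommGroup V] [Module ℂ V] [LieRingModule (GapVir p) V]
    [LieModule ℂ (GapVir p) V] (hirr : LieModule.IsIrreducible ℂ (GapVir p) V)
    (hV : GapVir.IsIntermediateSeries p V) :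
    (∃ (α β : ℂ) (F : Matrix {i : ZMod p // i ≠ 0} (ZMod p) ℂ) (hF : GapVir.Admissible F),
      IsLieSubquotient (GapVir p) V (GapVir.series p α β F hF) ∧
      (¬ LieModule.IsTrivial (GapVir p) V →
        ∀ (N : LieSubmodule ℂ (GapVir p) (GapVir.series p α β F hF))
          (K : LieSubmodule ℂ (GapVir p) N),
          LieModule.IsIrreducible ℂ (GapVir p) (N ⧸ K) →
          ¬ LieModule.IsTrivial (GapVir p) (N ⧸ K) →
          Nonempty (V ≃ₗ⁅ℂ, GapVir p⁆ (N ⧸ K)))) ∧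
    (∀ z w : ℂ, GapVir.component p V z ≠ ⊥ → GapVir.component p V w ≠ ⊥ →
      (∀ k : ℤ, w ≠ z + p * k) →
      ∀ a : ℂ,
        ¬ IsLieSubquotient (GapVir.vir p) (GapVir.component p V z) (GapVir.typeA p a) ∧
        ¬ IsLieSubquotient (GapVir.vir p) (GapVir.component p V z) (GapVir.typeB p a)) := by
  open GapVir in
  obtain ⟨a, v, hv0, hv⟩ := exists_weightFamily hp hV
  by_cases hact : ∃ s, IsActive p V s
  · obtain ⟨s₀, hs₀⟩ := hact
    obtain ⟨κ, -, hκ⟩ := exists_central_character hp hV.1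
    have hcomm : OpsCommute p V := by
      intro r s hr hs x
      by_cases hrs : r + s = 0
      · obtain rfl : s = -r := by omega
        have h0 := central_eq_zero hp hr (hκ r (C_mem_cartan _)) hv hv0
        have h1 := op_neg_comm hr (hκ r (C_mem_cartan _)) x
        rwa [h0, mul_zero, zero_smul, add_zero] at h1
      · exact op_comm hr hs hrs x
    obtain ⟨β, F, w, hF, hw, hsupp, hwact⟩ :=
      exists_series_coefficients hp hcomm (hκ 0 (C_mem_cartan 0)) hv hv0 hs₀
    refine ⟨⟨a, β, F, hF, ?_⟩, fun z _ hz _ _ e =>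
      component_not_isLieSubquotient hp hw hsupp hwact hz e⟩
    obtain ⟨f, hf⟩ := exists_bijective_of_series_coefficients hp hF hw hsupp hwact
    refine ⟨isLieSubquotient_of_surjective (f.comp (⊤ : LieSubmodule _ _ _).incl) fun y => ?_,
      fun _ N K hNK _ => nonempty_equiv_subquotient_of_bijective hf N K⟩
    obtain ⟨x, rfl⟩ := hf.2 y
    exact ⟨⟨x, LieSubmodule.mem_top x⟩, rfl⟩
  · refine ⟨?_, fun z w hz hw hzw =>
      absurd (exists_isActive_of_components hp hv hv0 hz hw hzw) hact⟩
    by_cases ht : LieModule.IsTrivial (GapVir p) V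
    · exact ⟨0, 1, 0, admissible_zero, isLieSubquotient_of_isTrivial hp, fun h => absurd ht h⟩
    · obtain ⟨α, β, N₀, f, hf⟩ := exists_density_cover_of_L_eq_zero hp hV
        (fun s hs x => op_eq_zero_of_not_isActive hs (fun h => hact ⟨s, h⟩) x) ht
      exact ⟨α, β, 0, admissible_zero, isLieSubquotient_of_surjective f hf, fun _ N K hNK hnt =>
        density_subquotient_unique hp f (LieSubmodule.Quotient.mk' K) hf
          (LieSubmodule.Quotient.surjective_mk' K) ht hnt⟩
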